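/- Notation. Let $D=(d_1,\dots,d_n)$ be a sequence of positive integers with $d_1\le\cdots\le d_n$ and put $M=\sum_{i=1}^n d_i$. For $j\in[n]$ let $S_j=\sum_{i=n-d_j}^{n} d_i$ and let $\ell(D)=\max\{j\in[n] : S_j\le M/2\}$. For $\varepsilon,\nu>0$, $D$ is a strict graphic sequence of type $(\varepsilon,\nu)$ if (1) $\sum_{i=n-m+1}^{n} d_i< m(m-1)+\sum_{i=1}^{n-m}\min\{m,d_i\}$ for all $1\le m\le n$; (2) $M$ is even and $M\ge n^{1+\varepsilon}$; (3) $\ell(D)$ exists and $\sqrt{n/M}\,\bigl(d_n-d_{\ell(D)}+1\bigr)<n^{-\nu}$. Let $\mathbb P^D$ be the set of all symmetric arrays $(x_{ij})_{i\ne j\in[n]}$ with $0\le x_{ij}\le 1$ and $\sum_{j\neq i}x_{ij}=d_i$ for all $i$, and let $\widetilde{\mathbf p}=(\widetilde p_{ij})$ be the maximizer on $\mathbb P^D$ of $\sum_{i<j}\bigl(-x_{ij}\ln x_{ij}-(1-x_{ij})\ln(1-x_{ij})\bigr)$. Let $\widetilde{\mathcal G}(D)$ be the random graph on $[n]$ in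 which the edges $\{i,j\}$ are present independently with probabilities $\widetilde p_{ij}$. For $\tfrac12<a<1$ let $\mathcal G_{\mathbf a}(a,D)$ be uniformly distributed on the set $\mathbb G_a^D$ of all simple graphs on $[n]$ whose degrees $\bar d_i$ satisfy $|d_i-\bar d_i|<d_i^{a}$ for all $i$. Let $\mathbb T^k$ be the set of all trees with vertex set $[k]$ and $\mathbb S_n^k$ the set of all injections $s:[k]\to[n]$. For $(s,T)\in\mathbb S_n^k\times\mathbb T^k$ let $\psi(s,T,D)=\prod_{u\in[k]} d_{s(u)}^{\,b_u-1}$, where $b_u$ is the degree of $u$ in $T$, and let $\mathbf p_{\mathbf a}(s,T)$ and $\widetilde{\mathbf p}(s,T)$ be the probabilities that $s$ maps every edge of $T$ to an edge of $\mathcal G_{\mathbf a}(a,D)$ and of $\widetilde{\mathcal G}(D)$, respectively. Put $$L_{\mathbf a}(a,k,D)=\frac1M\sum_{(s,T)\in\mathbb S_n^k\times\mathbb T^k}\frac{1}{\psi(s,T,D)}\bigl|\mathbf p_{\mathbf a}(s,T)-\widetilde{\mathbf p}(s,T)\bigr|.$$ Theorem. For every $k$ there is a constant $c_k>0$, depending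 only on $k$, such that for all $\varepsilon,\nu>0$ and all $a$ with $\tfrac12<a<\tfrac{\nu}{4}+\tfrac12$ there is an $N$ such that, for every $n\ge N$ and every strict graphic sequence $D=(d_1,\dots,d_n)$ of type $(\varepsilon,\nu)$, $$L_{\mathbf a}(a,k,D)\le c_k\, n^{\,a-\frac{\nu+1}{2}},$$ and the right-hand side tends to $0$ as $n\to\infty$. -/

import Mathlib

namespace AlmostDegree

open scoped Classical

noncomputable section

variable {n k : ℕ}

/-- `M`, the sum of the entries of `D`. -/
def total (D : Fin n → ℕ) : ℕ := ∑ i, D i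

/-- The strict Erdős–Gallai conditions for a nondecreasing sequence. The vertex called `i + 1` in
one-based numbering is the element `i` of `Fin n`. -/
def StrictErdosGallai (D : Fin n → ℕ) : Prop :=
  ∀ m : ℕ, 1 ≤ m → m ≤ n →
    ∑ i ∈ Finset.univ.filter (fun i : Fin n => n - m ≤ (i : ℕ)), D i
      < m * (m - 1) +
          ∑ i ∈ Finset.univ.filter (fun i : Fin n => (i : ℕ) < n - m), min m (D i)

/-- `S_j`, the sum of `d_i` over the (one-based) indices `i ∈ {n - d_j, …, n}`. -/
def upperSum (D : Fin n → ℕ) (j : Fin n) : ℕ :=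
  ∑ i ∈ Finset.univ.filter (fun i : Fin n => n ≤ ((i : ℕ) + 1) + D j), D i

/-- `ℓ` is the largest index with `S_ℓ ≤ M / 2`. -/
def IsEll (D : Fin n → ℕ) (ℓ : Fin n) : Prop :=
  IsGreatest {j : Fin n | (upperSum D j : ℝ) ≤ (total D : ℝ) / 2} ℓ

/-- Strict graphic sequences of type `(ε, ν)`. The last condition includes that the index `ℓ`
exists; `last` is the last index, so `D last` is the largest entry. -/
structure IsStrictGraphicOfType (ε ν : ℝ) (D : Fin n → ℕ) : Prop where
  pos : ∀ i, 1 ≤ D i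
  mono : Monotone D
  strictErdosGallai : StrictErdosGallai D
  even_total : Even (total D)
  le_total : (n : ℝ) ^ (1 + ε) ≤ (total D : ℝ)
  gap : ∃ ℓ last : Fin n, (last : ℕ) + 1 = n ∧ IsEll D ℓ ∧
    Real.sqrt ((n : ℝ) / (total D : ℝ)) * ((D last : ℝ) - (D ℓ : ℝ) + 1) < (n : ℝ) ^ (-ν)

/-- The polytope `P^D`: edge weights `x_{ij} = x_{ji} ∈ [0, 1]`, `i ≠ j`, whose sum at each vertex
`i` is `d_i`. The diagonal entries are not coordinates of the polytope and are set to `0`. -/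
def polytope (D : Fin n → ℕ) : Set (Fin n → Fin n → ℝ) :=
  {x | (∀ i j, x i j = x j i) ∧ (∀ i, x i i = 0) ∧ (∀ i j, 0 ≤ x i j ∧ x i j ≤ 1) ∧
    ∀ i, ∑ j with j ≠ i, x i j = D i}

/-- The entropy `H₁(x) = ∑_{i < j} H(x_{ij})`, with
`H(t) = - t ln t - (1 - t) ln (1 - t)`. -/
def entropy (x : Fin n → Fin n → ℝ) : ℝ :=
  ∑ i, ∑ j with i < j, Real.binEntropy (x i j)

/-- `p` maximizes the entropy over the polytope `P^D`. -/
def IsMaxEntropy (D : Fin n → ℕ) (p : Fin n → Fin n → ℝ) : Prop :=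
  p ∈ polytope D ∧ ∀ x ∈ polytope D, entropy x ≤ entropy p

/-- The point of maximum entropy of `P^D` (unique if `P^D` is non-empty). -/
def maxEntropy (D : Fin n → ℕ) : Fin n → Fin n → ℝ :=
  if h : ∃ p, IsMaxEntropy D p then h.choose else 0

/-- The probability of the graph `G` when each edge `{i, j}` is present independently with
probability `p i j`. -/
def bernoulliProb (p : Fin n → Fin n → ℝ) (G : SimpleGraph (Fin n)) : ℝ :=
  ∏ i, ∏ j with i < j, if G.Adj i j then p i j else 1 - p i j

/-- `G^D`: the graphs in which each vertex `i` has degree `d_i`. -/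
def graphsWithDegrees (D : Fin n → ℕ) : Set (SimpleGraph (Fin n)) :=
  {G | ∀ i, G.degree i = D i}

/-- `G_a^D`: the union of the sets `G^{D'}` over all `D'` with `|d_i - d'_i| < d_i ^ a` for
all `i`. -/
def almostGraphs (a : ℝ) (D : Fin n → ℕ) : Set (SimpleGraph (Fin n)) :=
  ⋃ (D' : Fin n → ℕ) (_ : ∀ i, |(D i : ℝ) - (D' i : ℝ)| < (D i : ℝ) ^ a), graphsWithDegrees D'

/-- `1_s(T, G)`: the indicator that `s` maps every edge of `T` to an edge of `G`. -/
def treeIndicator (s : Fin k ↪ Fin n) (T : SimpleGraph (Fin k)) (G : SimpleGraph (Fin n)) : ℝ :=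
  ∏ e ∈ T.edgeFinset, if e.map s ∈ G.edgeSet then 1 else 0

/-- `p_a(s, T)`: the expectation of `1_s(T, G)` for `G` uniform on `G_a^D`. -/
def probAlmost (a : ℝ) (D : Fin n → ℕ) (s : Fin k ↪ Fin n) (T : SimpleGraph (Fin k)) : ℝ :=
  (∑ G ∈ Finset.univ.filter (fun G : SimpleGraph (Fin n) => G ∈ almostGraphs a D),
      treeIndicator s T G) /
    ((Finset.univ.filter fun G : SimpleGraph (Fin n) => G ∈ almostGraphs a D).card : ℝ)

/-- `p̃(s, T)`: the expectation of `1_s(T, G)` for the random graph `G` with independent edges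
whose probabilities are given by the point of maximum entropy. -/
def probIndep (D : Fin n → ℕ) (s : Fin k ↪ Fin n) (T : SimpleGraph (Fin k)) : ℝ :=
  ∑ G : SimpleGraph (Fin n), bernoulliProb (maxEntropy D) G * treeIndicator s T G

/-- The B-function `ψ(s, T, D) = ∏_u d_{s(u)} ^ (b_u - 1)`, where `b_u` is the degree of `u`
in `T`. -/
def bFunction (s : Fin k ↪ Fin n) (T : SimpleGraph (Fin k)) (D : Fin n → ℕ) : ℝ :=
  ∏ u, (D (s u) : ℝ) ^ ((T.degree u : ℤ) - 1)

/-- `L_a(a, k, D)`: the weighted sum over all ordered trees `(s, T)`, where `T` runs over the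
labelled trees on `k` vertices and `s` over the injections of `k` vertices into `n`. -/
def treeError (a : ℝ) (k : ℕ) (D : Fin n → ℕ) : ℝ :=
  1 / (total D : ℝ) *
    ∑ s : Fin k ↪ Fin n, ∑ T : SimpleGraph (Fin k) with T.IsTree,
      1 / bFunction s T D * |probAlmost a D s T - probIndep D s T|

end

end AlmostDegree

/-! The argument compares the uniform measure on `almostGraphs a D` with the product measure P of
the maximum-entropy probabilities. P enters through dual variables: p_ij = sigmoid (l_i + l_j), so
P(G) depends on G only through its degrees (`IsDual.bernoulliProb_eq_exp`).

Change of measure. If 1/|A| ≤ e^K P(G) for every G in A, Jensen's inequality bounds the average over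
A of any f with E_P e^f ≤ 1 by K (`average_le_of_sum_exp_le`). The f used is a multiple of the
signed sum, over all ordered trees, of 1/ψ times (tree indicator − its P-probability), minus a
compensator. Telescoping along an enumeration of the edges writes the sum as Σ_e c_e (x_e − p_e),
with c_e a function of earlier bits only; so f is the exponent of an exponential supermartingale
(`sum_exp_predictable`). The weight 1/ψ is exactly what bounds every c_e by a constant C = C(k) on A
(`IsDual.abs_edgeCoeff_le`): rooting a tree at one end of e turns the weighted count of embeddings
into iterated row sums, each at most 3. With step size r/C and compensator r² Σ p_e ≤ r² M this
yields (r/C) M L ≤ K + M r², hence L ≤ 2Cr as soon as K ≤ M r².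

Size of K. Let |l_i| ≤ Λ. On A the degrees differ from d_i by less than d_i^a, so P varies on A by a
factor at most exp(2Λ Σ d_i^a), and it remains to bound P(A) below (`IsDual.prob_almostGraphs_ge`).
Vertices of degree at least n^ν concentrate by Chernoff. The others may be too small for that, so
their edges are fixed outright: the fractional weights p on the edges meeting them are rounded to
0/1, keeping their degrees exactly and moving the other degrees by at most 3 (`exists_isRounding`).
Forcing this configuration costs a factor exp(−O((Λ + 1) n^{1+ν})).

Dual variables. Strict Erdős–Gallai, read as cut inequalities and integrated over thresholds, makes
the dual function coercive, so l exists (`StrictErdosGallai.exists_isDual`). The definition of ℓ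
forces l_ℓ ≤ 6 log n; the degree gap limits how many dual values lie deep below zero, while
strictness forbids long empty intervals among them. Together, Λ = O((d_n − d_ℓ + 1) log n)
(`IsDual.abs_le`), and the gap condition gives K ≤ M r² for r = n^{a−(ν+1)/2}
(`relative_entropy_le`). -/

namespace AlmostDegree

open scoped Classical

noncomputable section

/-! ### Products of Bernoulli measures -/

section Bernoulli

variable {E : Type*} [Fintype E]

/-- The weight of `ω` under the product of Bernoulli measures with parameters `p`. -/
def bitWeight (p : E → ℝ) (ω : E → Bool) : ℝ := ∏ e, if ω e then p e else 1 - p e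

/-- The real value of a bit. -/
def bit (b : Bool) : ℝ := if b then 1 else 0

theorem bit_nonneg (b : Bool) : 0 ≤ bit b := by cases b <;> simp [bit]

theorem sum_prod_bits [DecidableEq E] (g : E → Bool → ℝ) :
    ∑ ω : E → Bool, ∏ e, g e (ω e) = ∏ e, (g e true + g e false) := by
  rw [← Fintype.piFinset_univ, ← Finset.prod_univ_sum]
  simp

theorem sum_bitWeight_mul_prod [DecidableEq E] (p : E → ℝ) (g : E → Bool → ℝ) :
    ∑ ω : E → Bool, bitWeight p ω * ∏ e, g e (ω e)
      = ∏ e, (p e * g e true + (1 - p e) * g e false) := by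
  simp only [bitWeight, ← Finset.prod_mul_distrib]
  rw [sum_prod_bits (fun e b => (if b then p e else 1 - p e) * g e b)]
  simp

theorem bitWeight_nonneg {p : E → ℝ} (hp : ∀ e, 0 ≤ p e ∧ p e ≤ 1) (ω : E → Bool) :
    0 ≤ bitWeight p ω := by
  refine Finset.prod_nonneg fun e _ => ?_
  have := hp e
  split_ifs <;> linarith

/-- Follows from 1 + u ≤ e^u and e^b − 1 − b ≤ b² on |b| ≤ 1. The factor p in the exponent matters:
summed over all edges it costs at most M, not n². -/
theorem bernoulli_exp_le {p b : ℝ} (hp : 0 ≤ p) (hb : |b| ≤ 1) :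
    p * Real.exp (b * (1 - p)) + (1 - p) * Real.exp (b * (0 - p)) ≤ Real.exp (b ^ 2 * p) := by
  have h1 : p * Real.exp (b * (1 - p)) + (1 - p) * Real.exp (b * (0 - p))
      = Real.exp (-(b * p)) * (p * (Real.exp b - 1) + 1) := by
    rw [show b * (1 - p) = -(b * p) + b by ring, show b * (0 - p) = -(b * p) by ring, Real.exp_add]
    ring
  have h2 := Real.add_one_le_exp (p * (Real.exp b - 1))
  have h3 := (abs_le.1 (Real.abs_exp_sub_one_sub_id_le hb)).2
  rw [h1]
  calc Real.exp (-(b * p)) * (p * (Real.exp b - 1) + 1)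
      ≤ Real.exp (-(b * p)) * Real.exp (p * (Real.exp b - 1)) := by gcongr
    _ = Real.exp (p * (Real.exp b - 1 - b)) := by rw [← Real.exp_add]; ring_nf
    _ ≤ _ := by
      apply Real.exp_le_exp.2
      nlinarith

/-- The last bit is integrated out first: its coefficient depends only on earlier bits, and the
compensator θ²p pays for its exponential moment. -/
theorem sum_exp_predictable_fin (N : ℕ) (p : Fin N → ℝ) (hp : ∀ e, 0 ≤ p e ∧ p e ≤ 1) (θ : ℝ)
    (hθ : θ ≤ 1) (b : Fin N → (Fin N → Bool) → ℝ) (hb : ∀ e ω, |b e ω| ≤ θ)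
    (hpre : ∀ e ω ω', (∀ f < e, ω f = ω' f) → b e ω = b e ω') :
    ∑ ω : Fin N → Bool, bitWeight p ω *
      Real.exp (∑ e, (b e ω * (bit (ω e) - p e) - θ ^ 2 * p e)) ≤ 1 := by
  induction N with
  | zero => simp [bitWeight]
  | succ N ih =>
    rw [← (Fin.snocEquiv fun _ => Bool).sum_comp, Fintype.sum_prod_type_right]
    -- The value `false` in the last coordinate is a dummy: by predictability no coefficient depends
    -- on it.
    have key := ih (fun e => p e.castSucc) (fun e => hp _)
      (fun e ω => b e.castSucc (Fin.snoc ω false)) (fun e ω => hb _ _) (by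
        intro e ω ω' h
        apply hpre
        intro f hf
        have hf' : (f : ℕ) < N := by
          have := e.2
          have h2 : (f : ℕ) < e := hf
          omega
        obtain ⟨g, rfl⟩ : ∃ g : Fin N, g.castSucc = f := ⟨⟨f, hf'⟩, rfl⟩
        simp only [Fin.snoc_castSucc]
        exact h g (by simpa using hf))
    refine le_trans (Finset.sum_le_sum fun ω _ => ?_) key
    have hbc : ∀ (c : Bool) (e : Fin N), b e.castSucc (Fin.snoc ω c : Fin (N + 1) → Bool)
        = b e.castSucc (Fin.snoc ω false : Fin (N + 1) → Bool) := by
      intro c e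
      apply hpre
      intro f hf
      have hf' : (f : ℕ) < N := by
        have := e.2
        have h2 : (f : ℕ) < e := hf
        omega
      obtain ⟨g, rfl⟩ : ∃ g : Fin N, g.castSucc = f := ⟨⟨f, hf'⟩, rfl⟩
      simp only [Fin.snoc_castSucc]
    have hbl : ∀ (c : Bool), b (Fin.last N) (Fin.snoc ω c : Fin (N + 1) → Bool)
        = b (Fin.last N) (Fin.snoc ω false : Fin (N + 1) → Bool) := by
      intro c
      apply hpre
      intro f hf
      have hf' : (f : ℕ) < N := hf
      obtain ⟨g, rfl⟩ : ∃ g : Fin N, g.castSucc = f := ⟨⟨f, hf'⟩, rfl⟩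
      simp only [Fin.snoc_castSucc]
    set W := bitWeight (fun e : Fin N => p e.castSucc) ω
    set X := ∑ e : Fin N, (b e.castSucc (Fin.snoc ω false : Fin (N + 1) → Bool)
      * (bit (ω e) - p e.castSucc) - θ ^ 2 * p e.castSucc)
    set β := b (Fin.last N) (Fin.snoc ω false : Fin (N + 1) → Bool) with hβ
    set q := p (Fin.last N)
    have hterm : ∀ c : Bool, bitWeight p (Fin.snoc ω c : Fin (N + 1) → Bool) *
        Real.exp (∑ e, (b e (Fin.snoc ω c : Fin (N + 1) → Bool)
          * (bit ((Fin.snoc ω c : Fin (N + 1) → Bool) e) - p e) - θ ^ 2 * p e))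
        = W * Real.exp X * ((if c then q else 1 - q) * Real.exp (β * (bit c - q)) *
            Real.exp (-(θ ^ 2 * q))) := by
      intro c
      rw [bitWeight, Fin.prod_univ_castSucc, Fin.sum_univ_castSucc]
      simp only [Fin.snoc_castSucc, Fin.snoc_last, hbc c, hbl c]
      rw [Real.exp_add, show β * (bit c - q) - θ ^ 2 * q = β * (bit c - q) + -(θ ^ 2 * q) by ring,
        Real.exp_add]
      simp only [W, X, bitWeight]
      ring
    simp only [Fin.snocEquiv, Equiv.coe_fn_mk]
    rw [Finset.sum_congr rfl fun c _ => hterm c, ← Finset.mul_sum]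
    have hW : 0 ≤ W := bitWeight_nonneg (fun e => hp _) ω
    have hβ1 : |β| ≤ θ := hb _ _
    have hq := hp (Fin.last N)
    have hs : ∑ c : Bool, ((if c then q else 1 - q) * Real.exp (β * (bit c - q)) *
            Real.exp (-(θ ^ 2 * q))) ≤ 1 := by
      have h1 := bernoulli_exp_le (p := q) (b := β) hq.1 (hβ1.trans hθ)
      simp only [Fintype.sum_bool, bit, if_true, Bool.false_eq_true, if_false]
      rw [← add_mul]
      calc _ ≤ Real.exp (β ^ 2 * q) * Real.exp (-(θ ^ 2 * q)) := by gcongr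
        _ = Real.exp (β ^ 2 * q - θ ^ 2 * q) := by rw [← Real.exp_add]; ring_nf
        _ ≤ 1 := by
          apply Real.exp_le_one_iff.2
          have : β ^ 2 ≤ θ ^ 2 := sq_le_sq' (abs_le.1 hβ1).1 (abs_le.1 hβ1).2
          nlinarith [hq.1]
    calc _ ≤ W * Real.exp X * 1 := by gcongr
      _ = _ := mul_one _

/-- Exponential supermartingale bound for a predictable transform of the centred bits. -/
theorem sum_exp_predictable [DecidableEq E] {N : ℕ} (o : E ≃ Fin N) (p : E → ℝ)
    (hp : ∀ e, 0 ≤ p e ∧ p e ≤ 1) (θ : ℝ)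
    (hθ : θ ≤ 1) (b : E → (E → Bool) → ℝ) (hb : ∀ e ω, |b e ω| ≤ θ)
    (hpre : ∀ e ω ω', (∀ f, o f < o e → ω f = ω' f) → b e ω = b e ω') :
    ∑ ω : E → Bool, bitWeight p ω *
      Real.exp (∑ e, (b e ω * (bit (ω e) - p e) - θ ^ 2 * p e)) ≤ 1 := by
  have key := sum_exp_predictable_fin N (fun i => p (o.symm i)) (fun e => hp _) θ hθ
    (fun i ω => b (o.symm i) (fun e => ω (o e))) (fun e ω => hb _ _) (by
      intro e ω ω' h
      apply hpre
      intro f hf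
      apply h
      rwa [o.apply_symm_apply] at hf)
  refine le_trans (le_of_eq ?_) key
  refine Fintype.sum_equiv (Equiv.arrowCongr o (Equiv.refl Bool)) _ _ fun ω => ?_
  have e1 : (fun e => ((Equiv.arrowCongr o (Equiv.refl Bool)) ω) (o e)) = ω := by
    funext e
    simp [Equiv.arrowCongr]
  simp only [bitWeight]
  rw [← o.symm.prod_comp, ← o.symm.sum_comp]
  simp only [e1]
  simp [Equiv.arrowCongr]

end Bernoulli

/-- The telescoping expansion of a difference of products along an enumeration. -/
theorem prod_sub_prod_ordered {E : Type*} {N : ℕ} (o : E ≃ Fin N) (F : Finset E) (x p : E → ℝ) :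
    ∏ e ∈ F, x e - ∏ e ∈ F, p e = ∑ e ∈ F, (x e - p e) *
      ((∏ f ∈ F with o f < o e, x f) * ∏ f ∈ F with o e < o f, p f) := by
  have h := Finset.prod_add_ordered (F.map o.toEmbedding) (fun i => p (o.symm i))
    (fun i => x (o.symm i) - p (o.symm i))
  simp only [add_sub_cancel, Finset.prod_map, Finset.sum_map, Equiv.coe_toEmbedding,
    Equiv.symm_apply_apply, Finset.filter_map, Function.comp_def] at h
  rw [h, add_sub_cancel_left]
  refine Finset.sum_congr rfl fun e _ => ?_
  rw [mul_assoc]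


/-- Jensen for exp under the uniform measure on A, whose density with respect to P is at most e^K.
Only this one-sided density bound is needed. -/
theorem average_le_of_sum_exp_le {Ω : Type*} [Fintype Ω] (A : Finset Ω) (hA : A.Nonempty)
    (P f : Ω → ℝ) (hP : ∀ ω, 0 ≤ P ω) (K : ℝ)
    (hK : ∀ ω ∈ A, 1 / (A.card : ℝ) ≤ Real.exp K * P ω)
    (hf : ∑ ω, P ω * Real.exp (f ω) ≤ 1) :
    (∑ ω ∈ A, f ω) / A.card ≤ K := by
  have hc : (0 : ℝ) < A.card := by exact_mod_cast hA.card_pos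
  have hJ := convexOn_exp.map_sum_le (t := A) (w := fun _ => 1 / (A.card : ℝ)) (p := f)
    (fun _ _ => by positivity) (by simp [hc.ne']) (fun _ _ => Set.mem_univ _)
  simp only [smul_eq_mul, ← Finset.mul_sum] at hJ
  have h1 : 1 / (A.card : ℝ) * ∑ ω ∈ A, Real.exp (f ω) ≤ Real.exp K := by
    rw [Finset.mul_sum]
    calc ∑ ω ∈ A, 1 / (A.card : ℝ) * Real.exp (f ω)
        ≤ ∑ ω ∈ A, Real.exp K * (P ω * Real.exp (f ω)) := by
          refine Finset.sum_le_sum fun ω hω => ?_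
          rw [← mul_assoc]
          exact mul_le_mul_of_nonneg_right (hK ω hω) (Real.exp_pos _).le
      _ ≤ ∑ ω, Real.exp K * (P ω * Real.exp (f ω)) := by
          refine Finset.sum_le_sum_of_subset_of_nonneg (Finset.subset_univ _) fun ω _ _ => ?_
          have := hP ω
          positivity
      _ ≤ Real.exp K := by
          rw [← Finset.mul_sum]
          exact mul_le_of_le_one_right (Real.exp_pos _).le hf
  have := Real.exp_le_exp.1 (hJ.trans h1)
  rw [div_eq_inv_mul, ← one_div]
  exact this

/-! ### Degree sequences with strict Erdős–Gallai conditions -/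

section DegreeSequence

variable {n : ℕ}

theorem card_filter_top {m : ℕ} (hm : m ≤ n) :
    (Finset.univ.filter fun i : Fin n => n - m ≤ (i : ℕ)).card = m := by
  have h := Finset.card_filter_add_card_filter_not (s := (Finset.univ : Finset (Fin n)))
    (fun i : Fin n => (i : ℕ) < n - m)
  rw [Fin.card_filter_val_lt] at h
  simp only [not_lt, Finset.card_univ, Fintype.card_fin] at h
  omega

/-- Among weights in `[0, 1]` of integral total mass `m`, the indicator of the last `m` indices
maximizes the weighted sum of a monotone function. -/
theorem sum_weight_mul_le_sum_top {h w : Fin n → ℝ} (hh : Monotone h)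
    (hw : ∀ i, 0 ≤ w i ∧ w i ≤ 1) {m : ℕ} (hm : m ≤ n) (hs : ∑ i, w i = m) :
    ∑ i, w i * h i ≤ ∑ i ∈ Finset.univ.filter (fun i : Fin n => n - m ≤ (i : ℕ)), h i := by
  rcases Nat.eq_zero_or_pos m with rfl | hpos
  · have : ∀ i, w i = 0 := fun i => by
      have := (Finset.sum_eq_zero_iff_of_nonneg (s := Finset.univ) fun i _ => (hw i).1).1
        (by simpa using hs)
      exact this i (Finset.mem_univ i)
    have hempty : (Finset.univ.filter fun i : Fin n => n - 0 ≤ (i : ℕ)) = ∅ := by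
      ext i
      have := i.2
      simp
    rw [hempty]
    simp [this]
  · have hlt : n - m < n := by omega
    -- c is the smallest value among the last m indices; h − c is nonnegative on them and
    -- nonpositive elsewhere.
    set c := h ⟨n - m, hlt⟩
    have key : ∀ i : Fin n, w i * h i - (if n - m ≤ (i : ℕ) then h i else 0)
        ≤ c * (w i - if n - m ≤ (i : ℕ) then 1 else 0) := by
      intro i
      have := hw i
      split_ifs with hi
      · have : c ≤ h i := hh (by simpa [Fin.le_def] using hi)
        nlinarith
      · have : h i ≤ c := hh (by simp only [Fin.le_def]; omega)
        nlinarith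
    have h1 := Finset.sum_le_sum fun i (_ : i ∈ Finset.univ) => key i
    rw [Finset.sum_sub_distrib, ← Finset.mul_sum, Finset.sum_sub_distrib, hs,
      ← Finset.sum_filter, ← Finset.sum_filter, Finset.sum_const, card_filter_top hm] at h1
    simpa using h1

/-- Adding Σ_A min(m, d) to both sides leaves a right side depending on m alone, while the left side
sums the monotone function d + min(m, d) over A, so the last m indices are the worst case.
Integrality turns strictness into the gap 1. -/
theorem StrictErdosGallai.sum_lt {D : Fin n → ℕ} (hD : StrictErdosGallai D) (hmono : Monotone D)
    {A : Finset (Fin n)} (hA : A.Nonempty) :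
    (∑ i ∈ A, (D i : ℝ)) + 1
      ≤ A.card * ((A.card : ℝ) - 1) + ∑ i ∈ Aᶜ, min (A.card : ℝ) (D i) := by
  set m := A.card with hm
  have hm1 : 1 ≤ m := hA.card_pos
  have hmn : m ≤ n := by simpa using Finset.card_le_univ A
  have h0 := hD m hm1 hmn
  set Top := Finset.univ.filter fun i : Fin n => n - m ≤ (i : ℕ)
  have hc : (Finset.univ.filter fun i : Fin n => (i : ℕ) < n - m) = Topᶜ := by
    ext i; simp only [Top, Finset.mem_filter, Finset.mem_univ, true_and, Finset.mem_compl, not_le]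
  rw [hc] at h0
  have h0' : (∑ i ∈ Top, (D i : ℝ)) + 1 ≤ m * ((m : ℝ) - 1) + ∑ i ∈ Topᶜ, min (m : ℝ) (D i) := by
    have h2 : (((∑ i ∈ Top, D i) + 1 : ℕ) : ℝ)
      ≤ ((m * (m - 1) + ∑ i ∈ Topᶜ, min m (D i) : ℕ) : ℝ) := by exact_mod_cast h0
    push_cast [Nat.cast_sub hm1] at h2
    exact h2
  have hmon : Monotone fun i => (D i : ℝ) + min (m : ℝ) (D i) := by
    intro i j hij
    have : (D i : ℝ) ≤ D j := by exact_mod_cast hmono hij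
    simp only
    gcongr
  have h3 := sum_weight_mul_le_sum_top hmon (w := fun i => if i ∈ A then 1 else 0)
    (fun i => by split_ifs <;> simp) hmn (by simp [hm])
  simp only [ite_mul, one_mul, zero_mul, Finset.sum_ite_mem, Finset.univ_inter] at h3
  rw [Finset.sum_add_distrib, Finset.sum_add_distrib] at h3
  have h4 := Finset.sum_add_sum_compl A fun i => min (m : ℝ) (D i)
  have h5 := Finset.sum_add_sum_compl Top fun i => min (m : ℝ) (D i)
  change _ ≤ ∑ i ∈ Top, (D i : ℝ) + ∑ i ∈ Top, min (m : ℝ) (D i) at h3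
  linarith

/-- The strict Erdős–Gallai conditions in the form of a cut inequality. -/
theorem StrictErdosGallai.cut_inequality {D : Fin n → ℕ} (hD : StrictErdosGallai D)
    (hmono : Monotone D) (hpos : ∀ i, 1 ≤ D i) {A B : Finset (Fin n)} (hAB : Disjoint A B)
    (hne : (A ∪ B).Nonempty) :
    (∑ i ∈ A, (D i : ℝ)) + 1 ≤ A.card * ((Bᶜ.card : ℝ) - 1) + ∑ i ∈ B, (D i : ℝ) := by
  rcases A.eq_empty_or_nonempty with rfl | hA
  · rw [Finset.empty_union] at hne
    have : (1 : ℝ) ≤ ∑ i ∈ B, (D i : ℝ) := by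
      calc (1 : ℝ) ≤ B.card := by exact_mod_cast hne.card_pos
        _ = ∑ i ∈ B, (1 : ℝ) := by simp
        _ ≤ _ := Finset.sum_le_sum fun i _ => by exact_mod_cast hpos i
    simpa using this
  · have h := hD.sum_lt hmono hA
    have hsub : B ⊆ Aᶜ := by
      intro i hi
      rw [Finset.mem_compl]
      exact fun hA => (Finset.disjoint_left.1 hAB) hA hi
    rw [← Finset.sum_sdiff hsub] at h
    -- min(|A|, d_i) is bounded by |A| off B and by d_i on B.
    have h1 : ∑ i ∈ Aᶜ \ B, min (A.card : ℝ) (D i) ≤ (Aᶜ \ B).card * (A.card : ℝ) := by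
      rw [← nsmul_eq_mul]
      exact Finset.sum_le_card_nsmul _ _ _ fun i _ => min_le_left _ _
    have h2 : ∑ i ∈ B, min (A.card : ℝ) (D i) ≤ ∑ i ∈ B, (D i : ℝ) :=
      Finset.sum_le_sum fun i _ => min_le_right _ _
    have h3 : ((Aᶜ \ B).card : ℝ) = Bᶜ.card - A.card := by
      have h4 : (Aᶜ \ B).card + A.card = Bᶜ.card := by
        rw [← Finset.card_union_of_disjoint]
        · congr 1
          ext i
          simp only [Finset.mem_union, Finset.mem_sdiff, Finset.mem_compl]
          have : i ∈ A → i ∉ B := fun h => Finset.disjoint_left.1 hAB h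
          tauto
        · rw [Finset.disjoint_left]
          intro i hi
          exact Finset.mem_compl.1 (Finset.mem_sdiff.1 hi).1
      rw [← h4]; push_cast; ring
    rw [h3] at h1
    nlinarith

/-! ### Coercivity of the dual function by integration over thresholds -/

theorem integral_indicator_Ioo (a b : ℝ) :
    ∫ t, (Set.Ioo a b).indicator (1 : ℝ → ℝ) t = max (b - a) 0 := by
  rw [MeasureTheory.integral_indicator_one measurableSet_Ioo, Real.volume_real_Ioo]

theorem integrable_indicator_Ioo (a b : ℝ) :
    MeasureTheory.Integrable ((Set.Ioo a b).indicator (1 : ℝ → ℝ)) :=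
  (MeasureTheory.integrable_indicator_iff measurableSet_Ioo).2
    (MeasureTheory.integrableOn_const (by simp))

theorem integral_indicator_Ioc (a b : ℝ) :
    ∫ t, (Set.Ioc a b).indicator (1 : ℝ → ℝ) t = max (b - a) 0 := by
  rw [MeasureTheory.integral_indicator_one measurableSet_Ioc, Real.volume_real_Ioc]

theorem integrable_indicator_Ioc (a b : ℝ) :
    MeasureTheory.Integrable ((Set.Ioc a b).indicator (1 : ℝ → ℝ)) :=
  (MeasureTheory.integrable_indicator_iff measurableSet_Ioc).2
    (MeasureTheory.integrableOn_const (by simp))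

/-- For t > 0 this is the cut inequality for A = {l > t} and B = {l ≤ −t}; its extra 1 is available
whenever A ∪ B is nonempty, in particular when t < |l o|. The half-open interval matches the
non-strict inequality in B, so that the bound holds at every t. -/
theorem StrictErdosGallai.indicator_le {D : Fin n → ℕ} (hD : StrictErdosGallai D)
    (hmono : Monotone D) (hpos : ∀ i, 1 ≤ D i) (l : Fin n → ℝ) (o : Fin n) (t : ℝ) :
    (Set.Ioo 0 |l o|).indicator (1 : ℝ → ℝ) t ≤
      (∑ i, ∑ j with j ≠ i, (Set.Ioo (max (-l j) 0) (l i)).indicator (1 : ℝ → ℝ) t)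
      - ∑ i, (D i : ℝ) * ((Set.Ioo 0 (l i)).indicator (1 : ℝ → ℝ) t
          - (Set.Ioc 0 (-l i)).indicator (1 : ℝ → ℝ) t) := by
  rcases le_or_gt t 0 with ht | ht
  · have h1 : ∀ i j, (Set.Ioo (max (-l j) 0) (l i)).indicator (1 : ℝ → ℝ) t = 0 := fun i j =>
      Set.indicator_of_notMem (fun h => absurd (lt_of_le_of_lt (le_max_right _ _) h.1) ht.not_gt) _
    have h2 : ∀ x : ℝ, (Set.Ioo 0 x).indicator (1 : ℝ → ℝ) t = 0 := fun x =>
      Set.indicator_of_notMem (fun h => absurd h.1 ht.not_gt) _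
    have h3 : ∀ x : ℝ, (Set.Ioc 0 x).indicator (1 : ℝ → ℝ) t = 0 := fun x =>
      Set.indicator_of_notMem (fun h => absurd h.1 ht.not_gt) _
    simp [h1, h2, h3]
  · set A := Finset.univ.filter fun i => t < l i
    set B := Finset.univ.filter fun i => l i ≤ -t
    have e1 : ∀ x : ℝ, (Set.Ioo 0 x).indicator (1 : ℝ → ℝ) t = if t < x then 1 else 0 := fun x => by
      simp [Set.indicator_apply, ht]
    have e2 : ∀ x : ℝ, (Set.Ioc 0 (-x)).indicator (1 : ℝ → ℝ) t = if x ≤ -t then 1 else 0 :=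
      fun x => by simp [Set.indicator_apply, ht, le_neg]
    have e3 : ∀ x y : ℝ, (Set.Ioo (max (-y) 0) x).indicator (1 : ℝ → ℝ) t
        = if t < x then (if ¬ y ≤ -t then 1 else 0) else 0 := fun x y => by
      have : -y < t ↔ ¬ y ≤ -t := by rw [not_le]; exact neg_lt
      simp only [Set.indicator_apply, Set.mem_Ioo, max_lt_iff, ht, and_true, this, Pi.one_apply]
      split_ifs <;> first | rfl | (exfalso; tauto)
    have hdisj : Disjoint A B := by
      rw [Finset.disjoint_left]
      intro i hi hi'
      simp only [A, B, Finset.mem_filter, Finset.mem_univ, true_and] at hi hi'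
      linarith
    have hpair : (∑ i, ∑ j with j ≠ i, (Set.Ioo (max (-l j) 0) (l i)).indicator (1 : ℝ → ℝ) t)
        = A.card * ((Bᶜ.card : ℝ) - 1) := by
      simp only [e3]
      have hin : ∀ i ∈ A, (∑ j with j ≠ i, if ¬ l j ≤ -t then (1 : ℝ) else 0) = Bᶜ.card - 1 := by
        intro i hi
        rw [Finset.sum_boole, Finset.filter_filter]
        have : (Finset.univ.filter fun j => j ≠ i ∧ ¬ l j ≤ -t) = Bᶜ.erase i := by
          ext j; simp [B]
        rw [this, Finset.card_erase_of_mem, Nat.cast_sub]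
        · simp
        · exact Finset.card_pos.2 ⟨i, Finset.mem_compl.2 (Finset.disjoint_left.1 hdisj hi)⟩
        · exact Finset.mem_compl.2 (Finset.disjoint_left.1 hdisj hi)
      calc _ = ∑ i, if t < l i then (∑ j with j ≠ i, if ¬ l j ≤ -t then (1 : ℝ) else 0) else 0 := by
            refine Finset.sum_congr rfl fun i _ => ?_
            split_ifs <;> simp
        _ = ∑ i ∈ A, (∑ j with j ≠ i, if ¬ l j ≤ -t then (1 : ℝ) else 0) := by
            rw [← Finset.sum_filter]
        _ = _ := by rw [Finset.sum_congr rfl hin, Finset.sum_const, nsmul_eq_mul]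
    have hlin : ∑ i, (D i : ℝ) * ((Set.Ioo 0 (l i)).indicator (1 : ℝ → ℝ) t
          - (Set.Ioc 0 (-l i)).indicator (1 : ℝ → ℝ) t)
        = ∑ i ∈ A, (D i : ℝ) - ∑ i ∈ B, (D i : ℝ) := by
      simp only [e1, e2, mul_sub, mul_ite, mul_one, mul_zero, Finset.sum_sub_distrib,
        Finset.sum_ite, Finset.sum_const_zero, add_zero, A, B]
    rw [hpair, hlin, e1]
    by_cases hne : (A ∪ B).Nonempty
    · have := hD.cut_inequality hmono hpos hdisj hne
      split_ifs <;> linarith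
    · rw [Finset.not_nonempty_iff_eq_empty, Finset.union_eq_empty] at hne
      have ho : ¬ t < |l o| := by
        intro h
        rcases lt_abs.1 h with h | h
        · have : o ∈ A := by simp [A, h]
          rw [hne.1] at this; simp at this
        · have : o ∈ B := by simp only [B, Finset.mem_filter, Finset.mem_univ, true_and]; linarith
          rw [hne.2] at this; simp at this
      rw [if_neg ho]
      simp [hne.1, hne.2]

/-- The two terms are the lengths of {t > 0 : −y < t < x} and {t > 0 : −x < t < y}, which is the
form produced by the threshold sets. -/
theorem posPart_add_eq (x y : ℝ) :
    max (x + y) 0 = max (x - max (-y) 0) 0 + max (y - max (-x) 0) 0 := by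
  rcases le_total 0 x with hx | hx <;> rcases le_total 0 y with hy | hy <;>
    rcases le_total 0 (x + y) with h | h <;>
    simp only [max_def] <;> split_ifs <;> linarith

theorem sum_offDiag_comm (f : Fin n → Fin n → ℝ) :
    ∑ i, ∑ j with j ≠ i, f i j = ∑ i, ∑ j with j ≠ i, f j i := by
  simp only [Finset.sum_filter]
  rw [Finset.sum_comm]
  simp only [ne_comm]

/-- The integral of `indicator_le` over t. Sums over ordered pairs count each edge twice, whence the
factors 2. -/
theorem StrictErdosGallai.two_mul_abs_le {D : Fin n → ℕ} (hD : StrictErdosGallai D)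
    (hmono : Monotone D) (hpos : ∀ i, 1 ≤ D i) (l : Fin n → ℝ) (o : Fin n) :
    2 * |l o| ≤ (∑ i, ∑ j with j ≠ i, max (l i + l j) 0) - 2 * ∑ i, (D i : ℝ) * l i := by
  have hI := MeasureTheory.integral_mono (integrable_indicator_Ioo 0 |l o|)
    (g := fun t => (∑ i, ∑ j with j ≠ i,
        (Set.Ioo (max (-l j) 0) (l i)).indicator (1 : ℝ → ℝ) t)
      - ∑ i, (D i : ℝ) * ((Set.Ioo 0 (l i)).indicator (1 : ℝ → ℝ) t
          - (Set.Ioc 0 (-l i)).indicator (1 : ℝ → ℝ) t))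
    (by
      refine MeasureTheory.Integrable.sub ?_ ?_
      · exact MeasureTheory.integrable_finsetSum _ fun i _ =>
          MeasureTheory.integrable_finsetSum _ fun j _ => integrable_indicator_Ioo _ _
      · exact MeasureTheory.integrable_finsetSum _ fun i _ =>
          ((integrable_indicator_Ioo _ _).sub (integrable_indicator_Ioc _ _)).const_mul _)
    (hD.indicator_le hmono hpos l o)
  rw [integral_indicator_Ioo, MeasureTheory.integral_sub, MeasureTheory.integral_finsetSum,
    MeasureTheory.integral_finsetSum] at hI
  rotate_left
  · exact fun i _ => ((integrable_indicator_Ioo _ _).sub (integrable_indicator_Ioc _ _)).const_mul _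
  · exact fun i _ => MeasureTheory.integrable_finsetSum _ fun j _ => integrable_indicator_Ioo _ _
  · exact MeasureTheory.integrable_finsetSum _ fun i _ =>
          MeasureTheory.integrable_finsetSum _ fun j _ => integrable_indicator_Ioo _ _
  · exact MeasureTheory.integrable_finsetSum _ fun i _ =>
          ((integrable_indicator_Ioo _ _).sub (integrable_indicator_Ioc _ _)).const_mul _
  have e1 : ∀ i, ∫ t, (D i : ℝ) * ((Set.Ioo 0 (l i)).indicator (1 : ℝ → ℝ) t
          - (Set.Ioc 0 (-l i)).indicator (1 : ℝ → ℝ) t) = D i * l i := by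
    intro i
    rw [MeasureTheory.integral_const_mul, MeasureTheory.integral_sub (integrable_indicator_Ioo _ _)
      (integrable_indicator_Ioc _ _), integral_indicator_Ioo, integral_indicator_Ioc]
    congr 1
    rcases le_total 0 (l i) with h | h
    · rw [max_eq_left (by linarith), max_eq_right (by linarith)]; ring
    · rw [max_eq_right (by linarith), max_eq_left (by linarith)]; ring
  have e2 : ∀ i, ∫ t, (∑ j with j ≠ i, (Set.Ioo (max (-l j) 0) (l i)).indicator (1 : ℝ → ℝ) t)
      = ∑ j with j ≠ i, max (l i - max (-l j) 0) 0 := by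
    intro i
    rw [MeasureTheory.integral_finsetSum _ fun j _ => integrable_indicator_Ioo _ _]
    simp only [integral_indicator_Ioo]
  simp only [e1, e2] at hI
  have e3 : (∑ i, ∑ j with j ≠ i, max (l i + l j) 0)
      = 2 * ∑ i, ∑ j with j ≠ i, max (l i - max (-l j) 0) 0 := by
    simp only [posPart_add_eq, Finset.sum_add_distrib]
    rw [sum_offDiag_comm (fun i j => max (l j - max (-l i) 0) 0)]
    ring
  rw [e3]
  have : max (|l o| - 0) 0 = |l o| := by rw [sub_zero]; exact max_eq_left (abs_nonneg _)
  rw [this] at hI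
  linarith

/-! ### The point of maximum entropy -/

/-- The log-partition function of a Bernoulli variable. -/
def softplus (t : ℝ) : ℝ := Real.log (1 + Real.exp t)

theorem max_zero_le_softplus (t : ℝ) : max t 0 ≤ softplus t := by
  have := Real.exp_pos t
  apply max_le
  · rw [softplus, Real.le_log_iff_exp_le (by positivity)]; linarith
  · exact Real.log_nonneg (by linarith)

theorem sigmoid_eq_exp_div (t : ℝ) : Real.sigmoid t = Real.exp t / (1 + Real.exp t) := by
  rw [Real.sigmoid_def, Real.exp_neg]
  have := Real.exp_pos t
  field_simp
  ring

theorem one_sub_sigmoid (t : ℝ) : 1 - Real.sigmoid t = 1 / (1 + Real.exp t) := by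
  rw [sigmoid_eq_exp_div]
  have := Real.exp_pos t
  field_simp
  ring

theorem hasDerivAt_softplus (t : ℝ) : HasDerivAt softplus (Real.sigmoid t) t := by
  rw [sigmoid_eq_exp_div]
  have := Real.exp_pos t
  exact ((Real.hasDerivAt_exp t).const_add 1).log (by positivity)

theorem continuous_softplus : Continuous softplus :=
  continuous_iff_continuousAt.2 fun t => (hasDerivAt_softplus t).continuousAt

theorem log_sigmoid (t : ℝ) : Real.log (Real.sigmoid t) = t - softplus t := by
  have := Real.exp_pos t
  rw [sigmoid_eq_exp_div, Real.log_div (by positivity) (by positivity), Real.log_exp, softplus]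

theorem log_one_sub_sigmoid (t : ℝ) : Real.log (1 - Real.sigmoid t) = - softplus t := by
  have := Real.exp_pos t
  rw [one_sub_sigmoid, Real.log_div (by positivity) (by positivity), Real.log_one, softplus]
  ring

/-- Concavity: the tangent at p lies above the graph. The equality case later yields uniqueness of
the maximizer. -/
theorem negMulLog_le {x p : ℝ} (hx : 0 ≤ x) (hp : 0 < p) :
    Real.negMulLog x ≤ -(x * Real.log p) + (p - x) ∧
      (Real.negMulLog x = -(x * Real.log p) + (p - x) → x = p) := by
  rcases hx.eq_or_lt with rfl | hx
  · simp [hp.le]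
  · have e : Real.negMulLog x = -(x * Real.log p) + x * Real.log (p / x) := by
      rw [Real.log_div hp.ne' hx.ne', Real.negMulLog]; ring
    by_cases h : p / x = 1
    · have : p = x := by field_simp at h; exact h
      subst this
      simp [Real.negMulLog]
    · have h1 := Real.log_lt_sub_one_of_pos (by positivity : 0 < p / x) h
      have h2 : x * Real.log (p / x) < p - x := by
        calc _ < x * (p / x - 1) := by gcongr
          _ = _ := by field_simp
      refine ⟨by rw [e]; linarith, fun h3 => ?_⟩
      rw [e] at h3
      linarith

/-- Gibbs' inequality for Bernoulli variables, with its equality case. -/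
theorem binEntropy_le_softplus {x : ℝ} (hx : 0 ≤ x) (hx1 : x ≤ 1) (t : ℝ) :
    Real.binEntropy x ≤ softplus t - x * t ∧
      (Real.binEntropy x = softplus t - x * t → x = Real.sigmoid t) := by
  have h1 := negMulLog_le hx (Real.sigmoid_pos t)
  have h2 := negMulLog_le (sub_nonneg.2 hx1) (sub_pos.2 (Real.sigmoid_lt_one t))
  rw [log_sigmoid] at h1
  rw [log_one_sub_sigmoid] at h2
  rw [Real.binEntropy_eq_negMulLog_add_negMulLog_one_sub]
  constructor
  · linarith [h1.1, h2.1]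
  · intro h
    apply h1.2
    linarith [h1.1, h2.1]

theorem binEntropy_sigmoid (t : ℝ) :
    Real.binEntropy (Real.sigmoid t) = softplus t - Real.sigmoid t * t := by
  rw [Real.binEntropy_eq_negMulLog_add_negMulLog_one_sub, Real.negMulLog, Real.negMulLog,
    log_sigmoid, log_one_sub_sigmoid]
  ring

/-- The vector `l` is a dual solution: the edge probabilities `sigmoid (l i + l j)` have expected
degrees `D`. -/
def IsDual (D : Fin n → ℕ) (l : Fin n → ℝ) : Prop :=
  ∀ i, ∑ j with j ≠ i, Real.sigmoid (l i + l j) = D i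

/-- Softplus dominates the positive part, so F grows at least like the norm and attains its minimum;
vanishing of the gradient there is the system of degree equations. -/
theorem StrictErdosGallai.exists_isDual {D : Fin n → ℕ} (hD : StrictErdosGallai D)
    (hmono : Monotone D) (hpos : ∀ i, 1 ≤ D i) : ∃ l, IsDual D l := by
  let F : (Fin n → ℝ) → ℝ := fun l =>
    (∑ i, ∑ j with j ≠ i, softplus (l i + l j)) - 2 * ∑ i, (D i : ℝ) * l i
  have hF : ∀ l, ‖l‖ ≤ F l := by
    intro l
    have hsp : (∑ i, ∑ j with j ≠ i, max (l i + l j) 0)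
        ≤ ∑ i, ∑ j with j ≠ i, softplus (l i + l j) :=
      Finset.sum_le_sum fun i _ => Finset.sum_le_sum fun j _ => max_zero_le_softplus _
    rcases isEmpty_or_nonempty (Fin n) with he | ⟨⟨o⟩⟩
    · have : l = 0 := Subsingleton.elim _ _
      subst this
      simp [F]
    · have h0 : ∀ o, |l o| ≤ F l := fun o => by
        have := hD.two_mul_abs_le hmono hpos l o
        have h2 := abs_nonneg (l o)
        simp only [F]
        linarith
      exact (pi_norm_le_iff_of_nonneg ((abs_nonneg _).trans (h0 o))).2 h0
  have hcont : Continuous F := by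
    have := continuous_softplus
    fun_prop
  obtain ⟨l, hl⟩ := hcont.exists_forall_le
    (Filter.tendsto_atTop_mono hF (tendsto_norm_cocompact_atTop (E := Fin n → ℝ)))
  refine ⟨l, fun i => ?_⟩
  -- Variation in the single coordinate i; the derivative is twice (expected degree − d_i).
  let δ : Fin n → ℝ := fun a => if a = i then 1 else 0
  have hder : HasDerivAt (fun t : ℝ => F fun a => l a + t * δ a)
      ((∑ a, ∑ b with b ≠ a, Real.sigmoid (l a + l b) * (δ a + δ b))
        - 2 * ∑ a, (D a : ℝ) * δ a) 0 := by
    have hlin : ∀ a, HasDerivAt (fun t : ℝ => l a + t * δ a) (δ a) 0 := fun a => by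
      simpa using ((hasDerivAt_id (0 : ℝ)).mul_const (δ a)).const_add (l a)
    refine HasDerivAt.sub ?_ ?_
    · refine HasDerivAt.fun_sum fun a _ => HasDerivAt.fun_sum fun b _ => ?_
      have h1 := (hlin a).add (hlin b)
      have h2 : HasDerivAt softplus (Real.sigmoid (l a + l b))
          ((fun t : ℝ => l a + t * δ a) 0 + (fun t : ℝ => l b + t * δ b) 0) := by
        simpa using hasDerivAt_softplus (l a + l b)
      exact HasDerivAt.comp (h₂ := softplus) (0 : ℝ) h2 h1
    · exact (HasDerivAt.fun_sum fun a _ => (hlin a).const_mul (D a : ℝ)).const_mul 2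
  have hmin : IsLocalMin (fun t : ℝ => F fun a => l a + t * δ a) 0 := by
    refine Filter.Eventually.of_forall fun t => ?_
    simpa using hl fun a => l a + t * δ a
  have h0 := hmin.hasDerivAt_eq_zero hder
  have e1 : (∑ a, ∑ b with b ≠ a, Real.sigmoid (l a + l b) * (δ a + δ b))
      = 2 * ∑ j with j ≠ i, Real.sigmoid (l i + l j) := by
    simp only [mul_add, Finset.sum_add_distrib]
    rw [sum_offDiag_comm (fun a b => Real.sigmoid (l a + l b) * δ b)]
    have : ∑ a, ∑ b with b ≠ a, Real.sigmoid (l a + l b) * δ a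
        = ∑ j with j ≠ i, Real.sigmoid (l i + l j) := by
      simp only [← Finset.sum_mul]
      simp [δ]
    have h2 : ∑ a, ∑ b with b ≠ a, Real.sigmoid (l b + l a) * δ a
        = ∑ j with j ≠ i, Real.sigmoid (l i + l j) := by
      rw [← this]
      refine Finset.sum_congr rfl fun a _ => Finset.sum_congr rfl fun b _ => ?_
      rw [add_comm]
    rw [this, h2]; ring
  have e2 : ∑ a, (D a : ℝ) * δ a = D i := by simp [δ]
  rw [e1, e2] at h0
  linarith

theorem sum_lt_mul_add {x : Fin n → Fin n → ℝ} (hx : ∀ i j, x i j = x j i) (l : Fin n → ℝ) :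
    ∑ i, ∑ j with i < j, x i j * (l i + l j) = ∑ i, (∑ j with j ≠ i, x i j) * l i := by
  have h1 : ∀ i, (∑ j with j ≠ i, x i j) * l i
      = ∑ j with i < j, x i j * l i + ∑ j with j < i, x i j * l i := by
    intro i
    rw [Finset.sum_mul, ← Finset.sum_union]
    · refine Finset.sum_congr ?_ fun _ _ => rfl
      ext j
      simp only [Finset.mem_filter, Finset.mem_univ, true_and, Finset.mem_union]
      rw [ne_comm]
      exact lt_or_lt_iff_ne.symm
    · rw [Finset.disjoint_left]
      intro j hj hj'
      simp only [Finset.mem_filter, Finset.mem_univ, true_and] at hj hj'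
      exact absurd hj hj'.not_gt
  simp only [h1, Finset.sum_add_distrib, mul_add]
  congr 1
  simp only [Finset.sum_filter]
  rw [Finset.sum_comm]
  refine Finset.sum_congr rfl fun j _ => Finset.sum_congr rfl fun i _ => ?_
  rw [hx]

/-- Gibbs' inequality, summed over edges, bounds the entropy by softplus terms minus a linear
functional that depends only on the degrees and is therefore constant on the polytope. Equality
forces every coordinate, which identifies the maximizer picked by choice. -/
theorem IsDual.maxEntropy_eq {D : Fin n → ℕ} {l : Fin n → ℝ} (hl : IsDual D l) :
    maxEntropy D = fun i j => if i = j then 0 else Real.sigmoid (l i + l j) := by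
  set p : Fin n → Fin n → ℝ := fun i j => if i = j then 0 else Real.sigmoid (l i + l j) with hp
  have hpoly : p ∈ polytope D := by
    refine ⟨fun i j => ?_, fun i => by simp [hp], fun i j => ?_, fun i => ?_⟩
    · simp only [hp, eq_comm (a := i), add_comm (l i)]
    · simp only [hp]
      split_ifs
      · simp
      · exact ⟨Real.sigmoid_nonneg _, Real.sigmoid_le_one _⟩
    · rw [← hl i]
      refine Finset.sum_congr rfl fun j hj => ?_
      have : j ≠ i := by simpa using hj
      simp [hp, this.symm]
  set Z := (∑ i, ∑ j with i < j, softplus (l i + l j)) - ∑ i, (D i : ℝ) * l i with hZ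
  have hval : ∀ x ∈ polytope D,
      (∑ i, ∑ j with i < j, (softplus (l i + l j) - x i j * (l i + l j))) = Z := by
    intro x hx
    simp only [Finset.sum_sub_distrib]
    rw [sum_lt_mul_add hx.1 l]
    simp only [hx.2.2.2, hZ]
  have hle : ∀ x ∈ polytope D, ∀ i j, Real.binEntropy (x i j)
      ≤ softplus (l i + l j) - x i j * (l i + l j) := fun x hx i j =>
    (binEntropy_le_softplus (hx.2.2.1 i j).1 (hx.2.2.1 i j).2 _).1
  have hpZ : entropy p = Z := by
    rw [← hval p hpoly, entropy]
    refine Finset.sum_congr rfl fun i _ => Finset.sum_congr rfl fun j hj => ?_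
    have hij : i ≠ j := ne_of_lt (by simpa using hj)
    simp only [hp, if_neg hij]
    exact binEntropy_sigmoid _
  have hmax : IsMaxEntropy D p := by
    refine ⟨hpoly, fun x hx => ?_⟩
    rw [hpZ, ← hval x hx, entropy]
    exact Finset.sum_le_sum fun i _ => Finset.sum_le_sum fun j _ => hle x hx i j
  have hex : ∃ p, IsMaxEntropy D p := ⟨p, hmax⟩
  rw [maxEntropy, dif_pos hex]
  set q := hex.choose
  have hq : IsMaxEntropy D q := hex.choose_spec
  have hqZ : entropy q = Z := le_antisymm (hpZ ▸ hmax.2 q hq.1) (hpZ ▸ hq.2 p hpoly)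
  have heq : ∀ i j, i < j → q i j = p i j := by
    intro i j hij
    rw [← hval q hq.1, entropy] at hqZ
    have h1 := (Finset.sum_eq_sum_iff_of_le fun i _ =>
      Finset.sum_le_sum fun j _ => hle q hq.1 i j).1 hqZ i (Finset.mem_univ i)
    have h2 := (Finset.sum_eq_sum_iff_of_le fun j _ => hle q hq.1 i j).1 h1 j (by simpa using hij)
    rw [(binEntropy_le_softplus (hq.1.2.2.1 i j).1 (hq.1.2.2.1 i j).2 _).2 h2]
    simp [hp, hij.ne]
  funext i j
  rcases lt_trichotomy i j with h | h | h
  · exact heq i j h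
  · subst h
    rw [hq.1.2.1, hpoly.2.1]
  · rw [hq.1.1, hpoly.1, heq j i h]

end DegreeSequence

/-! ### Bounds for the dual solution -/

section DualBound

variable {n : ℕ}

theorem sigmoid_le_exp (t : ℝ) : Real.sigmoid t ≤ Real.exp t := by
  rw [sigmoid_eq_exp_div]
  have := Real.exp_pos t
  exact div_le_self this.le (by linarith)

theorem one_sub_sigmoid_le_exp (t : ℝ) : 1 - Real.sigmoid t ≤ Real.exp (-t) := by
  rw [← Real.sigmoid_neg]
  exact sigmoid_le_exp _

theorem neg_mul_log_le_of_le_sigmoid {x t : ℝ} {k : ℕ} (hx : 0 < x)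
    (h : 1 / x ^ k ≤ Real.sigmoid t) : -(k * Real.log x) ≤ t := by
  have h1 := h.trans (sigmoid_le_exp t)
  rw [← Real.log_le_iff_le_exp (by positivity)] at h1
  simpa [Real.log_pow] using h1

theorem le_mul_log_of_le_one_sub_sigmoid {x t : ℝ} {k : ℕ} (hx : 0 < x)
    (h : 1 / x ^ k ≤ 1 - Real.sigmoid t) : t ≤ k * Real.log x := by
  rw [← Real.sigmoid_neg] at h
  linarith [neg_mul_log_le_of_le_sigmoid hx h]

variable {D : Fin n → ℕ} {l : Fin n → ℝ}

theorem IsDual.sum_ite (hl : IsDual D l) (i : Fin n) :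
    ∑ j, (if i = j then 0 else Real.sigmoid (l i + l j)) = D i := by
  rw [← hl i, Finset.sum_filter]
  refine Finset.sum_congr rfl fun j _ => ?_
  by_cases h : i = j
  · simp [h]
  · simp [h, Ne.symm h]

theorem IsDual.add_one_le (hl : IsDual D l) (i : Fin n) : D i + 1 ≤ n := by
  have h1 : (D i : ℝ) ≤ ((n - 1 : ℕ) : ℝ) := by
    rw [← hl i]
    calc _ ≤ ∑ j with j ≠ i, (1 : ℝ) := Finset.sum_le_sum fun j _ => Real.sigmoid_le_one _
      _ = _ := by
        rw [Finset.sum_const, Finset.filter_ne', Finset.card_erase_of_mem (Finset.mem_univ i)]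
        simp
  have h2 : D i ≤ n - 1 := by exact_mod_cast h1
  have := i.2
  omega

theorem IsDual.exists_inv_le (hl : IsDual D l) (hpos : ∀ i, 1 ≤ D i) (i : Fin n) :
    ∃ j, j ≠ i ∧ 1 / (n : ℝ) ≤ Real.sigmoid (l i + l j) := by
  by_contra hcon
  push Not at hcon
  have hn : (0 : ℝ) < n := by
    have := i.2
    exact_mod_cast (by omega : 0 < n)
  have h1 : (1 : ℝ) ≤ D i := by exact_mod_cast hpos i
  have hne : (Finset.univ.filter fun j => j ≠ i).Nonempty := by
    by_contra h
    rw [Finset.not_nonempty_iff_eq_empty] at h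
    have := hl i
    rw [h, Finset.sum_empty] at this
    linarith
  have h2 : (D i : ℝ) < ∑ j with j ≠ i, 1 / (n : ℝ) := by
    rw [← hl i]
    exact Finset.sum_lt_sum_of_nonempty hne fun j hj => hcon j (by simpa using hj)
  have h3 : ∑ j with j ≠ i, 1 / (n : ℝ) ≤ 1 := by
    rw [Finset.sum_const, nsmul_eq_mul]
    have : ((Finset.univ.filter fun j => j ≠ i).card : ℝ) ≤ n := by
      exact_mod_cast (Finset.card_le_univ _).trans (by simp)
    rw [mul_one_div, div_le_one hn]
    exact this
  linarith

/-- The rows of i and j are compared after swapping i and j, which matches the missing diagonal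
entries and the common entry p_ij. -/
theorem IsDual.mono (hl : IsDual D l) {i j : Fin n} (h : l i ≤ l j) : D i ≤ D j := by
  rcases eq_or_ne i j with rfl | hij
  · exact le_rfl
  have : (D i : ℝ) ≤ D j := by
    rw [← hl.sum_ite i, ← hl.sum_ite j, ← Equiv.sum_comp (Equiv.swap i j)
      (fun v => if j = v then 0 else Real.sigmoid (l j + l v))]
    refine Finset.sum_le_sum fun v _ => ?_
    by_cases hvi : v = i
    · subst hvi
      simp
    · by_cases hvj : v = j
      · subst hvj
        simp only [Equiv.swap_apply_right, if_neg hij, if_neg hij.symm, add_comm (l v)]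
        exact le_rfl
      · rw [Equiv.swap_apply_of_ne_of_ne hvi hvj, if_neg (Ne.symm hvi), if_neg (Ne.symm hvj)]
        exact Real.sigmoid_le (by linarith)
  exact_mod_cast this

/-- Take w_u = p_eu with w_e = 1. Its mass is d_e + 1, so Σ w d ≤ S_e ≤ M/2, and expanding gives Σ
p_uv (1 − w_u)(1 − w_v) ≥ Σ p_uv w_u w_v ≥ n⁻². Some pair then has all three factors at least n⁻⁴:
l_u + l_v ≥ −4 log n, while l_e + l_u and l_e + l_v are at most 4 log n. Adding gives 2 l_e ≤ 12 log
n. -/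
theorem IsDual.ell_le (hl : IsDual D l) (hmono : Monotone D) (hpos : ∀ i, 1 ≤ D i) {e : Fin n}
    (he : (upperSum D e : ℝ) ≤ (total D : ℝ) / 2) : l e ≤ 6 * Real.log n := by
  have hn : (0 : ℝ) < n := by
    have := e.2
    exact_mod_cast (by omega : 0 < n)
  let P : Fin n → Fin n → ℝ := fun u v => if u = v then 0 else Real.sigmoid (l u + l v)
  let w : Fin n → ℝ := fun u => if e = u then 1 else Real.sigmoid (l e + l u)
  have hP0 : ∀ u v, 0 ≤ P u v := fun u v => by
    simp only [P]; split_ifs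
    · exact le_rfl
    · exact Real.sigmoid_nonneg _
  have hP1 : ∀ u v, P u v ≤ 1 := fun u v => by
    simp only [P]; split_ifs
    · simp
    · exact Real.sigmoid_le_one _
  have hPs : ∀ u v, P u v = P v u := fun u v => by
    simp only [P, eq_comm (a := u), add_comm (l u)]
  have hw : ∀ u, 0 ≤ w u ∧ w u ≤ 1 := fun u => by
    simp only [w]; split_ifs
    · simp
    · exact ⟨Real.sigmoid_nonneg _, Real.sigmoid_le_one _⟩
  have hrow : ∀ u, ∑ v, P u v = D u := fun u => hl.sum_ite u
  have hwsum : ∑ u, w u = ((D e + 1 : ℕ) : ℝ) := by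
    have : ∀ u, w u = P e u + if e = u then 1 else 0 := fun u => by
      simp only [w, P]; split_ifs <;> simp
    simp only [this, Finset.sum_add_distrib, hrow]
    simp
  have htop := sum_weight_mul_le_sum_top (h := fun i => (D i : ℝ)) (w := w)
    (fun i j hij => Nat.cast_le.2 (hmono hij)) hw (hl.add_one_le e) hwsum
  -- S_j runs over d_j + 1 indices, not d_j; this is why w_e is set to 1.
  have hupper : ∑ i ∈ Finset.univ.filter (fun i : Fin n => n - (D e + 1) ≤ (i : ℕ)), (D i : ℝ)
      = upperSum D e := by
    rw [upperSum, Nat.cast_sum]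
    refine Finset.sum_congr ?_ fun _ _ => rfl
    ext i
    simp only [Finset.mem_filter, Finset.mem_univ, true_and]
    omega
  rw [hupper] at htop
  have hexp : ∑ u, ∑ v, P u v * (1 - w u) * (1 - w v)
      = (total D : ℝ) - 2 * ∑ u, w u * D u + ∑ u, ∑ v, P u v * w u * w v := by
    have e1 : ∑ u, ∑ v, P u v * w u = ∑ u, w u * D u := by
      refine Finset.sum_congr rfl fun u _ => ?_
      rw [← Finset.sum_mul, hrow, mul_comm]
    have e2 : ∑ u, ∑ v, P u v * w v = ∑ u, w u * D u := by
      rw [Finset.sum_comm, ← e1]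
      refine Finset.sum_congr rfl fun u _ => Finset.sum_congr rfl fun v _ => ?_
      rw [hPs]
    have e3 : ∑ u, ∑ v, P u v = total D := by
      simp only [hrow, total, Nat.cast_sum]
    calc _ = ∑ u, ∑ v, (P u v - P u v * w u - P u v * w v + P u v * w u * w v) := by
          refine Finset.sum_congr rfl fun u _ => Finset.sum_congr rfl fun v _ => ?_
          ring
      _ = _ := by
          simp only [Finset.sum_add_distrib, Finset.sum_sub_distrib, e1, e2, e3]
          ring
  obtain ⟨o, hoe, ho⟩ := hl.exists_inv_le hpos e
  have hlow : 1 / (n : ℝ) ^ 2 ≤ ∑ u, ∑ v, P u v * w u * w v := by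
    have hnn : ∀ u v, 0 ≤ P u v * w u * w v := fun u v =>
      mul_nonneg (mul_nonneg (hP0 u v) (hw u).1) (hw v).1
    calc 1 / (n : ℝ) ^ 2 = 1 / (n : ℝ) * 1 * (1 / (n : ℝ)) := by field_simp
      _ ≤ P e o * w e * w o := by
          simp only [P, w, if_neg hoe.symm, if_true]
          have : 0 ≤ 1 / (n : ℝ) := by positivity
          have h2 := Real.sigmoid_nonneg (l e + l o)
          rw [mul_one, mul_one]
          exact mul_le_mul ho ho this h2
      _ ≤ ∑ v, P e v * w e * w v :=
          Finset.single_le_sum (f := fun v => P e v * w e * w v) (fun v _ => hnn e v)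
            (Finset.mem_univ o)
      _ ≤ _ := Finset.single_le_sum (f := fun u => ∑ v, P u v * w u * w v)
            (fun u _ => Finset.sum_nonneg fun v _ => hnn u v) (Finset.mem_univ e)
  obtain ⟨u, v, huv⟩ : ∃ u v, 1 / (n : ℝ) ^ 4 ≤ P u v * (1 - w u) * (1 - w v) := by
    by_contra hcon
    push Not at hcon
    have hne : (Finset.univ : Finset (Fin n)).Nonempty := ⟨e, Finset.mem_univ e⟩
    have : ∑ u, ∑ v, P u v * (1 - w u) * (1 - w v) < ∑ u : Fin n, ∑ v : Fin n, 1 / (n : ℝ) ^ 4 :=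
      Finset.sum_lt_sum_of_nonempty hne fun u _ =>
        Finset.sum_lt_sum_of_nonempty hne fun v _ => hcon u v
    have h2 : ∑ u : Fin n, ∑ v : Fin n, 1 / (n : ℝ) ^ 4 = 1 / (n : ℝ) ^ 2 := by
      simp only [Finset.sum_const, Finset.card_univ, Fintype.card_fin, nsmul_eq_mul]
      field_simp
    linarith
  have hq : 0 < 1 / (n : ℝ) ^ 4 := by positivity
  have hw1 : ∀ u, 0 ≤ 1 - w u ∧ 1 - w u ≤ 1 := fun u => by
    constructor <;> linarith [(hw u).1, (hw u).2]
  have a1 : 1 / (n : ℝ) ^ 4 ≤ P u v := huv.trans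
    (by
      rw [mul_assoc]
      exact mul_le_of_le_one_right (hP0 u v) (mul_le_one₀ (hw1 u).2 (hw1 v).1 (hw1 v).2))
  have a2 : 1 / (n : ℝ) ^ 4 ≤ 1 - w u := huv.trans
    (by
      calc _ ≤ P u v * (1 - w u) :=
            mul_le_of_le_one_right (mul_nonneg (hP0 u v) (hw1 u).1) (hw1 v).2
        _ ≤ _ := mul_le_of_le_one_left (hw1 u).1 (hP1 u v))
  have a3 : 1 / (n : ℝ) ^ 4 ≤ 1 - w v := huv.trans
    (mul_le_of_le_one_left (hw1 v).1 (mul_le_one₀ (hP1 u v) (hw1 u).1 (hw1 u).2))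
  have huv' : u ≠ v := by
    intro h
    simp only [P, if_pos h] at a1
    linarith
  have hue : e ≠ u := by
    intro h
    simp only [w, if_pos h] at a2
    linarith
  have hve : e ≠ v := by
    intro h
    simp only [w, if_pos h] at a3
    linarith
  simp only [P, if_neg huv'] at a1
  simp only [w, if_neg hue] at a2
  simp only [w, if_neg hve] at a3
  have b1 := neg_mul_log_le_of_le_sigmoid hn a1
  have b2 := le_mul_log_of_le_one_sub_sigmoid hn a2
  have b3 := le_mul_log_of_le_one_sub_sigmoid hn a3
  push_cast at b1 b2 b3
  linarith

/-- Few vertices have dual values well below `-l e` and above `-l h`. -/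
theorem IsDual.card_between_le (hl : IsDual D l) {e h : Fin n} (hh : l e ≤ l h) {c : ℝ}
    (hc : Real.sigmoid (l e - c) ≤ 1 / 4) (hpos : 0 < l h) (hc0 : 0 ≤ c) :
    ((Finset.univ.filter fun v => -l h ≤ l v ∧ l v ≤ -c).card : ℝ)
      ≤ 4 * ((D h : ℝ) - D e) + 1 := by
  set N := Finset.univ.filter fun v => -l h ≤ l v ∧ l v ≤ -c with hN
  have hcard : (N.card : ℝ) ≤ (N.erase e).card + 1 := by
    have := Finset.pred_card_le_card_erase (s := N) (a := e)
    exact_mod_cast (by omega : N.card ≤ (N.erase e).card + 1)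
  rcases eq_or_ne e h with rfl | heh
  · have : N.erase e = ∅ := by
      ext v
      simp only [Finset.mem_erase, hN, Finset.mem_filter, Finset.mem_univ, true_and,
        Finset.notMem_empty, iff_false, not_and]
      intro _ h1 h2
      have : Real.sigmoid 0 ≤ Real.sigmoid (l e - c) := Real.sigmoid_le (by linarith)
      rw [Real.sigmoid_zero] at this
      linarith
    rw [this] at hcard
    simpa using hcard
  -- The swap of h and e aligns the rows so that every difference is nonnegative; a vertex of N
  -- other than e contributes at least 1/2 − 1/4.
  have hsum : (D h : ℝ) - D e = ∑ v, ((if h = (Equiv.swap h e) v then 0 else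
      Real.sigmoid (l h + l ((Equiv.swap h e) v)))
        - if e = v then 0 else Real.sigmoid (l e + l v)) := by
    rw [Finset.sum_sub_distrib, hl.sum_ite e,
      Equiv.sum_comp (Equiv.swap h e) (fun v => if h = v then 0 else Real.sigmoid (l h + l v)),
      hl.sum_ite h]
  have hnn : ∀ v, (if v ∈ N.erase e then (1 : ℝ) / 4 else 0) ≤
      (if h = (Equiv.swap h e) v then 0 else Real.sigmoid (l h + l ((Equiv.swap h e) v)))
        - if e = v then 0 else Real.sigmoid (l e + l v) := by
    intro v
    by_cases hve : v = e
    · subst hve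
      simp
    by_cases hvh : v = h
    · subst hvh
      have : v ∉ N.erase e := by
        simp only [Finset.mem_erase, hN, Finset.mem_filter, Finset.mem_univ, true_and]
        intro h3
        linarith [h3.2.2]
      simp only [this, if_false, Equiv.swap_apply_left, if_neg hve, if_neg (Ne.symm hve),
        add_comm (l e)]
      simp
    rw [Equiv.swap_apply_of_ne_of_ne hvh hve, if_neg (Ne.symm hvh), if_neg (Ne.symm hve)]
    split_ifs with hv
    · simp only [Finset.mem_erase, hN, Finset.mem_filter, Finset.mem_univ, true_and] at hv
      have h1 : Real.sigmoid 0 ≤ Real.sigmoid (l h + l v) := Real.sigmoid_le (by linarith [hv.2.1])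
      have h2 : Real.sigmoid (l e + l v) ≤ Real.sigmoid (l e - c) :=
        Real.sigmoid_le (by linarith [hv.2.2])
      rw [Real.sigmoid_zero] at h1
      linarith
    · linarith [Real.sigmoid_le (show l e + l v ≤ l h + l v by linarith)]
  have h1 := Finset.sum_le_sum fun v (_ : v ∈ Finset.univ) => hnn v
  rw [← hsum, Finset.sum_ite_mem, Finset.univ_inter, Finset.sum_const, nsmul_eq_mul] at h1
  linarith

/-- A large gap among the negative dual values contradicts the strict Erdős–Gallai conditions. -/
theorem IsDual.exists_mem_window (hl : IsDual D l) (hD : StrictErdosGallai D) (hmono : Monotone D)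
    (hpos : ∀ i, 1 ≤ D i) (hn : 3 ≤ n) {t : ℝ} (ht : 0 ≤ t) {h : Fin n}
    (hh : t + 3 * Real.log n ≤ l h) :
    ∃ v, -(t + 6 * Real.log n) ≤ l v ∧ l v < -t := by
  by_contra hcon
  push Not at hcon
  have hn0 : (0 : ℝ) < n := by exact_mod_cast (by omega : 0 < n)
  have hn3 : (3 : ℝ) ≤ n := by exact_mod_cast hn
  have hlog : 0 ≤ Real.log n := Real.log_nonneg (by linarith)
  -- If the window is empty, every vertex off B has l ≥ −t. Edges from A to the complement of B then
  -- have probability at least 1 − n⁻³, edges from B to the complement of A at most n⁻³, so the cut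
  -- (A, B) is tight up to 2n² · n⁻³ < 1, against the gap 1 in the cut inequality.
  set A := Finset.univ.filter fun v => t + 3 * Real.log n ≤ l v with hA
  set B := Finset.univ.filter fun v => l v < -(t + 6 * Real.log n) with hB
  have hdisj : Disjoint A B := by
    rw [Finset.disjoint_left]
    intro v hv hv'
    simp only [hA, hB, Finset.mem_filter, Finset.mem_univ, true_and] at hv hv'
    linarith
  have hhA : h ∈ A := by simp [hA, hh]
  have hcut := hD.cut_inequality hmono hpos hdisj ⟨h, Finset.mem_union_left _ hhA⟩
  set δ : ℝ := 1 / (n : ℝ) ^ 3 with hδ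
  have hδe : Real.exp (-(3 * Real.log n)) = δ := by
    rw [hδ, Real.exp_neg, one_div, ← Real.exp_log hn0, ← Real.exp_nat_mul, Real.log_exp]
    norm_num
  let P : Fin n → Fin n → ℝ := fun u v => if u = v then 0 else Real.sigmoid (l u + l v)
  have hP0 : ∀ u v, 0 ≤ P u v := fun u v => by
    simp only [P]; split_ifs
    · exact le_rfl
    · exact Real.sigmoid_nonneg _
  have hPs : ∀ u v, P u v = P v u := fun u v => by
    simp only [P, eq_comm (a := u), add_comm (l u)]
  have hrow : ∀ u, ∑ v, P u v = D u := fun u => hl.sum_ite u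
  have hδ0 : 0 ≤ δ := by positivity
  have hAn : (A.card : ℝ) ≤ n := by exact_mod_cast (Finset.card_le_univ A).trans (by simp)
  have hBn : (B.card : ℝ) ≤ n := by exact_mod_cast (Finset.card_le_univ B).trans (by simp)
  have hlow : ∀ u ∈ A, ((Bᶜ.card : ℝ) - 1) - n * δ + ∑ v ∈ B, P u v ≤ D u := by
    intro u hu
    rw [← hrow u, ← Finset.sum_compl_add_sum B]
    have huB : u ∈ Bᶜ := Finset.mem_compl.2 (Finset.disjoint_left.1 hdisj hu)
    have : (∑ v ∈ Bᶜ, (((1 : ℝ) - if v = u then 1 else 0) - δ)) ≤ ∑ v ∈ Bᶜ, P u v := by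
      refine Finset.sum_le_sum fun v hv => ?_
      by_cases huv : v = u
      · simp only [huv, if_true, P]; linarith
      · simp only [P, if_neg huv, if_neg (Ne.symm huv)]
        have hv' : -t ≤ l v := by
          apply hcon
          simp only [hB, Finset.mem_compl, Finset.mem_filter, Finset.mem_univ, true_and,
            not_lt] at hv
          exact hv
        simp only [hA, Finset.mem_filter, Finset.mem_univ, true_and] at hu
        have h1 := one_sub_sigmoid_le_exp (l u + l v)
        have h2 : Real.exp (-(l u + l v)) ≤ Real.exp (-(3 * Real.log n)) :=
          Real.exp_le_exp.2 (by linarith)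
        linarith
    rw [Finset.sum_sub_distrib, Finset.sum_sub_distrib, Finset.sum_ite_eq' Bᶜ u, if_pos huB,
      Finset.sum_const, Finset.sum_const, nsmul_eq_mul, nsmul_eq_mul, mul_one] at this
    have hc : (Bᶜ.card : ℝ) ≤ n := by exact_mod_cast (Finset.card_le_univ _).trans (by simp)
    nlinarith
  have hup : ∀ u ∈ B, (D u : ℝ) ≤ ∑ v ∈ A, P u v + n * δ := by
    intro u hu
    rw [← hrow u, ← Finset.sum_add_sum_compl A]
    have : ∑ v ∈ Aᶜ, P u v ≤ ∑ v ∈ Aᶜ, δ := by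
      refine Finset.sum_le_sum fun v hv => ?_
      simp only [P]
      split_ifs
      · exact hδ0
      · simp only [hA, Finset.mem_compl, Finset.mem_filter, Finset.mem_univ, true_and,
          not_le] at hv
        simp only [hB, Finset.mem_filter, Finset.mem_univ, true_and] at hu
        have h1 := sigmoid_le_exp (l u + l v)
        have h2 : Real.exp (l u + l v) ≤ Real.exp (-(3 * Real.log n)) :=
          Real.exp_le_exp.2 (by linarith)
        linarith
    rw [Finset.sum_const, nsmul_eq_mul] at this
    have hc : (Aᶜ.card : ℝ) ≤ n := by exact_mod_cast (Finset.card_le_univ _).trans (by simp)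
    nlinarith
  have s1 := Finset.sum_le_sum hlow
  have s2 := Finset.sum_le_sum hup
  rw [Finset.sum_add_distrib, Finset.sum_const, nsmul_eq_mul] at s1
  rw [Finset.sum_add_distrib, Finset.sum_const, nsmul_eq_mul] at s2
  have s3 : ∑ u ∈ A, ∑ v ∈ B, P u v = ∑ u ∈ B, ∑ v ∈ A, P u v := by
    rw [Finset.sum_comm]
    exact Finset.sum_congr rfl fun u _ => Finset.sum_congr rfl fun v _ => hPs _ _
  have s4 : (A.card : ℝ) * (n * δ) ≤ n * (n * δ) := by gcongr
  have s5 : (B.card : ℝ) * (n * δ) ≤ n * (n * δ) := by gcongr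
  have s6 : (n : ℝ) * (n * δ) ≤ 1 / 3 := by
    rw [hδ]
    have : (n : ℝ) * (n * (1 / (n : ℝ) ^ 3)) = 1 / n := by field_simp
    rw [this]
    exact one_div_le_one_div_of_le (by norm_num) hn3
  nlinarith

/-- A large maximum l_h would allow 4γ + 2 disjoint windows between −l_h and −7 log n, with γ = d_n
− d_ℓ. Each contains a dual value by `exists_mem_window`, one more than `card_between_le` permits.
The minimum is controlled by the maximum, since every vertex has an edge of probability at least
1/n. -/
theorem IsDual.abs_le (hl : IsDual D l) (hD : StrictErdosGallai D) (hmono : Monotone D)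
    (hpos : ∀ i, 1 ≤ D i) (hn : 4 ≤ n) {e last : Fin n} (hlast : (last : ℕ) + 1 = n)
    (he : (upperSum D e : ℝ) ≤ (total D : ℝ) / 2) (i : Fin n) :
    |l i| ≤ 38 * ((D last : ℝ) - D e + 1) * Real.log n := by
  have hn0 : (0 : ℝ) < n := by exact_mod_cast (by omega : 0 < n)
  have hn4 : (4 : ℝ) ≤ n := by exact_mod_cast hn
  have hlog1 : 1 ≤ Real.log n := by
    rw [Real.le_log_iff_exp_le hn0]
    linarith [Real.exp_one_lt_d9]
  have : Nonempty (Fin n) := ⟨i⟩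
  obtain ⟨h, hh⟩ := Finite.exists_max l
  obtain ⟨g, hg⟩ := Finite.exists_min l
  have hDh : D h = D last := by
    apply le_antisymm
    · apply hmono
      rw [Fin.le_def]
      have := h.2
      omega
    · exact hl.mono (hh last)
  have hDe : D e ≤ D last := hDh ▸ hl.mono (hh e)
  obtain ⟨γ, hγ⟩ := Nat.exists_eq_add_of_le hDe
  have hγ' : (D last : ℝ) - D e + 1 = (γ : ℝ) + 1 := by rw [hγ]; push_cast; ring
  rw [hγ']
  have hg1 : -Real.log n ≤ l g + l h := by
    obtain ⟨j, -, hj⟩ := hl.exists_inv_le hpos g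
    have := neg_mul_log_le_of_le_sigmoid (k := 1) hn0 (by simpa using hj)
    simp only [Nat.cast_one, one_mul] at this
    linarith [hh j]
  have hel := hl.ell_le hmono hpos he
  -- This gives l_h ≤ (24γ + 19) log n and min l ≥ −(24γ + 20) log n, both within 38 (γ + 1) log n.
  suffices hmain : l h ≤ 7 * Real.log n + (4 * γ + 2) * (6 * Real.log n) by
    have hγ0 : (0 : ℝ) ≤ γ := Nat.cast_nonneg _
    rw [_root_.abs_le]
    have h1 := hh i
    have h2 := hg i
    constructor <;> nlinarith
  by_contra hcon
  push Not at hcon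
  have hγ0 : (0 : ℝ) ≤ γ := Nat.cast_nonneg _
  have hwin : ∀ j : Fin (4 * γ + 2), ∃ v,
      -(7 * Real.log n + (j : ℕ) * (6 * Real.log n) + 6 * Real.log n) ≤ l v ∧
        l v < -(7 * Real.log n + (j : ℕ) * (6 * Real.log n)) := by
    intro j
    have hj : ((j : ℕ) : ℝ) + 1 ≤ 4 * γ + 2 := by exact_mod_cast j.2
    exact hl.exists_mem_window hD hmono hpos (by omega) (by positivity) (h := h) (by nlinarith)
  choose f hf using hwin
  have hinj : Function.Injective f := by
    have hlt : ∀ a b : Fin (4 * γ + 2), a < b → f a ≠ f b := by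
      intro a b hab heq
      have h1 := (hf a).1
      have h2 := (hf b).2
      rw [heq] at h1
      have : ((a : ℕ) : ℝ) + 1 ≤ (b : ℕ) := by exact_mod_cast hab
      nlinarith
    intro a b hab
    by_contra hne
    rcases lt_or_gt_of_ne hne with h1 | h1
    · exact hlt a b h1 hab
    · exact hlt b a h1 hab.symm
  have hle : 4 * γ + 2 ≤ (Finset.univ.filter fun v => -l h ≤ l v ∧ l v ≤ -(7 * Real.log n)).card := by
    have h1 : (Finset.univ.image f).card = 4 * γ + 2 := by
      rw [Finset.card_image_of_injective _ hinj]; simp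
    rw [← h1]
    apply Finset.card_le_card
    intro v hv
    obtain ⟨j, -, rfl⟩ := Finset.mem_image.1 hv
    have hj : ((j : ℕ) : ℝ) + 1 ≤ 4 * γ + 2 := by exact_mod_cast j.2
    have hj0 : (0 : ℝ) ≤ (j : ℕ) := Nat.cast_nonneg _
    have h2 := hf j
    simp only [Finset.mem_filter, Finset.mem_univ, true_and]
    constructor <;> nlinarith
  -- With l_e ≤ 6 log n, the choice c = 7 log n makes sigmoid (l_e − c) ≤ 1/n ≤ 1/4.
  have hub := hl.card_between_le (e := e) (h := h) (hh e) (c := 7 * Real.log n) (by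
      refine (Real.sigmoid_le (show _ ≤ -Real.log n by linarith)).trans ?_
      refine (sigmoid_le_exp _).trans ?_
      rw [Real.exp_neg, Real.exp_log hn0, ← one_div]
      exact one_div_le_one_div_of_le (by norm_num) hn4) (by nlinarith) (by positivity)
  have hle' : (4 : ℝ) * γ + 2 ≤
      ((Finset.univ.filter fun v => -l h ≤ l v ∧ l v ≤ -(7 * Real.log n)).card : ℝ) := by
    exact_mod_cast hle
  rw [hDh, hγ] at hub
  push_cast at hub
  linarith

end DualBound

/-! ### Rounding fractional edge weights -/

section Rounding

/-- More edges in W than vertex constraints in A: a linear system with more unknowns than equations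
has a nonzero solution. -/
theorem exists_kernel_vector {V : Type*} [Fintype V] [DecidableEq V] (W : Finset (Sym2 V)) (A : Finset V)
    (h : A.card < W.card) :
    ∃ z : Sym2 V → ℝ, (∀ e ∉ W, z e = 0) ∧ (∃ e ∈ W, z e ≠ 0) ∧
      ∀ v ∈ A, ∑ e ∈ W with v ∈ e, z e = 0 := by
  let L := Matrix.mulVecLin (Matrix.of fun (v : A) (e : W) => if (v : V) ∈ (e : Sym2 V) then (1 : ℝ)
    else 0)
  have hker : LinearMap.ker L ≠ ⊥ := LinearMap.ker_ne_bot_of_finrank_lt (by simpa using h)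
  obtain ⟨c, hc, hc0⟩ := (Submodule.ne_bot_iff _).1 hker
  refine ⟨fun e => if h : e ∈ W then c ⟨e, h⟩ else 0, fun e he => by simp [he], ?_, ?_⟩
  · obtain ⟨e, he⟩ := Function.ne_iff.1 hc0
    exact ⟨e, e.2, by simpa using he⟩
  · intro v hv
    have h1 := congrFun (LinearMap.mem_ker.1 hc) ⟨v, hv⟩
    simp only [L, Matrix.mulVecLin_apply, Matrix.mulVec, dotProduct, Matrix.of_apply,
      Pi.zero_apply, ite_mul, one_mul, zero_mul] at h1
    rw [← h1, Finset.sum_filter, ← Finset.sum_coe_sort W]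
    refine Finset.sum_congr rfl fun e _ => ?_
    simp

theorem exists_exit {α : Type*} (W : Finset α) (x z : α → ℝ) (hx : ∀ e ∈ W, 0 ≤ x e ∧ x e ≤ 1)
    (hz : ∃ e ∈ W, z e ≠ 0) :
    ∃ t : ℝ, (∀ e ∈ W, 0 ≤ x e + t * z e ∧ x e + t * z e ≤ 1) ∧
      ∃ e ∈ W, (0 < z e ∧ x e + t * z e = 1) ∨ (z e < 0 ∧ x e + t * z e = 0) := by
  -- τ e is the time at which e reaches the boundary of [0, 1] when moving along z; the least one is
  -- the exit time.
  let τ : α → ℝ := fun e => if 0 < z e then (1 - x e) / z e else x e / (-z e)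
  obtain ⟨e, he, hmin⟩ := (W.filter fun e => z e ≠ 0).exists_min_image τ (by
    obtain ⟨e, he, h⟩ := hz
    exact ⟨e, Finset.mem_filter.2 ⟨he, h⟩⟩)
  obtain ⟨heW, hze⟩ := Finset.mem_filter.1 he
  have hnn : 0 ≤ τ e := by
    have := hx e heW
    simp only [τ]
    split_ifs with h
    · exact div_nonneg (by linarith) h.le
    · exact div_nonneg this.1 (by linarith)
  refine ⟨τ e, fun f hf => ?_, e, heW, ?_⟩
  · have hf01 := hx f hf
    rcases lt_trichotomy (z f) 0 with h | h | h
    · have hle := hmin f (Finset.mem_filter.2 ⟨hf, h.ne⟩)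
      simp only [τ, if_neg h.not_gt] at hle
      rw [le_div_iff₀ (by linarith)] at hle
      simp only [τ] at hnn ⊢
      constructor <;> nlinarith
    · rw [h]; simpa using hf01
    · have hle := hmin f (Finset.mem_filter.2 ⟨hf, h.ne'⟩)
      simp only [τ, if_pos h] at hle
      rw [le_div_iff₀ h] at hle
      simp only [τ] at hnn ⊢
      constructor <;> nlinarith
  · rcases lt_or_gt_of_ne hze with h | h
    · right
      refine ⟨h, ?_⟩
      simp only [τ, if_neg h.not_gt]
      field_simp
      ring
    · left
      refine ⟨h, ?_⟩
      simp only [τ, if_pos h]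
      field_simp
      ring

variable {V : Type*} [Fintype V] [DecidableEq V]

/-- The edges of the complete graph that meet `S`. -/
def meeting (S : Finset V) : Finset (Sym2 V) :=
  Finset.univ.filter fun e => ¬ e.IsDiag ∧ ∃ i ∈ S, i ∈ e

theorem mem_meeting {S : Finset V} {e : Sym2 V} :
    e ∈ meeting S ↔ ¬ e.IsDiag ∧ ∃ i ∈ S, i ∈ e := by
  simp [meeting]

/-- The weighted degree of `v`, counting the edges that meet `S`. -/
def wdeg (S : Finset V) (x : Sym2 V → ℝ) (v : V) : ℝ := ∑ e ∈ meeting S with v ∈ e, x e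

/-- The edges of fractional weight. -/
def fracEdges (S : Finset V) (x : Sym2 V → ℝ) : Finset (Sym2 V) :=
  (meeting S).filter fun e => 0 < x e ∧ x e < 1

/-- The edges of fractional weight at `v`. -/
def fracAt (S : Finset V) (x : Sym2 V → ℝ) (v : V) : Finset (Sym2 V) :=
  (fracEdges S x).filter fun e => v ∈ e

variable {S : Finset V} {x y : Sym2 V → ℝ}

theorem eq_zero_or_one_of_notMem_fracEdges (hx : ∀ e ∈ meeting S, 0 ≤ x e ∧ x e ≤ 1)
    {e : Sym2 V} (he : e ∈ meeting S) (h : e ∉ fracEdges S x) : x e = 0 ∨ x e = 1 := by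
  have h1 := hx e he
  simp only [fracEdges, Finset.mem_filter, not_and, not_lt] at h
  rcases h1.1.eq_or_lt with h0 | h0
  · exact Or.inl h0.symm
  · exact Or.inr (le_antisymm h1.2 (h he h0))

theorem exists_int_sum_fracAt (hx : ∀ e ∈ meeting S, 0 ≤ x e ∧ x e ≤ 1) {v : V}
    (hv : ∃ d : ℤ, wdeg S x v = d) : ∃ d : ℤ, ∑ e ∈ fracAt S x v, x e = d := by
  obtain ⟨d, hd⟩ := hv
  have hsub : fracAt S x v ⊆ (meeting S).filter fun e => v ∈ e := by
    intro e he
    simp only [fracAt, fracEdges, Finset.mem_filter] at he ⊢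
    exact ⟨he.1.1, he.2⟩
  rw [wdeg, ← Finset.sum_sdiff hsub] at hd
  have hint : ∀ T : Finset (Sym2 V), (∀ e ∈ T, x e = 0 ∨ x e = 1) → ∃ c : ℤ, ∑ e ∈ T, x e = c := by
    intro T hT
    refine ⟨∑ e ∈ T, if x e = 1 then 1 else 0, ?_⟩
    push_cast
    refine Finset.sum_congr rfl fun e he => ?_
    rcases hT e he with h | h <;> simp [h]
  obtain ⟨c, hc⟩ := hint (((meeting S).filter fun e => v ∈ e) \ fracAt S x v) (by
    intro e he
    simp only [Finset.mem_sdiff, Finset.mem_filter, fracAt, not_and] at he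
    exact eq_zero_or_one_of_notMem_fracEdges hx he.1.1 fun h => he.2 h he.1.2)
  refine ⟨d - c, ?_⟩
  push_cast
  linarith

/-- A single fractional weight cannot complete an integral degree. This parity-like fact drives the
counting below. -/
theorem card_fracAt_ne_one (hx : ∀ e ∈ meeting S, 0 ≤ x e ∧ x e ≤ 1) {v : V}
    (hv : ∃ d : ℤ, wdeg S x v = d) : (fracAt S x v).card ≠ 1 := by
  intro h
  obtain ⟨d, hd⟩ := exists_int_sum_fracAt hx hv
  obtain ⟨e, he⟩ := Finset.card_eq_one.1 h
  have hmem : e ∈ fracAt S x v := by rw [he]; simp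
  simp only [fracAt, fracEdges, Finset.mem_filter] at hmem
  rw [he, Finset.sum_singleton] at hd
  have h1 := hmem.1.2
  rw [hd] at h1
  have h2 : (0 : ℤ) < d := by exact_mod_cast h1.1
  have h3 : d < (1 : ℤ) := by exact_mod_cast h1.2
  omega

theorem abs_wdeg_sub_le (hx : ∀ e ∈ meeting S, 0 ≤ x e ∧ x e ≤ 1)
    (hy : ∀ e ∈ meeting S, 0 ≤ y e ∧ y e ≤ 1) {v : V} {e₀ : Sym2 V}
    (h : ∀ e ∈ meeting S, v ∈ e → e ≠ e₀ → (x e = 0 ∨ x e = 1) → y e = x e) :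
    |wdeg S y v - wdeg S x v| ≤ (fracAt S x v).card + 1 := by
  rw [wdeg, wdeg, ← Finset.sum_sub_distrib]
  refine (Finset.abs_sum_le_sum_abs _ _).trans ?_
  calc ∑ e ∈ meeting S with v ∈ e, |y e - x e|
      ≤ ∑ e ∈ meeting S with v ∈ e, if e ∈ insert e₀ (fracAt S x v) then (1 : ℝ) else 0 := by
        refine Finset.sum_le_sum fun e he => ?_
        obtain ⟨he, hve⟩ := Finset.mem_filter.1 he
        have h1 := hx e he
        have h2 := hy e he
        split_ifs with hmem
        · rw [abs_le]; constructor <;> linarith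
        · rw [Finset.mem_insert, not_or] at hmem
          have : e ∉ fracEdges S x := fun h' => hmem.2 (Finset.mem_filter.2 ⟨h', hve⟩)
          rw [h e he hve hmem.1 (eq_zero_or_one_of_notMem_fracEdges hx he this)]
          simp
    _ ≤ ((insert e₀ (fracAt S x v)).card : ℝ) := by
        rw [Finset.sum_boole]
        exact_mod_cast Finset.card_le_card fun e he => (Finset.mem_filter.1 he).2
    _ ≤ _ := by exact_mod_cast Finset.card_insert_le _ _

theorem sum_card_fracAt : ∑ v, (fracAt S x v).card = 2 * (fracEdges S x).card := by
  simp only [fracAt, Finset.card_filter]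
  rw [Finset.sum_comm]
  have : ∀ e ∈ fracEdges S x, (∑ v : V, if v ∈ e then 1 else 0) = 2 := by
    intro e he
    have hd : ¬ e.IsDiag := by
      simp only [fracEdges, meeting, Finset.mem_filter] at he
      exact he.1.2.1
    rw [← Sym2.card_toFinset_of_not_isDiag e hd, Finset.sum_boole]
    simp only [Nat.cast_id]
    congr 1
    ext v
    simp [Sym2.mem_toFinset]
  rw [Finset.sum_congr rfl this]
  simp [mul_comm]

/-- `y` is an integral rounding of `x` that keeps the degrees in `S` and nearly keeps the others. -/
def IsRounding (S : Finset V) (x y : Sym2 V → ℝ) : Prop :=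
  (∀ e ∈ meeting S, y e = 0 ∨ y e = 1) ∧ (∀ i ∈ S, wdeg S y i = wdeg S x i) ∧
    ∀ v ∉ S, |wdeg S y v - wdeg S x v| ≤ 3 ∧
      ∃ e₀, ∀ e ∈ meeting S, v ∈ e → e ≠ e₀ → (x e = 0 ∨ x e = 1) → y e = x e

/-- A vertex outside S is held fixed while it has at least three fractional edges. Once it has at
most two it is released, and from then on only those two and one exceptional edge can change, for a
total of at most 3. -/
theorem IsRounding.of_step {x' : Sym2 V → ℝ} (hx : ∀ e ∈ meeting S, 0 ≤ x e ∧ x e ≤ 1)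
    (hS : ∀ i ∈ S, wdeg S x' i = wdeg S x i)
    (hlarge : ∀ v ∉ S, 3 ≤ (fracAt S x v).card → wdeg S x' v = wdeg S x v)
    (hfix : ∀ v ∉ S, ∀ e ∈ meeting S, v ∈ e → (x e = 0 ∨ x e = 1) → x' e = x e)
    (hy : IsRounding S x' y) : IsRounding S x y := by
  refine ⟨hy.1, fun i hi => (hy.2.1 i hi).trans (hS i hi), fun v hv => ?_⟩
  obtain ⟨h1, e₀, h2⟩ := hy.2.2 v hv
  have h3 : ∀ e ∈ meeting S, v ∈ e → e ≠ e₀ → (x e = 0 ∨ x e = 1) → y e = x e := by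
    intro e he hve hne hxe
    have h4 := hfix v hv e he hve hxe
    rw [h2 e he hve hne (by rwa [h4]), h4]
  refine ⟨?_, e₀, h3⟩
  by_cases hc : 3 ≤ (fracAt S x v).card
  · rw [← hlarge v hv hc]; exact h1
  · have h5 := abs_wdeg_sub_le hx (fun e he => by
      rcases hy.1 e he with h | h <;> rw [h] <;> simp) h3
    have h6 : ((fracAt S x v).card : ℝ) ≤ 2 := by exact_mod_cast (by omega : (fracAt S x v).card ≤ 2)
    linarith

theorem wdeg_add_mul {W : Finset (Sym2 V)} {z : Sym2 V → ℝ} (hW : W ⊆ meeting S)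
    (hz : ∀ e ∉ W, z e = 0) (t : ℝ) (v : V) :
    wdeg S (fun e => x e + t * z e) v = wdeg S x v + t * ∑ e ∈ W with v ∈ e, z e := by
  rw [wdeg, Finset.sum_add_distrib, ← Finset.mul_sum, wdeg]
  congr 2
  symm
  refine Finset.sum_subset (Finset.filter_subset_filter _ hW) fun e he hne => hz e fun h => hne ?_
  exact Finset.mem_filter.2 ⟨h, (Finset.mem_filter.1 he).2⟩

/-- Moving along a kernel vector keeps all degrees constrained by A and makes some fractional edge
integral on exit. -/
theorem exists_step_of_card_lt (hx : ∀ e ∈ meeting S, 0 ≤ x e ∧ x e ≤ 1) (A : Finset V)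
    (hAS : ∀ i ∈ S, i ∉ A → fracAt S x i = ∅)
    (hAc : ∀ v ∉ S, 3 ≤ (fracAt S x v).card → v ∈ A) (hcard : A.card < (fracEdges S x).card) :
    ∃ x' : Sym2 V → ℝ, (∀ e ∈ meeting S, 0 ≤ x' e ∧ x' e ≤ 1) ∧
      (fracEdges S x').card < (fracEdges S x).card ∧ (∀ i ∈ S, wdeg S x' i = wdeg S x i) ∧
      ∀ y, IsRounding S x' y → IsRounding S x y := by
  obtain ⟨z, hz0, hzne, hzA⟩ := exists_kernel_vector _ A hcard
  have hsub : fracEdges S x ⊆ meeting S := Finset.filter_subset _ _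
  obtain ⟨t, ht, e, he, hexit⟩ := exists_exit (fracEdges S x) x z (fun e he => hx e (hsub he)) hzne
  have hdeg : ∀ v, (v ∈ A ∨ fracAt S x v = ∅) → wdeg S (fun e => x e + t * z e) v = wdeg S x v := by
    intro v hv
    rw [wdeg_add_mul hsub hz0]
    rcases hv with hv | hv
    · rw [hzA v hv]; ring
    · rw [fracAt] at hv
      rw [hv]; simp
  have hS : ∀ i ∈ S, wdeg S (fun e => x e + t * z e) i = wdeg S x i := fun i hi => by
    apply hdeg
    by_cases h : i ∈ A
    · exact Or.inl h
    · exact Or.inr (hAS i hi h)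
  have hkeep : ∀ f ∉ fracEdges S x, x f + t * z f = x f := fun f hf => by rw [hz0 f hf]; ring
  refine ⟨fun e => x e + t * z e, fun f hf => ?_, ?_, hS, fun y hy => ?_⟩
  · by_cases h : f ∈ fracEdges S x
    · exact ht f h
    · simp only [hkeep f h]; exact hx f hf
  · apply Finset.card_lt_card
    refine Finset.ssubset_iff_of_subset (fun f hf => ?_) |>.2 ⟨e, he, fun h => ?_⟩
    · by_contra h
      have h1 := Finset.mem_filter.1 hf
      simp only [hkeep f h] at h1
      exact h (Finset.mem_filter.2 h1)
    · have h1 := (Finset.mem_filter.1 h).2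
      simp only at h1
      rcases hexit with h2 | h2 <;> linarith [h1.1, h1.2, h2.2]
  · refine IsRounding.of_step hx hS (fun v hv hc => hdeg v (Or.inl (hAc v hv hc))) ?_ hy
    intro v _ f hf _ hxf
    refine hkeep f fun h => ?_
    have h1 := (Finset.mem_filter.1 h).2
    rcases hxf with h2 | h2 <;> linarith [h1.1, h1.2]

/-- When the fractional edges form a 2-regular graph inside `S`, opening one further edge lets the
number of fractional edges decrease. -/
theorem exists_step_of_regular (hx : ∀ e ∈ meeting S, 0 ≤ x e ∧ x e ≤ 1)
    (hint : ∀ i ∈ S, ∃ d : ℤ, wdeg S x i = d) {A : Finset V} (hAS : A ⊆ S)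
    (hA : ∀ v ∈ A, (fracAt S x v).card = 2) (hA0 : ∀ v ∉ A, fracAt S x v = ∅)
    (hcard : (fracEdges S x).card = A.card) {i u : V} (hi : i ∈ A) (hu : u ∈ A ∨ u ∉ S)
    (hiu : i ≠ u) (hfr : s(i, u) ∉ fracEdges S x) :
    ∃ x' : Sym2 V → ℝ, (∀ e ∈ meeting S, 0 ≤ x' e ∧ x' e ≤ 1) ∧
      (fracEdges S x').card < (fracEdges S x).card ∧ (∀ i ∈ S, wdeg S x' i = wdeg S x i) ∧
      (∀ f, f ∉ fracEdges S x → f ≠ s(i, u) → x' f = x f) := by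
  set e := s(i, u) with he
  have heM : e ∈ meeting S := by
    refine Finset.mem_filter.2 ⟨Finset.mem_univ _, by simpa [he] using hiu, i, hAS hi, by simp [he]⟩
  have hsub : insert e (fracEdges S x) ⊆ meeting S :=
    Finset.insert_subset heM (Finset.filter_subset _ _)
  -- Adding e gives one unknown more than constraints. The sign of z is chosen so that e does not
  -- leave [0, 1] at once; if e is the exit edge, it has crossed the whole interval.
  obtain ⟨z, hz0, hzne, hzA, hzin⟩ : ∃ z : Sym2 V → ℝ, (∀ f ∉ insert e (fracEdges S x), z f = 0) ∧
      (∃ f ∈ insert e (fracEdges S x), z f ≠ 0) ∧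
      (∀ v ∈ A, ∑ f ∈ insert e (fracEdges S x) with v ∈ f, z f = 0) ∧
      ((x e = 0 ∧ 0 ≤ z e) ∨ (x e = 1 ∧ z e ≤ 0)) := by
    obtain ⟨z, hz0, hzne, hzA⟩ := exists_kernel_vector (insert e (fracEdges S x)) A (by
      rw [Finset.card_insert_of_notMem hfr]; omega)
    have hneg : (∀ f ∉ insert e (fracEdges S x), -z f = 0) ∧
      (∃ f ∈ insert e (fracEdges S x), -z f ≠ 0) ∧
      (∀ v ∈ A, ∑ f ∈ insert e (fracEdges S x) with v ∈ f, -z f = 0) := by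
      refine ⟨fun f hf => by rw [hz0 f hf, neg_zero], ?_, fun v hv => ?_⟩
      · obtain ⟨f, hf, h⟩ := hzne
        exact ⟨f, hf, neg_ne_zero.2 h⟩
      · rw [Finset.sum_neg_distrib, hzA v hv, neg_zero]
    rcases eq_zero_or_one_of_notMem_fracEdges hx heM hfr with h | h <;>
      rcases le_total 0 (z e) with h' | h'
    · exact ⟨z, hz0, hzne, hzA, Or.inl ⟨h, h'⟩⟩
    · exact ⟨fun f => -z f, hneg.1, hneg.2.1, hneg.2.2, Or.inl ⟨h, by simpa using h'⟩⟩
    · exact ⟨fun f => -z f, hneg.1, hneg.2.1, hneg.2.2, Or.inr ⟨h, by simpa using h'⟩⟩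
    · exact ⟨z, hz0, hzne, hzA, Or.inr ⟨h, h'⟩⟩
  obtain ⟨t, ht, g, hg, hexit⟩ := exists_exit _ x z (fun f hf => hx f (hsub hf)) hzne
  set x' : Sym2 V → ℝ := fun f => x f + t * z f with hx'
  have hkeep : ∀ f, f ∉ fracEdges S x → f ≠ e → x' f = x f := fun f hf hfe => by
    simp only [hx']
    rw [hz0 f (by simp [hf, hfe])]; ring
  have hx'01 : ∀ f ∈ meeting S, 0 ≤ x' f ∧ x' f ≤ 1 := fun f hf => by
    by_cases h : f ∈ insert e (fracEdges S x)
    · exact ht f h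
    · rw [Finset.mem_insert, not_or] at h
      rw [hkeep f h.2 h.1]; exact hx f hf
  have hdeg : ∀ v ∈ S, wdeg S x' v = wdeg S x v := by
    intro v hv
    rw [hx', wdeg_add_mul hsub hz0]
    by_cases hvA : v ∈ A
    · rw [hzA v hvA]; ring
    · have hempty : (insert e (fracEdges S x)).filter (fun f => v ∈ f) = ∅ := by
        rw [Finset.filter_insert, if_neg, ← fracAt, hA0 v hvA]
        rw [he, Sym2.mem_iff, not_or]
        refine ⟨fun h => hvA (h ▸ hi), fun h => ?_⟩
        rcases hu with hu | hu
        · exact hvA (h ▸ hu)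
        · exact hu (h ▸ hv)
      rw [hempty]; simp
  have hsub' : fracEdges S x' ⊆ insert e (fracEdges S x) := by
    intro f hf
    by_contra h
    rw [Finset.mem_insert, not_or] at h
    have h1 := Finset.mem_filter.1 hf
    rw [hkeep f h.2 h.1] at h1
    exact h.2 (Finset.mem_filter.2 h1)
  -- Some old fractional edge must become integral. Otherwise e is the exit edge and changes by ±1;
  -- the two fractional edges at i sum to 1, being integral and strictly between 0 and 2, so their
  -- new sum is 0 or 2 although both stay inside (0, 1).
  obtain ⟨f, hf, hff⟩ : ∃ f ∈ fracEdges S x, f ∉ fracEdges S x' := by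
    by_contra hcon
    push Not at hcon
    have hge : g = e := by
      rcases Finset.mem_insert.1 hg with h | h
      · exact h
      · have h1 := (Finset.mem_filter.1 (hcon g h)).2
        simp only [hx'] at h1
        rcases hexit with h2 | h2 <;> linarith [h1.1, h1.2, h2.2]
    subst hge
    obtain ⟨d, hd⟩ := exists_int_sum_fracAt hx (hint i (hAS hi))
    obtain ⟨f₁, f₂, hne, hpair⟩ := Finset.card_eq_two.1 (hA i hi)
    have hmem : ∀ f ∈ fracAt S x i, (0 < x f ∧ x f < 1) ∧ (0 < x' f ∧ x' f < 1) := fun f hf => by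
      have h1 := (Finset.mem_filter.1 hf).1
      exact ⟨(Finset.mem_filter.1 h1).2, (Finset.mem_filter.1 (hcon f h1)).2⟩
    have m1 := hmem f₁ (by rw [hpair]; simp)
    have m2 := hmem f₂ (by rw [hpair]; simp)
    rw [hpair, Finset.sum_pair hne] at hd
    have hd1 : d = 1 := by
      have h1 : (0 : ℝ) < d := by linarith [m1.1.1, m2.1.1]
      have h2 : (d : ℝ) < 2 := by linarith [m1.1.2, m2.1.2]
      have h3 : (0 : ℤ) < d := by exact_mod_cast h1
      have h4 : d < (2 : ℤ) := by exact_mod_cast h2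
      omega
    rw [hd1] at hd
    push_cast at hd
    have hz := hzA i hi
    rw [Finset.filter_insert, if_pos (by simp [he]), Finset.sum_insert (by simp [hfr]),
      ← fracAt, hpair, Finset.sum_pair hne] at hz
    simp only [hx'] at m1 m2
    have hz' : t * z e + (t * z f₁ + t * z f₂) = 0 := by rw [← mul_add, ← mul_add, hz, mul_zero]
    rcases hexit with h2 | h2 <;> rcases hzin with h3 | h3 <;>
      linarith [h2.1, h2.2, h3.1, h3.2, m1.2.1, m1.2.2, m2.2.1, m2.2.2]
  -- At an endpoint w of f off e, losing f leaves at most one fractional edge, hence none: two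
  -- fractional edges disappear, and at most the edge e is gained.
  obtain ⟨w, hwf, hwe⟩ : ∃ w ∈ f, w ∉ e := by
    by_contra hcon
    push Not at hcon
    have hfd : ¬ f.IsDiag := by
      have := (Finset.mem_filter.1 hf).1
      exact (Finset.mem_filter.1 this).2.1
    induction f using Sym2.ind with
    | _ a b =>
      have h1 := hcon a (by simp)
      have h2 := hcon b (by simp)
      simp only [Sym2.mk_isDiag_iff] at hfd
      have : s(a, b) = e := by
        symm
        exact (Sym2.mem_and_mem_iff hfd).1 ⟨h1, h2⟩
      exact hfr (this ▸ hf)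
  have hwA : w ∈ A := by
    by_contra h
    have h1 : f ∈ fracAt S x w := Finset.mem_filter.2 ⟨hf, hwf⟩
    rw [hA0 w h] at h1
    simp at h1
  have hwempty : fracAt S x' w = ∅ := by
    have hs : fracAt S x' w ⊆ (fracAt S x w).erase f := by
      intro f' hf'
      obtain ⟨h1, h2⟩ := Finset.mem_filter.1 hf'
      have hne : f' ≠ e := fun h => hwe (h ▸ h2)
      refine Finset.mem_erase.2 ⟨fun h => hff (h ▸ h1), Finset.mem_filter.2 ⟨?_, h2⟩⟩
      exact (Finset.mem_insert.1 (hsub' h1)).resolve_left hne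
    have h1 := Finset.card_le_card hs
    have hfw : f ∈ fracAt S x w := Finset.mem_filter.2 ⟨hf, hwf⟩
    rw [Finset.card_erase_of_mem hfw, hA w hwA] at h1
    have h2 := card_fracAt_ne_one hx'01 (v := w) (by
      rw [hdeg w (hAS hwA)]; exact hint w (hAS hwA))
    rw [← Finset.card_eq_zero]
    omega
  refine ⟨x', hx'01, ?_, hdeg, hkeep⟩
  have hs : fracEdges S x' ⊆ insert e (fracEdges S x \ fracAt S x w) := by
    intro f' hf'
    rcases Finset.mem_insert.1 (hsub' hf') with h | h
    · exact Finset.mem_insert.2 (Or.inl h)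
    · refine Finset.mem_insert.2 (Or.inr (Finset.mem_sdiff.2 ⟨h, fun h' => ?_⟩))
      have : f' ∈ fracAt S x' w := Finset.mem_filter.2 ⟨hf', (Finset.mem_filter.1 h').2⟩
      rw [hwempty] at this
      simp at this
  have h1 := (Finset.card_le_card hs).trans (Finset.card_insert_le _ _)
  have h2 := Finset.card_sdiff_add_card_eq_card (s := fracAt S x w) (t := fracEdges S x)
    (Finset.filter_subset _ _)
  rw [hA w hwA] at h2
  omega

/-- Double counting: every vertex of A has at least two fractional edges, so 2|A| ≤ Σ_v |frac(v)| =
2|frac| ≤ 2|A|, and equality holds throughout. -/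
theorem exists_regular_of_card_le (hx : ∀ e ∈ meeting S, 0 ≤ x e ∧ x e ≤ 1)
    (hint : ∀ i ∈ S, ∃ d : ℤ, wdeg S x i = d) {A : Finset V}
    (hAdef : ∀ v, v ∈ A ↔ (v ∈ S ∧ fracAt S x v ≠ ∅) ∨ (v ∉ S ∧ 3 ≤ (fracAt S x v).card))
    (hle : (fracEdges S x).card ≤ A.card) :
    A ⊆ S ∧ (∀ v ∈ A, (fracAt S x v).card = 2) ∧ (∀ v ∉ A, fracAt S x v = ∅) ∧
      (fracEdges S x).card = A.card := by
  have hlow : ∀ v, (if v ∈ A then 2 else 0) ≤ (fracAt S x v).card := by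
    intro v
    split_ifs with h
    · rcases (hAdef v).1 h with ⟨hS, hne⟩ | ⟨_, h3⟩
      · have h1 := card_fracAt_ne_one hx (hint v hS)
        have h2 : (fracAt S x v).card ≠ 0 := by simpa [Finset.card_eq_zero] using hne
        omega
      · omega
    · exact Nat.zero_le _
  have hs := sum_card_fracAt (S := S) (x := x)
  have hs2 : (∑ v : V, if v ∈ A then 2 else 0) = 2 * A.card := by
    rw [Finset.sum_ite_mem]; simp [mul_comm]
  have hge := Finset.sum_le_sum fun v (_ : v ∈ Finset.univ) => hlow v
  have heq : (∑ v : V, if v ∈ A then 2 else 0) = ∑ v, (fracAt S x v).card := by omega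
  have hall := (Finset.sum_eq_sum_iff_of_le fun v _ => hlow v).1 heq
  refine ⟨fun v hv => ?_, fun v hv => ?_, fun v hv => ?_, by omega⟩
  · have := hall v (Finset.mem_univ v)
    rw [if_pos hv] at this
    rcases (hAdef v).1 hv with h | h
    · exact h.1
    · omega
  · have := hall v (Finset.mem_univ v)
    rw [if_pos hv] at this
    exact this.symm
  · have := hall v (Finset.mem_univ v)
    rw [if_neg hv] at this
    exact Finset.card_eq_zero.1 this.symm

/-- A fractional edge inside S needs a second fractional edge at each endpoint, and these two are
distinct: at least three in all. -/
theorem fracEdges_eq_empty_of_card_le_two (hx : ∀ e ∈ meeting S, 0 ≤ x e ∧ x e ≤ 1)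
    (hint : ∀ i ∈ S, ∃ d : ℤ, wdeg S x i = d) (hcard : (fracEdges S x).card ≤ 2) {e : Sym2 V}
    (he : ∃ i ∈ S, i ∈ e) (hS : ∀ f ∈ fracEdges S x, f ≠ e → ∀ v ∈ f, v ∈ S) :
    fracEdges S x = ∅ := by
  by_contra hne
  have hother : ∀ v ∈ S, ∀ g ∈ fracEdges S x, v ∈ g → ∃ g' ∈ fracEdges S x, v ∈ g' ∧ g' ≠ g := by
    intro v hv g hg hvg
    have h1 := card_fracAt_ne_one hx (hint v hv)
    have h2 : g ∈ fracAt S x v := Finset.mem_filter.2 ⟨hg, hvg⟩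
    have h3 : 1 < (fracAt S x v).card := by
      have := Finset.card_pos.2 ⟨g, h2⟩
      omega
    obtain ⟨g', hg', hne'⟩ := Finset.exists_mem_ne h3 g
    exact ⟨g', (Finset.mem_filter.1 hg').1, (Finset.mem_filter.1 hg').2, hne'⟩
  obtain ⟨g, hg, hge⟩ : ∃ g ∈ fracEdges S x, g ≠ e := by
    obtain ⟨g, hg⟩ := Finset.nonempty_iff_ne_empty.2 hne
    by_cases h : g = e
    · subst h
      obtain ⟨i, hi, hie⟩ := he
      obtain ⟨g', h1, -, h3⟩ := hother i hi g hg hie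
      exact ⟨g', h1, h3⟩
    · exact ⟨g, hg, h⟩
  have hgd : ¬ g.IsDiag := (Finset.mem_filter.1 (Finset.mem_filter.1 hg).1).2.1
  induction g using Sym2.ind with
  | _ a b =>
    rw [Sym2.mk_isDiag_iff] at hgd
    obtain ⟨ga, ha1, ha2, ha3⟩ := hother a (hS _ hg hge a (by simp)) _ hg (by simp)
    obtain ⟨gb, hb1, hb2, hb3⟩ := hother b (hS _ hg hge b (by simp)) _ hg (by simp)
    have hab : ga ≠ gb := by
      intro h
      subst h
      exact ha3 ((Sym2.mem_and_mem_iff hgd).1 ⟨ha2, hb2⟩)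
    have h3 : ({s(a, b), ga, gb} : Finset (Sym2 V)) ⊆ fracEdges S x := by
      intro f hf
      simp only [Finset.mem_insert, Finset.mem_singleton] at hf
      rcases hf with rfl | rfl | rfl <;> assumption
    have h4 := Finset.card_le_card h3
    rw [Finset.card_eq_three.2 ⟨_, _, _, ha3.symm, hb3.symm, hab, rfl⟩] at h4
    omega

/-- Fractional edge weights whose degrees in `S` are integral can be rounded so that the degrees in
`S` are kept and the other degrees change by at most `3`. -/
theorem exists_isRounding {star : V} (hstar : star ∉ S)
    (hx : ∀ e ∈ meeting S, 0 ≤ x e ∧ x e ≤ 1) (hint : ∀ i ∈ S, ∃ d : ℤ, wdeg S x i = d) :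
    ∃ y, IsRounding S x y := by
  induction hN : (fracEdges S x).card using Nat.strong_induction_on generalizing x with
  | _ N ih =>
    subst hN
    by_cases hempty : fracEdges S x = ∅
    -- A loop lies outside `meeting S`, so s(v, v) serves as a void exceptional edge.
    · refine ⟨x, fun e he => eq_zero_or_one_of_notMem_fracEdges hx he (by simp [hempty]),
        fun _ _ => rfl, fun v _ => ⟨by simp, s(v, v), fun _ _ _ _ _ => rfl⟩⟩
    set A := Finset.univ.filter fun v =>
      (v ∈ S ∧ fracAt S x v ≠ ∅) ∨ (v ∉ S ∧ 3 ≤ (fracAt S x v).card) with hA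
    have hAdef : ∀ v, v ∈ A ↔
        (v ∈ S ∧ fracAt S x v ≠ ∅) ∨ (v ∉ S ∧ 3 ≤ (fracAt S x v).card) := fun v => by simp [hA]
    rcases lt_or_ge A.card (fracEdges S x).card with hlt | hle
    · obtain ⟨x', h1, h2, h3, h4⟩ := exists_step_of_card_lt hx A
        (fun i hi hiA => by
          by_contra h
          exact hiA ((hAdef i).2 (Or.inl ⟨hi, h⟩)))
        (fun v hv hc => (hAdef v).2 (Or.inr ⟨hv, hc⟩)) hlt
      obtain ⟨y, hy⟩ := ih _ h2 h1 (fun i hi => by rw [h3 i hi]; exact hint i hi) rfl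
      exact ⟨y, h4 y hy⟩
    · obtain ⟨hAS, hA2, hA0, hcard⟩ := exists_regular_of_card_le hx hint hAdef hle
      obtain ⟨i, hi⟩ : A.Nonempty := by
        rw [← Finset.card_pos, ← hcard, Finset.card_pos]
        exact Finset.nonempty_iff_ne_empty.2 hempty
      have hmemS : ∀ f ∈ fracEdges S x, ∀ v ∈ f, v ∈ A := by
        intro f hf v hv
        by_contra h
        have h1 : f ∈ fracAt S x v := Finset.mem_filter.2 ⟨hf, hv⟩
        rw [hA0 v h] at h1
        simp at h1
      by_cases hu : ∃ u ∈ A, i ≠ u ∧ s(i, u) ∉ fracEdges S x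
      · obtain ⟨u, huA, hiu, hfr⟩ := hu
        obtain ⟨x', h1, h2, h3, h4⟩ :=
          exists_step_of_regular hx hint hAS hA2 hA0 hcard hi (Or.inl huA) hiu hfr
        obtain ⟨y, hy⟩ := ih _ h2 h1 (fun i hi => by rw [h3 i hi]; exact hint i hi) rfl
        refine ⟨y, IsRounding.of_step hx h3 (fun v hv hc => ?_) (fun v hv e _ hve hxe => ?_) hy⟩
        · exact absurd (hAS ((hAdef v).2 (Or.inr ⟨hv, hc⟩))) hv
        · refine h4 e (fun h => hv (hAS (hmemS e h v hve))) fun h => ?_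
          rw [h, Sym2.mem_iff] at hve
          rcases hve with rfl | rfl
          · exact hv (hAS hi)
          · exact hv (hAS huA)
      -- Here i is joined by fractional edges to all of A, so 2-regularity gives |A| ≤ 3. A triangle
      -- of halves cannot be rounded within itself, hence one edge to `star` is opened; afterwards
      -- at most two fractional edges remain, and so none.
      · push Not at hu
        have hne : i ≠ star := fun h => hstar (h ▸ hAS hi)
        have hfr : s(i, star) ∉ fracEdges S x := fun h =>
          hstar (hAS (hmemS _ h star (by simp)))
        obtain ⟨x', h1, h2, h3, h4⟩ :=
          exists_step_of_regular hx hint hAS hA2 hA0 hcard hi (Or.inr hstar) hne hfr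
        have hA3 : A.card ≤ 3 := by
          have hinj : (A.erase i).card ≤ (fracAt S x i).card := by
            refine Finset.card_le_card_of_injOn (fun u => s(i, u)) (fun u hu' => ?_)
              (fun u _ u' _ h => ?_)
            · have hu'' := Finset.mem_erase.1 (Finset.mem_coe.1 hu')
              exact Finset.mem_coe.2
                (Finset.mem_filter.2 ⟨hu u hu''.2 hu''.1.symm, by simp⟩)
            · exact Sym2.congr_right.1 h
          rw [hA2 i hi, Finset.card_erase_of_mem hi] at hinj
          omega
        have hx'e : fracEdges S x' = ∅ := by
          refine fracEdges_eq_empty_of_card_le_two h1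
            (fun i hi => by rw [h3 i hi]; exact hint i hi) (by omega) (e := s(i, star))
            ⟨i, hAS hi, by simp⟩ fun f hf hfe v hv => ?_
          by_cases hfx : f ∈ fracEdges S x
          · exact hAS (hmemS f hfx v hv)
          · have h5 := Finset.mem_filter.1 hf
            rw [h4 f hfx hfe] at h5
            exact absurd (Finset.mem_filter.2 h5) hfx
        have hfix : ∀ e ∈ meeting S, e ≠ s(i, star) → (x e = 0 ∨ x e = 1) → x' e = x e := by
          intro e _ hne' hxe
          refine h4 e (fun h => ?_) hne'
          have h5 := (Finset.mem_filter.1 h).2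
          rcases hxe with h6 | h6 <;> linarith [h5.1, h5.2]
        refine ⟨x', fun e he => eq_zero_or_one_of_notMem_fracEdges h1 he (by simp [hx'e]), h3,
          fun v hv => ⟨?_, s(i, star), fun e he _ hne' hxe => hfix e he hne' hxe⟩⟩
        have h5 := abs_wdeg_sub_le hx h1 (v := v) (e₀ := s(i, star))
          fun e he _ hne' hxe => hfix e he hne' hxe
        rw [hA0 v fun h => hv (hAS h)] at h5
        simp at h5
        linarith

end Rounding

/-! ### Weighted sums over embedded trees -/

section Trees

/-- Induction on leaves: a vertex of maximal rank is nobody's parent, so summing over its image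
costs one row sum. -/
theorem sum_extensions_le {V X : Type*} [Fintype V] [Fintype X] (m : X → X → ℝ)
    (hm : ∀ i j, 0 ≤ m i j) {C : ℝ} (hC : ∀ i, ∑ j, m i j ≤ C) (par : V → V)
    (r : V → ℕ) (s₀ : V → X) (Y : Finset V) (hY : ∀ y ∈ Y, r (par y) < r y) :
    ∑ s : V → X with ∀ x ∉ Y, s x = s₀ x, ∏ y ∈ Y, m (s (par y)) (s y) ≤ C ^ Y.card := by
  induction hN : Y.card generalizing Y with
  | zero =>
    rw [Finset.card_eq_zero] at hN
    subst hN
    have : (Finset.univ.filter fun s : V → X => ∀ x ∉ (∅ : Finset V), s x = s₀ x) = {s₀} := by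
      ext s
      simp [funext_iff]
    rw [this]
    simp
  | succ N ih =>
    obtain ⟨y, hy, hmax⟩ := Y.exists_max_image r (Finset.card_pos.1 (by omega))
    have hcard : (Y.erase y).card = N := by rw [Finset.card_erase_of_mem hy, hN]; rfl
    have hih := ih (Y.erase y) (fun z hz => hY z (Finset.mem_of_mem_erase hz)) hcard
    have hre : ∑ s : V → X with ∀ x ∉ Y, s x = s₀ x, ∏ y ∈ Y, m (s (par y)) (s y)
        = ∑ q ∈ (Finset.univ.filter fun s : V → X => ∀ x ∉ Y.erase y, s x = s₀ x) ×ˢ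
            (Finset.univ : Finset X),
          (∏ z ∈ Y.erase y, m (q.1 (par z)) (q.1 z)) * m (q.1 (par y)) q.2 := by
      refine Finset.sum_nbij' (fun s => (Function.update s y (s₀ y), s y))
        (fun q => Function.update q.1 y q.2) ?_ ?_ ?_ ?_ ?_
      · intro s hs
        simp only [Finset.mem_filter, Finset.mem_univ, true_and] at hs
        simp only [Finset.mem_product, Finset.mem_filter, Finset.mem_univ, true_and, and_true]
        intro x hx
        by_cases hxy : x = y
        · subst hxy; simp
        · rw [Function.update_of_ne hxy]
          exact hs x fun h => hx (Finset.mem_erase.2 ⟨hxy, h⟩)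
      · rintro ⟨s, j⟩ hs
        simp only [Finset.mem_product, Finset.mem_filter, Finset.mem_univ, true_and,
          and_true] at hs
        simp only [Finset.mem_filter, Finset.mem_univ, true_and]
        intro x hx
        have hxy : x ≠ y := fun h => hx (h ▸ hy)
        rw [Function.update_of_ne hxy]
        exact hs x fun h => hx (Finset.mem_of_mem_erase h)
      · intro s _
        simp
      · rintro ⟨s, j⟩ hs
        simp only [Finset.mem_product, Finset.mem_filter, Finset.mem_univ, true_and,
          and_true] at hs
        have : s y = s₀ y := hs y (by simp)
        simp [← this]
      · intro s _
        have hpar : ∀ z ∈ Y, par z ≠ y := fun z hz h => by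
          have h1 := hY z hz
          have h2 := hmax z hz
          rw [h] at h1
          omega
        rw [← Finset.prod_erase_mul _ _ hy]
        congr 1
        · refine Finset.prod_congr rfl fun z hz => ?_
          obtain ⟨hzy, hz⟩ := Finset.mem_erase.1 hz
          simp only [Function.update_of_ne (hpar z hz), Function.update_of_ne hzy]
        · simp only [Function.update_of_ne (hpar y hy)]
    rw [hre, Finset.sum_product]
    have hC0 : 0 ≤ C := by
      by_cases hX : Nonempty X
      · exact (Finset.sum_nonneg fun j _ => hm _ _).trans (hC hX.some)
      · exact absurd ⟨s₀ y⟩ hX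
    calc _ ≤ ∑ s : V → X with ∀ x ∉ Y.erase y, s x = s₀ x,
          (∏ z ∈ Y.erase y, m (s (par z)) (s z)) * C := by
          refine Finset.sum_le_sum fun s _ => ?_
          simp only
          rw [← Finset.mul_sum]
          exact mul_le_mul_of_nonneg_left (hC _) (Finset.prod_nonneg fun z _ => hm _ _)
      _ ≤ C ^ N * C := by
          rw [← Finset.sum_mul]
          exact mul_le_mul_of_nonneg_right hih hC0
      _ = C ^ (N + 1) := (pow_succ _ _).symm

variable {k n : ℕ}

/-- The tree rooted at u; its edges correspond bijectively to the non-root vertices. -/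
theorem exists_parent {V : Type*} [Fintype V] [DecidableEq V] {T : SimpleGraph V} (hT : T.IsTree) (u : V) :
    ∃ par : V → V, (∀ y, y ≠ u → T.Adj y (par y) ∧ T.dist (par y) u < T.dist y u) ∧
      Set.InjOn (fun y => s(y, par y)) (Finset.univ.erase u : Finset V) ∧
      (Finset.univ.erase u).image (fun y => s(y, par y)) = T.edgeFinset := by
  have hex : ∀ y, ∃ z, y ≠ u → T.Adj y z ∧ T.dist z u < T.dist y u := by
    intro y
    by_cases hy : y = u
    · exact ⟨y, fun h => absurd hy h⟩
    obtain ⟨p, hp⟩ := hT.1.exists_walk_length_eq_dist y u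
    cases p with
    | nil => exact absurd rfl hy
    | @cons _ z _ h q =>
      refine ⟨z, fun _ => ⟨h, ?_⟩⟩
      rw [SimpleGraph.Walk.length_cons] at hp
      have := SimpleGraph.dist_le q
      omega
  choose par hpar using hex
  have hinj : Set.InjOn (fun y => s(y, par y)) (Finset.univ.erase u : Finset V) := by
    intro y hy z hz h
    have hy' := hpar y (Finset.mem_erase.1 (Finset.mem_coe.1 hy)).1
    have hz' := hpar z (Finset.mem_erase.1 (Finset.mem_coe.1 hz)).1
    simp only [Sym2.eq_iff] at h
    rcases h with h | ⟨h1, h2⟩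
    · exact h.1
    · have e1 := hy'.2
      have e2 := hz'.2
      rw [h2] at e1
      rw [← h1] at e2
      omega
  refine ⟨par, hpar, hinj, ?_⟩
  apply Finset.eq_of_subset_of_card_le
  · intro e he
    obtain ⟨y, hy, rfl⟩ := Finset.mem_image.1 he
    rw [SimpleGraph.mem_edgeFinset]
    exact (hpar y (Finset.mem_erase.1 hy).1).1
  · rw [Finset.card_image_of_injOn hinj, Finset.card_erase_of_mem (Finset.mem_univ u)]
    have := hT.card_edgeFinset
    rw [Finset.card_univ]
    omega

theorem prod_pow_degree {V : Type*} [Fintype V] [DecidableEq V] (T : SimpleGraph V) (c : V → ℝ) :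
    ∏ x, c x ^ T.degree x = ∏ e ∈ T.edgeFinset, ∏ x, if x ∈ e then c x else 1 := by
  rw [Finset.prod_comm]
  refine Finset.prod_congr rfl fun x _ => ?_
  rw [← T.card_incidenceFinset_eq_degree x, T.incidenceFinset_eq_filter, Finset.prod_ite,
    Finset.prod_const, Finset.prod_const_one, mul_one]

theorem prod_ite_mem_mk {V : Type*} [Fintype V] [DecidableEq V] (c : V → ℝ) {a b : V} (hab : a ≠ b) :
    (∏ x, if x ∈ s(a, b) then c x else 1) = c a * c b := by
  rw [← Finset.prod_filter]
  have : (Finset.univ.filter fun x => x ∈ s(a, b)) = {a, b} := by ext x; simp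
  rw [this, Finset.prod_pair hab]

/-- Π d^{b} is a product over edges of d_y d_{par y}; dividing by Π d removes each child factor and
one d_u, and the latter cancels the parent factor of v. -/
theorem bFunction_eq {T : SimpleGraph (Fin k)} {D : Fin n → ℕ}
    (hD : ∀ i, 1 ≤ D i) {u v : Fin k} (huv : u ≠ v) {par : Fin k → Fin k} (hpv : par v = u)
    (hne : ∀ y, y ≠ u → y ≠ par y)
    (hinj : Set.InjOn (fun y => s(y, par y)) (Finset.univ.erase u : Finset (Fin k)))
    (himg : (Finset.univ.erase u).image (fun y => s(y, par y)) = T.edgeFinset)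
    (s : Fin k ↪ Fin n) :
    bFunction s T D = ∏ y ∈ (Finset.univ.erase u).erase v, (D (s (par y)) : ℝ) := by
  have hpos : ∀ x, (0 : ℝ) < D (s x) := fun x => by exact_mod_cast hD (s x)
  have h1 : bFunction s T D * ∏ x, (D (s x) : ℝ) = ∏ x, (D (s x) : ℝ) ^ T.degree x := by
    rw [bFunction, ← Finset.prod_mul_distrib]
    refine Finset.prod_congr rfl fun x _ => ?_
    rw [zpow_sub₀ (hpos x).ne', zpow_one, zpow_natCast]
    exact div_mul_cancel₀ _ (hpos x).ne'
  rw [prod_pow_degree, ← himg, Finset.prod_image hinj] at h1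
  have h2 : ∏ y ∈ Finset.univ.erase u, (∏ x, if x ∈ s(y, par y) then (D (s x) : ℝ) else 1)
      = (∏ y ∈ Finset.univ.erase u, (D (s y) : ℝ)) *
        ∏ y ∈ Finset.univ.erase u, (D (s (par y)) : ℝ) := by
    rw [← Finset.prod_mul_distrib]
    exact Finset.prod_congr rfl fun y hy => prod_ite_mem_mk _ (hne y (Finset.mem_erase.1 hy).1)
  rw [h2, ← Finset.mul_prod_erase Finset.univ _ (Finset.mem_univ u),
    ← Finset.mul_prod_erase (Finset.univ.erase u) (fun y => (D (s (par y)) : ℝ))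
      (Finset.mem_erase.2 ⟨huv.symm, Finset.mem_univ v⟩), hpv] at h1
  have h3 : (0 : ℝ) < D (s u) * ∏ y ∈ Finset.univ.erase u, (D (s y) : ℝ) :=
    mul_pos (hpos u) (Finset.prod_pos fun y _ => hpos y)
  apply mul_right_cancel₀ h3.ne'
  rw [h1]
  ring

/-- The weighted number of embeddings of a tree with one edge prescribed is bounded. -/
theorem sum_embedding_le {T : SimpleGraph (Fin k)} (hT : T.IsTree) {D : Fin n → ℕ}
    (hD : ∀ i, 1 ≤ D i) (W : Sym2 (Fin n) → ℝ) (hW : ∀ e, 0 ≤ W e)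
    (hrow : ∀ i, ∑ j, W s(i, j) ≤ 3 * D i) {u v : Fin k} (huv : T.Adj u v) (i j : Fin n) :
    ∑ s : Fin k ↪ Fin n with s u = i ∧ s v = j,
      1 / bFunction s T D * ∏ f ∈ T.edgeFinset.erase s(u, v), W (f.map s) ≤ 3 ^ k := by
  obtain ⟨par, hpar, hinj, himg⟩ := exists_parent hT u
  have hpv : par v = u := by
    have h1 := (hpar v huv.ne').2
    rw [SimpleGraph.dist_eq_one_iff_adj.2 huv.symm] at h1
    exact (hT.1.dist_eq_zero_iff).1 (by omega)
  set Y := (Finset.univ.erase u).erase v with hYdef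
  have himgY : T.edgeFinset.erase s(u, v) = Y.image fun y => s(y, par y) := by
    rw [← himg, hYdef]
    have hv : s(u, v) = (fun y => s(y, par y)) v := by simp only [hpv]; exact Sym2.eq_swap
    rw [hv]
    ext e
    simp only [Finset.mem_erase, Finset.mem_image, Finset.mem_univ, and_true]
    constructor
    · rintro ⟨h1, y, hy, rfl⟩
      exact ⟨y, ⟨fun h => h1 (h ▸ rfl), hy⟩, rfl⟩
    · rintro ⟨y, ⟨hyv, hyu⟩, rfl⟩
      refine ⟨fun h => hyv (hinj ?_ ?_ h), y, hyu, rfl⟩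
      · simpa using hyu
      · simpa using huv.ne'
  have hYinj : Set.InjOn (fun y => s(y, par y)) (Y : Set (Fin k)) :=
    hinj.mono (Finset.coe_subset.2 (Finset.erase_subset _ _))
  -- Dividing by the degree of the parent makes m a kernel with row sums at most 3; these divisors
  -- are exactly ψ.
  let m : Fin n → Fin n → ℝ := fun a b => W s(b, a) / D a
  have hDpos : ∀ a, (0 : ℝ) < D a := fun a => by exact_mod_cast hD a
  have hm : ∀ a b, 0 ≤ m a b := fun a b => div_nonneg (hW _) (hDpos a).le
  have hmC : ∀ a, ∑ b, m a b ≤ 3 := fun a => by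
    simp only [m]
    rw [← Finset.sum_div, div_le_iff₀ (hDpos a)]
    simpa only [Sym2.eq_swap] using hrow a
  have hYmem : ∀ y ∈ Y, y ≠ u := fun y hy =>
    (Finset.mem_erase.1 (Finset.mem_of_mem_erase hy)).1
  have hbound := sum_extensions_le m hm hmC par (fun y => T.dist y u)
    (fun x => if x = u then i else j) Y (fun y hy => (hpar y (hYmem y hy)).2)
  have hterm : ∀ s : Fin k ↪ Fin n,
      1 / bFunction s T D * ∏ f ∈ T.edgeFinset.erase s(u, v), W (f.map s)
        = ∏ y ∈ Y, m (s (par y)) (s y) := by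
    intro s
    rw [himgY, Finset.prod_image hYinj,
      bFunction_eq hD huv.ne hpv (fun y hy => (hpar y hy).1.ne) hinj himg s,
      Finset.prod_div_distrib, one_div, inv_mul_eq_div]
    simp only [Sym2.map_mk]
    rfl
  simp only [hterm]
  have hYk : Y.card ≤ k := by simpa using Finset.card_le_univ Y
  refine le_trans ?_ (hbound.trans (pow_le_pow_right₀ (by norm_num) hYk))
  set I := (Finset.univ.filter fun s : Fin k ↪ Fin n => s u = i ∧ s v = j).image
    fun s : Fin k ↪ Fin n => ⇑s with hI
  have himage : I ⊆ Finset.univ.filter fun s : Fin k → Fin n =>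
        ∀ x ∉ Y, s x = if x = u then i else j := by
    intro f hf
    obtain ⟨s, hs, rfl⟩ := Finset.mem_image.1 hf
    simp only [Finset.mem_filter, Finset.mem_univ, true_and] at hs ⊢
    intro x hx
    by_cases hxu : x = u
    · simp [hxu, hs.1]
    · by_cases hxv : x = v
      · rw [if_neg hxu, hxv, hs.2]
      · exact absurd (Finset.mem_erase.2 ⟨hxv, Finset.mem_erase.2 ⟨hxu, Finset.mem_univ x⟩⟩) hx
  calc _ = ∑ f ∈ I, ∏ y ∈ Y, m (f (par y)) (f y) := by
        rw [hI, Finset.sum_image]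
        intro s _ s' _ h
        exact DFunLike.coe_injective h
    _ ≤ ∑ f : Fin k → Fin n with ∀ x ∉ Y, f x = if x = u then i else j,
          ∏ y ∈ Y, m (f (par y)) (f y) :=
        Finset.sum_le_sum_of_subset_of_nonneg himage fun f _ _ =>
          Finset.prod_nonneg fun y _ => hm _ _
    _ = _ := Finset.sum_congr (by ext; simp) fun _ _ => rfl

end Trees

/-! ### Graphs as families of bits -/

section Encoding

variable {n k : ℕ}

/-- The edges of the complete graph on `Fin n`. -/
abbrev Edge (n : ℕ) : Type := {e : Sym2 (Fin n) // ¬ e.IsDiag}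

/-- A graph is the family of the indicators of its edges. -/
def graphBits (n : ℕ) : SimpleGraph (Fin n) ≃ (Edge n → Bool) where
  toFun G e := decide (e.1 ∈ G.edgeSet)
  invFun ω := SimpleGraph.fromEdgeSet {e | ∃ h : ¬ e.IsDiag, ω ⟨e, h⟩ = true}
  left_inv G := by
    ext i j
    simp only [SimpleGraph.fromEdgeSet_adj, Set.mem_ofPred_eq, Sym2.mk_isDiag_iff,
      decide_eq_true_eq, SimpleGraph.mem_edgeSet, exists_prop]
    exact ⟨fun h => h.1.2, fun h => ⟨⟨h.ne, h⟩, h.ne⟩⟩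
  right_inv ω := by
    funext ⟨e, he⟩
    apply Bool.eq_iff_iff.2
    simp only [decide_eq_true_eq, SimpleGraph.edgeSet_fromEdgeSet,
      Set.mem_sdiff, Set.mem_ofPred_eq]
    exact ⟨fun h => h.1.2, fun h => ⟨⟨he, h⟩, he⟩⟩

/-- The indicator of the edges of a graph, on all unordered pairs. -/
def edgeInd (G : SimpleGraph (Fin n)) (e : Sym2 (Fin n)) : ℝ := if e ∈ G.edgeSet then 1 else 0

theorem edgeInd_nonneg (G : SimpleGraph (Fin n)) (e : Sym2 (Fin n)) : 0 ≤ edgeInd G e := by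
  rw [edgeInd]; split_ifs <;> simp

theorem edgeInd_of_isDiag (G : SimpleGraph (Fin n)) {e : Sym2 (Fin n)} (he : e.IsDiag) :
    edgeInd G e = 0 :=
  if_neg fun h => G.not_isDiag_of_mem_edgeSet h he

theorem bit_graphBits (G : SimpleGraph (Fin n)) (e : Edge n) :
    bit (graphBits n G e) = edgeInd G e.1 := by
  simp [bit, graphBits, edgeInd]

theorem sum_edgeInd (G : SimpleGraph (Fin n)) (i : Fin n) :
    ∑ j, edgeInd G s(i, j) = G.degree i := by
  simp only [edgeInd, SimpleGraph.mem_edgeSet]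
  rw [Finset.sum_boole, ← G.card_neighborFinset_eq_degree, G.neighborFinset_eq_filter]

theorem sum_filter_mem (g : Sym2 (Fin n) → ℝ) (v : Fin n) :
    ∑ e : Sym2 (Fin n) with v ∈ e, g e = ∑ j, g s(v, j) := by
  have : (Finset.univ.filter fun e : Sym2 (Fin n) => v ∈ e) = Finset.univ.image fun j => s(v, j) := by
    ext e
    simp only [Finset.mem_filter, Finset.mem_univ, true_and, Finset.mem_image]
    constructor
    · rintro ⟨j, rfl⟩
      exact ⟨j, rfl⟩
    · rintro ⟨j, rfl⟩
      simp
  rw [this, Finset.sum_image fun a _ b _ h => Sym2.congr_right.1 h]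

theorem sum_edge (g : Sym2 (Fin n) → ℝ) :
    ∑ e : Edge n, g e.1 = ∑ e : Sym2 (Fin n) with ¬ e.IsDiag, g e :=
  (Finset.sum_subtype _ (by simp) g).symm

theorem prod_edge (g : Sym2 (Fin n) → ℝ) :
    ∏ i, ∏ j with i < j, g s(i, j) = ∏ e : Edge n, g e.1 := by
  have h1 : ∏ e : Edge n, g e.1 = ∏ e : Sym2 (Fin n) with ¬ e.IsDiag, g e :=
    (Finset.prod_subtype _ (by simp) g).symm
  have h2 : (Finset.univ.filter fun e : Sym2 (Fin n) => ¬ e.IsDiag)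
      = (Finset.univ.filter fun q : Fin n × Fin n => q.1 < q.2).image fun q => s(q.1, q.2) := by
    ext e
    induction e using Sym2.ind with
    | _ a b =>
      simp only [Finset.mem_filter, Finset.mem_univ, true_and, Finset.mem_image,
        Sym2.mk_isDiag_iff, Prod.exists]
      constructor
      · intro h
        rcases lt_or_gt_of_ne h with h | h
        · exact ⟨a, b, h, rfl⟩
        · exact ⟨b, a, h, Sym2.eq_swap⟩
      · rintro ⟨c, d, h, h'⟩ rfl
        rw [Sym2.eq_iff] at h'
        rcases h' with ⟨rfl, rfl⟩ | ⟨rfl, rfl⟩ <;> exact lt_irrefl _ h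
  have hinj : Set.InjOn (fun q : Fin n × Fin n => s(q.1, q.2))
      ((Finset.univ.filter fun q : Fin n × Fin n => q.1 < q.2 : Finset _) : Set (Fin n × Fin n)) := by
    rintro ⟨a, b⟩ h1 ⟨c, d⟩ h2 h
    simp only [Finset.coe_filter, Finset.mem_univ, true_and, Set.mem_ofPred_eq] at h1 h2
    simp only [Sym2.eq_iff] at h
    rcases h with ⟨rfl, rfl⟩ | ⟨rfl, rfl⟩
    · rfl
    · exact absurd h1 h2.not_gt
  rw [h1, h2, Finset.prod_image hinj, Finset.prod_filter, ← Finset.univ_product_univ,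
    Finset.prod_product]
  simp only [Finset.prod_filter]

/-- The edge probabilities given by a dual solution. -/
def edgeProb (l : Fin n → ℝ) : Sym2 (Fin n) → ℝ :=
  Sym2.lift ⟨fun i j => Real.sigmoid (l i + l j), fun i j => by simp only [add_comm]⟩

theorem edgeProb_mk (l : Fin n → ℝ) (i j : Fin n) :
    edgeProb l s(i, j) = Real.sigmoid (l i + l j) := rfl

theorem edgeProb_pos (l : Fin n → ℝ) (e : Sym2 (Fin n)) : 0 < edgeProb l e := by
  induction e using Sym2.ind with
  | _ a b => exact Real.sigmoid_pos _

theorem edgeProb_lt_one (l : Fin n → ℝ) (e : Sym2 (Fin n)) : edgeProb l e < 1 := by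
  induction e using Sym2.ind with
  | _ a b => exact Real.sigmoid_lt_one _

theorem edgeProb_mem (l : Fin n → ℝ) (e : Edge n) : 0 ≤ edgeProb l e.1 ∧ edgeProb l e.1 ≤ 1 :=
  ⟨(edgeProb_pos l _).le, (edgeProb_lt_one l _).le⟩

variable {D : Fin n → ℕ} {l : Fin n → ℝ}

theorem IsDual.bernoulliProb_eq (hl : IsDual D l) (G : SimpleGraph (Fin n)) :
    bernoulliProb (maxEntropy D) G = bitWeight (fun e : Edge n => edgeProb l e.1) (graphBits n G) := by
  have h := prod_edge fun e => if e ∈ G.edgeSet then edgeProb l e else 1 - edgeProb l e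
  rw [bernoulliProb, bitWeight, hl.maxEntropy_eq]
  simp only [graphBits, Equiv.coe_fn_mk, decide_eq_true_eq]
  rw [← h]
  refine Finset.prod_congr rfl fun i _ => Finset.prod_congr rfl fun j hj => ?_
  have hij : i ≠ j := ne_of_lt (by simpa using hj)
  simp only [SimpleGraph.mem_edgeSet, edgeProb_mk, if_neg hij]

/-- The log-likelihood is linear in the degrees, so P is nearly constant on graphs with nearly equal
degrees. -/
theorem IsDual.bernoulliProb_eq_exp (hl : IsDual D l) (G : SimpleGraph (Fin n)) :
    bernoulliProb (maxEntropy D) G = Real.exp ((∑ i, (G.degree i : ℝ) * l i)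
      - ∑ i, ∑ j with i < j, softplus (l i + l j)) := by
  have h1 : ∀ i, ∑ j with j ≠ i, edgeInd G s(i, j) = (G.degree i : ℝ) := by
    intro i
    rw [← sum_edgeInd, Finset.sum_filter]
    refine Finset.sum_congr rfl fun j _ => ?_
    split_ifs with h
    · rfl
    · rw [edgeInd_of_isDiag]
      simp only [not_not] at h
      simp [h]
  simp only [← h1]
  rw [← sum_lt_mul_add (fun i j => by rw [Sym2.eq_swap]) l, ← Finset.sum_sub_distrib,
    Real.exp_sum, bernoulliProb, hl.maxEntropy_eq]
  refine Finset.prod_congr rfl fun i _ => ?_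
  rw [← Finset.sum_sub_distrib, Real.exp_sum]
  refine Finset.prod_congr rfl fun j hj => ?_
  have hij : i ≠ j := ne_of_lt (by simpa using hj)
  simp only [if_neg hij, edgeInd, SimpleGraph.mem_edgeSet]
  split_ifs
  · rw [one_mul, ← log_sigmoid, Real.exp_log (Real.sigmoid_pos _)]
  · rw [zero_mul, zero_sub, ← log_one_sub_sigmoid,
      Real.exp_log (sub_pos.2 (Real.sigmoid_lt_one _))]

theorem IsDual.sum_bernoulliProb_mul (hl : IsDual D l) (f : SimpleGraph (Fin n) → ℝ) :
    ∑ G, bernoulliProb (maxEntropy D) G * f G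
      = ∑ ω : Edge n → Bool, bitWeight (fun e : Edge n => edgeProb l e.1) ω
          * f ((graphBits n).symm ω) := by
  refine Fintype.sum_equiv (graphBits n) _ _ fun G => ?_
  rw [hl.bernoulliProb_eq]
  simp

/-- The edges of the image of `T` under `s`. -/
def treeEdges (s : Fin k ↪ Fin n) (T : SimpleGraph (Fin k)) : Finset (Edge n) :=
  Finset.univ.filter fun e => e.1 ∈ T.edgeFinset.image (Sym2.map s)

theorem not_isDiag_map (s : Fin k ↪ Fin n) {f : Sym2 (Fin k)} (hf : ¬ f.IsDiag) :
    ¬ (f.map s).IsDiag := by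
  induction f using Sym2.ind with
  | _ a b => simpa using hf

theorem prod_treeEdges (s : Fin k ↪ Fin n) (T : SimpleGraph (Fin k)) (g : Sym2 (Fin n) → ℝ) :
    ∏ e ∈ treeEdges s T, g e.1 = ∏ f ∈ T.edgeFinset, g (f.map s) := by
  rw [← Finset.prod_image (f := g) (g := Sym2.map s) fun a _ b _ h => Sym2.map.injective s.injective h]
  refine Finset.prod_nbij (fun e => e.1) ?_ ?_ ?_ ?_
  · intro e he
    exact (Finset.mem_filter.1 he).2
  · intro a _ b _ h
    exact Subtype.ext h
  · intro e he
    obtain ⟨f, hf, rfl⟩ := Finset.mem_image.1 (Finset.mem_coe.1 he)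
    exact ⟨⟨f.map s, not_isDiag_map s (SimpleGraph.not_isDiag_of_mem_edgeFinset hf)⟩,
      Finset.mem_coe.2 (Finset.mem_filter.2 ⟨Finset.mem_univ _, Finset.mem_coe.1 he⟩), rfl⟩
  · intro e _
    rfl

theorem treeIndicator_eq (s : Fin k ↪ Fin n) (T : SimpleGraph (Fin k)) (G : SimpleGraph (Fin n)) :
    treeIndicator s T G = ∏ e ∈ treeEdges s T, bit (graphBits n G e) := by
  simp only [bit_graphBits]
  rw [prod_treeEdges s T (edgeInd G)]
  rfl

theorem IsDual.probIndep_eq (hl : IsDual D l) (s : Fin k ↪ Fin n) (T : SimpleGraph (Fin k)) :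
    probIndep D s T = ∏ e ∈ treeEdges s T, edgeProb l e.1 := by
  rw [probIndep, hl.sum_bernoulliProb_mul]
  simp only [treeIndicator_eq, Equiv.apply_symm_apply]
  have h := sum_bitWeight_mul_prod (fun e : Edge n => edgeProb l e.1)
    (fun e b => if e ∈ treeEdges s T then bit b else 1)
  simp only [Finset.prod_ite_mem, Finset.univ_inter] at h
  rw [h, ← Finset.prod_subset (Finset.subset_univ (treeEdges s T))]
  · refine Finset.prod_congr rfl fun e he => ?_
    simp [he, bit]
  · intro e _ he
    simp [he]

end Encoding

/-! ### The probability of almost realizing the degree sequence -/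

section LowerBound

variable {n : ℕ} {D : Fin n → ℕ} {l : Fin n → ℝ}

theorem mem_almostGraphs {a : ℝ} {G : SimpleGraph (Fin n)} :
    G ∈ almostGraphs a D ↔ ∀ i, |(D i : ℝ) - (G.degree i : ℝ)| < (D i : ℝ) ^ a := by
  simp only [almostGraphs, graphsWithDegrees, Set.mem_iUnion]
  constructor
  · rintro ⟨D', hD', hG⟩ i
    rw [hG i]
    exact hD' i
  · intro h
    exact ⟨fun i => G.degree i, h, fun i => rfl⟩

theorem sum_edge_mem (g : Sym2 (Fin n) → ℝ) (v : Fin n) :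
    ∑ e : Edge n with v ∈ e.1, g e.1 = ∑ j with j ≠ v, g s(v, j) := by
  rw [Finset.sum_filter, sum_edge fun e => if v ∈ e then g e else 0, Finset.sum_filter]
  have h := sum_filter_mem (fun e => if ¬ e.IsDiag then g e else 0) v
  rw [Finset.sum_filter] at h
  rw [Finset.sum_filter]
  calc _ = ∑ e : Sym2 (Fin n), if v ∈ e then (if ¬ e.IsDiag then g e else 0) else 0 := by
        refine Finset.sum_congr rfl fun e _ => ?_
        split_ifs <;> rfl
    _ = _ := h
    _ = _ := by
        refine Finset.sum_congr rfl fun j _ => ?_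
        simp only [Sym2.mk_isDiag_iff, eq_comm (a := v)]

theorem degree_eq_sum_edge (G : SimpleGraph (Fin n)) (v : Fin n) :
    (G.degree v : ℝ) = ∑ e : Edge n with v ∈ e.1, edgeInd G e.1 := by
  rw [sum_edge_mem, ← sum_edgeInd, Finset.sum_filter]
  refine Finset.sum_congr rfl fun j _ => ?_
  split_ifs with h
  · rfl
  · rw [edgeInd_of_isDiag]
    simp only [not_not] at h
    simp [h]

theorem IsDual.sum_edgeProb (hl : IsDual D l) (v : Fin n) :
    ∑ e : Edge n with v ∈ e.1, edgeProb l e.1 = D v := by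
  rw [sum_edge_mem, ← hl v]
  rfl

theorem sum_meeting (S : Finset (Fin n)) (g : Sym2 (Fin n) → ℝ) :
    ∑ e : Edge n with e.1 ∈ meeting S, g e.1 = ∑ e ∈ meeting S, g e := by
  rw [Finset.sum_filter, sum_edge fun e => if e ∈ meeting S then g e else 0, Finset.sum_ite_mem]
  congr 1
  ext e
  simp only [meeting, Finset.mem_inter, Finset.mem_filter, Finset.mem_univ, true_and]
  tauto

theorem wdeg_eq (S : Finset (Fin n)) (g : Sym2 (Fin n) → ℝ) (v : Fin n) :
    wdeg S g v = ∑ e : Edge n with e.1 ∈ meeting S, if v ∈ e.1 then g e.1 else 0 := by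
  rw [sum_meeting S fun e => if v ∈ e then g e else 0, wdeg, Finset.sum_filter]

theorem sum_edge_mem_eq_wdeg_add (S : Finset (Fin n)) (g : Sym2 (Fin n) → ℝ) (v : Fin n) :
    ∑ e : Edge n with v ∈ e.1, g e.1
      = wdeg S g v + ∑ e : Edge n with v ∈ e.1 ∧ e.1 ∉ meeting S, g e.1 := by
  rw [wdeg_eq, Finset.sum_filter, Finset.sum_filter, Finset.sum_filter, ← Finset.sum_add_distrib]
  refine Finset.sum_congr rfl fun e _ => ?_
  by_cases h1 : v ∈ e.1 <;> by_cases h2 : e.1 ∈ meeting S <;> simp [h1, h2]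

theorem wdeg_eq_of_mem {S : Finset (Fin n)} (g : Sym2 (Fin n) → ℝ) {v : Fin n} (hv : v ∈ S) :
    wdeg S g v = ∑ e : Edge n with v ∈ e.1, g e.1 := by
  rw [sum_edge_mem_eq_wdeg_add S g v]
  have : (Finset.univ.filter fun e : Edge n => v ∈ e.1 ∧ e.1 ∉ meeting S) = ∅ := by
    ext e
    simp only [Finset.mem_filter, Finset.mem_univ, true_and, Finset.notMem_empty, iff_false,
      not_and, not_not]
    exact fun h => mem_meeting.2 ⟨e.2, v, hv, h⟩
  rw [this]
  simp

theorem sum_meeting_le (S : Finset (Fin n)) {g : Sym2 (Fin n) → ℝ}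
    (hg : ∀ e ∈ meeting S, 0 ≤ g e) : ∑ e ∈ meeting S, g e ≤ ∑ i ∈ S, wdeg S g i := by
  simp only [wdeg, Finset.sum_filter]
  rw [Finset.sum_comm]
  refine Finset.sum_le_sum fun e he => ?_
  obtain ⟨-, i, hi, hie⟩ := mem_meeting.1 he
  calc g e = if i ∈ e then g e else 0 := by rw [if_pos hie]
    _ ≤ _ := Finset.single_le_sum (f := fun i => if i ∈ e then g e else 0)
      (fun j _ => by split_ifs; exacts [hg e he, le_rfl]) hi

/-- The indicator that a bit agrees with a prescribed configuration on the edges meeting `S`. -/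
def agree (S : Finset (Fin n)) (y : Sym2 (Fin n) → ℝ) (e : Edge n) (b : Bool) : ℝ :=
  if e.1 ∈ meeting S then (if bit b = y e.1 then 1 else 0) else 1

theorem agree_nonneg (S : Finset (Fin n)) (y : Sym2 (Fin n) → ℝ) (e : Edge n) (b : Bool) :
    0 ≤ agree S y e b := by
  unfold agree; split_ifs <;> simp

/-- The probability that the edges meeting `S` follow the configuration `y`. -/
def configProb (l : Fin n → ℝ) (S : Finset (Fin n)) (y : Sym2 (Fin n) → ℝ) : ℝ :=
  ∑ ω : Edge n → Bool, bitWeight (fun e : Edge n => edgeProb l e.1) ω * ∏ e, agree S y e (ω e)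

/-- Edges off `meeting S` are independent of the prescribed configuration, so its probability
factors out of the Chernoff bound. -/
theorem IsDual.sum_agree_mul_exp_le (hl : IsDual D l) (S : Finset (Fin n)) (y : Sym2 (Fin n) → ℝ)
    (v : Fin n) {θ : ℝ} (hθ : |θ| ≤ 1) :
    ∑ ω : Edge n → Bool, bitWeight (fun e : Edge n => edgeProb l e.1) ω *
      ((∏ e, agree S y e (ω e)) * Real.exp (θ *
        ∑ e : Edge n with v ∈ e.1 ∧ e.1 ∉ meeting S, (bit (ω e) - edgeProb l e.1)))
      ≤ configProb l S y * Real.exp (θ ^ 2 * D v) := by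
  have hprod : ∀ ω : Edge n → Bool, (∏ e, agree S y e (ω e)) * Real.exp (θ *
        ∑ e : Edge n with v ∈ e.1 ∧ e.1 ∉ meeting S, (bit (ω e) - edgeProb l e.1))
      = ∏ e, (agree S y e (ω e) * if v ∈ e.1 ∧ e.1 ∉ meeting S then
          Real.exp (θ * (bit (ω e) - edgeProb l e.1)) else 1) := by
    intro ω
    rw [Finset.prod_mul_distrib, Finset.mul_sum, Real.exp_sum, Finset.prod_filter]
  simp only [hprod]
  rw [sum_bitWeight_mul_prod _ (fun e b => agree S y e b * if v ∈ e.1 ∧ e.1 ∉ meeting S then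
          Real.exp (θ * (bit b - edgeProb l e.1)) else 1), configProb, sum_bitWeight_mul_prod]
  have hexp : Real.exp (θ ^ 2 * ∑ e : Edge n with v ∈ e.1 ∧ e.1 ∉ meeting S, edgeProb l e.1)
      ≤ Real.exp (θ ^ 2 * D v) := by
    apply Real.exp_le_exp.2
    apply mul_le_mul_of_nonneg_left _ (sq_nonneg θ)
    rw [← hl.sum_edgeProb v]
    refine Finset.sum_le_sum_of_subset_of_nonneg (fun e he => ?_) fun e _ _ =>
      (edgeProb_pos l e.1).le
    simp only [Finset.mem_filter, Finset.mem_univ, true_and] at he ⊢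
    exact he.1
  have hnn : ∀ e : Edge n, 0 ≤ edgeProb l e.1 * agree S y e true
      + (1 - edgeProb l e.1) * agree S y e false := fun e =>
    add_nonneg (mul_nonneg (edgeProb_mem l e).1 (agree_nonneg _ _ _ _))
      (mul_nonneg (sub_nonneg.2 (edgeProb_mem l e).2) (agree_nonneg _ _ _ _))
  refine le_trans ?_ (mul_le_mul_of_nonneg_left hexp (Finset.prod_nonneg fun e _ => hnn e))
  rw [Finset.mul_sum, Real.exp_sum, Finset.prod_filter, ← Finset.prod_mul_distrib]
  refine Finset.prod_le_prod (fun e _ => ?_) fun e _ => ?_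
  · refine add_nonneg (mul_nonneg (edgeProb_mem l e).1 (mul_nonneg (agree_nonneg _ _ _ _) ?_))
      (mul_nonneg (sub_nonneg.2 (edgeProb_mem l e).2) (mul_nonneg (agree_nonneg _ _ _ _) ?_)) <;>
    · split_ifs <;> positivity
  · split_ifs with h
    · simp only [agree, if_neg h.2, bit, if_true, Bool.false_eq_true, if_false]
      have := bernoulli_exp_le (p := edgeProb l e.1) (b := θ) (edgeProb_mem l e).1 hθ
      simpa using this
    · simp

theorem exp_neg_le_sigmoid {Λ t : ℝ} (ht : |t| ≤ 2 * Λ) :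
    Real.exp (-(2 * Λ + 1)) ≤ Real.sigmoid t := by
  have h0 : 0 ≤ 2 * Λ := (abs_nonneg t).trans ht
  rw [Real.sigmoid_def, Real.exp_neg]
  apply inv_anti₀
  · have := Real.exp_pos (-t)
    linarith
  · have h1 : Real.exp (-t) ≤ Real.exp (2 * Λ) := Real.exp_le_exp.2 (by linarith [(abs_le.1 ht).1])
    have h2 : 1 ≤ Real.exp (2 * Λ) := Real.one_le_exp h0
    have h3 : (2 : ℝ) ≤ Real.exp 1 := by linarith [Real.add_one_le_exp (1 : ℝ)]
    rw [Real.exp_add]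
    nlinarith

/-- The exponent is proportional to p, so that forbidding many unlikely edges costs only their
expected number: 1 − p ≥ e^{−2p} for p ≤ 1/2, and 2p ≥ 1 otherwise. -/
theorem exp_neg_le_one_sub {c p : ℝ} (hc : 1 ≤ c) (hp : 0 ≤ p) (h : Real.exp (-c) ≤ 1 - p) :
    Real.exp (-(c * (2 * p))) ≤ 1 - p := by
  rcases le_total p (1 / 2) with hp2 | hp2
  · have h1 : Real.exp (-(c * (2 * p))) ≤ Real.exp (-(2 * p)) := Real.exp_le_exp.2 (by nlinarith)
    refine h1.trans ?_
    rw [Real.exp_neg, inv_le_comm₀ (Real.exp_pos _) (by linarith)]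
    have h2 := Real.add_one_le_exp (2 * p)
    refine le_trans ?_ h2
    rw [inv_le_iff_one_le_mul₀ (by linarith)]
    nlinarith
  · exact (Real.exp_le_exp.2 (by nlinarith)).trans h

theorem abs_add_le_two_mul {Λ : ℝ} (hΛ : ∀ i, |l i| ≤ Λ) (i j : Fin n) : |l i + l j| ≤ 2 * Λ :=
  (abs_add_le _ _).trans (by linarith [hΛ i, hΛ j])

theorem exp_neg_le_configProb {Λ : ℝ} (hΛ0 : 0 ≤ Λ) (hΛ : ∀ i, |l i| ≤ Λ) (S : Finset (Fin n))
    {y : Sym2 (Fin n) → ℝ} (hy : ∀ e ∈ meeting S, y e = 0 ∨ y e = 1) :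
    Real.exp (-((2 * Λ + 1) * ∑ e ∈ meeting S, (y e + 2 * edgeProb l e))) ≤ configProb l S y := by
  rw [configProb, sum_bitWeight_mul_prod,
    ← sum_meeting S (fun e => y e + 2 * edgeProb l e), Finset.mul_sum, ← Finset.sum_neg_distrib,
    Real.exp_sum, Finset.prod_filter]
  refine Finset.prod_le_prod (fun e _ => by split_ifs <;> positivity) fun e _ => ?_
  split_ifs with he
  · have hp0 := edgeProb_mem l e
    have hlow : Real.exp (-(2 * Λ + 1)) ≤ edgeProb l e.1
        ∧ Real.exp (-(2 * Λ + 1)) ≤ 1 - edgeProb l e.1 := by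
      obtain ⟨e, -⟩ := e
      induction e using Sym2.ind with
      | _ i j =>
        rw [edgeProb_mk]
        refine ⟨exp_neg_le_sigmoid (abs_add_le_two_mul hΛ i j), ?_⟩
        rw [← Real.sigmoid_neg]
        exact exp_neg_le_sigmoid (by rw [abs_neg]; exact abs_add_le_two_mul hΛ i j)
    rcases hy e.1 he with h | h
    · simp only [agree, if_pos he, h, bit]
      have := exp_neg_le_one_sub (by linarith) hp0.1 hlow.2
      simpa using this
    · simp only [agree, if_pos he, h, bit]
      have : Real.exp (-((2 * Λ + 1) * (1 + 2 * edgeProb l e.1))) ≤ Real.exp (-(2 * Λ + 1)) := by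
        apply Real.exp_le_exp.2
        nlinarith [hp0.1]
      simpa using this.trans hlow.1
  · simp [agree, he]

theorem indicator_le_exp_add_exp {d t θ : ℝ} (hθ : 0 ≤ θ) :
    (if t ≤ |d| then (1 : ℝ) else 0) ≤ Real.exp (-(θ * t)) * (Real.exp (θ * d) + Real.exp (-θ * d)) := by
  split_ifs with h
  · rw [mul_add, ← Real.exp_add, ← Real.exp_add]
    rcases le_abs.1 h with h | h
    · have h1 : 1 ≤ Real.exp (-(θ * t) + θ * d) := Real.one_le_exp (by nlinarith)
      linarith [Real.exp_pos (-(θ * t) + -θ * d)]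
    · have h1 : 1 ≤ Real.exp (-(θ * t) + -θ * d) := Real.one_le_exp (by nlinarith)
      linarith [Real.exp_pos (-(θ * t) + θ * d)]
  · positivity

/-- Prescribe a rounding y of p on the edges meeting the vertices of degree below L. Their degrees
are then exact, and the price is governed by Σ (y + 2p) ≤ 3 Σ_S d ≤ 3nL. Given this, each of the at
most n other vertices fails with probability at most 1/(2n), so at least half of the probability of
the configuration survives. -/
theorem IsDual.prob_almostGraphs_ge (hl : IsDual D l) (hpos : ∀ i, 1 ≤ D i) {Λ : ℝ}
    (hΛ : ∀ i, |l i| ≤ Λ) {L a : ℝ} (hL0 : 0 ≤ L) (hL : ∃ v, L ≤ D v) (ha : a ≤ 1)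
    (hsix : ∀ v, L ≤ D v → 6 < (D v : ℝ) ^ a)
    (hexp : ∀ v, L ≤ D v → 2 * Real.exp (-((D v : ℝ) ^ (2 * a - 1) / 16)) ≤ 1 / (2 * n)) :
    1 / 2 * Real.exp (-((2 * Λ + 1) * (3 * (n * L)))) ≤
      ∑ G ∈ Finset.univ.filter (fun G : SimpleGraph (Fin n) => G ∈ almostGraphs a D),
        bernoulliProb (maxEntropy D) G := by
  obtain ⟨star, hstar⟩ := hL
  have hΛ0 : 0 ≤ Λ := (abs_nonneg _).trans (hΛ star)
  have hn : (0 : ℝ) < n := by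
    have := star.2
    exact_mod_cast (by omega : 0 < n)
  set S := Finset.univ.filter fun i => (D i : ℝ) < L with hS
  have hSmem : ∀ v, v ∉ S ↔ L ≤ D v := fun v => by simp [hS]
  have hwS : ∀ i ∈ S, wdeg S (edgeProb l) i = D i := fun i hi => by
    rw [wdeg_eq_of_mem _ hi, hl.sum_edgeProb]
  obtain ⟨y, hy01, hyS, hyB⟩ := exists_isRounding (S := S) (x := edgeProb l) (star := star)
    ((hSmem star).2 hstar) (fun e _ => ⟨(edgeProb_pos l e).le, (edgeProb_lt_one l e).le⟩)
    (fun i hi => ⟨D i, by rw [hwS i hi]; simp⟩)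
  set Q := configProb l S y with hQ
  have hDpos : ∀ v, (0 : ℝ) < D v := fun v => by exact_mod_cast hpos v
  set bw := bitWeight (fun e : Edge n => edgeProb l e.1) with hbw
  have hbw0 : ∀ ω, 0 ≤ bw ω := fun ω => bitWeight_nonneg (edgeProb_mem l) ω
  let dev : Fin n → (Edge n → Bool) → ℝ := fun v ω =>
    ∑ e : Edge n with v ∈ e.1 ∧ e.1 ∉ meeting S, (bit (ω e) - edgeProb l e.1)
  let cfg : (Edge n → Bool) → ℝ := fun ω => ∏ e, agree S y e (ω e)
  have hcfg0 : ∀ ω, 0 ≤ cfg ω := fun ω => Finset.prod_nonneg fun e _ => agree_nonneg _ _ _ _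
  have hQlow : Real.exp (-((2 * Λ + 1) * (3 * (n * L)))) ≤ Q := by
    refine le_trans (Real.exp_le_exp.2 ?_) (exp_neg_le_configProb hΛ0 hΛ S hy01)
    have hDS : ∑ i ∈ S, (D i : ℝ) ≤ n * L := by
      calc ∑ i ∈ S, (D i : ℝ) ≤ ∑ _i ∈ S, L :=
            Finset.sum_le_sum fun i hi => (Finset.mem_filter.1 hi).2.le
        _ = S.card * L := by rw [Finset.sum_const, nsmul_eq_mul]
        _ ≤ n * L := by
            gcongr
            exact_mod_cast (Finset.card_le_univ _).trans (by simp)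
    have hy0 : ∀ e ∈ meeting S, 0 ≤ y e := fun e he => by
      rcases hy01 e he with h | h <;> simp [h]
    have h1 := sum_meeting_le S hy0
    have h2 := sum_meeting_le S (g := edgeProb l) fun e _ => (edgeProb_pos l e).le
    rw [Finset.sum_congr rfl fun i hi => (hyS i hi).trans (hwS i hi)] at h1
    rw [Finset.sum_congr rfl hwS] at h2
    rw [Finset.sum_add_distrib, ← Finset.mul_sum, neg_le_neg_iff]
    refine mul_le_mul_of_nonneg_left ?_ (by linarith)
    linarith
  have hcfg_of : ∀ ω, cfg ω ≠ 0 → cfg ω = 1 ∧ ∀ e : Edge n, e.1 ∈ meeting S → bit (ω e) = y e.1 := by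
    intro ω hω
    have h1 : ∀ e : Edge n, e.1 ∈ meeting S → bit (ω e) = y e.1 := by
      intro e he
      by_contra hne
      exact hω (Finset.prod_eq_zero (Finset.mem_univ e) (by simp [agree, he, hne]))
    refine ⟨Finset.prod_eq_one fun e _ => ?_, h1⟩
    by_cases he : e.1 ∈ meeting S
    · simp [agree, he, h1 e he]
    · simp [agree, he]
  have hgood : ∀ ω, cfg ω ≠ 0 → (∀ v ∉ S, |dev v ω| < (D v : ℝ) ^ a / 2) →
      (graphBits n).symm ω ∈ almostGraphs a D := by
    intro ω hω hdev
    obtain ⟨-, hagree⟩ := hcfg_of ω hω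
    rw [mem_almostGraphs]
    intro v
    set G := (graphBits n).symm ω with hG
    have hbit : ∀ e : Edge n, edgeInd G e.1 = bit (ω e) := fun e => by
      rw [← bit_graphBits, hG, Equiv.apply_symm_apply]
    have hw : wdeg S (edgeInd G) v = wdeg S y v := by
      rw [wdeg_eq, wdeg_eq]
      refine Finset.sum_congr rfl fun e he => ?_
      rw [hbit, hagree e (Finset.mem_filter.1 he).2]
    by_cases hv : v ∈ S
    · have : (G.degree v : ℝ) = D v := by
        rw [degree_eq_sum_edge, ← wdeg_eq_of_mem _ hv, hw, hyS v hv, hwS v hv]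
      rw [this, sub_self, abs_zero]
      exact Real.rpow_pos_of_pos (hDpos v) a
    · have h1 : (G.degree v : ℝ) - D v = (wdeg S y v - wdeg S (edgeProb l) v) + dev v ω := by
        rw [degree_eq_sum_edge, ← hl.sum_edgeProb v, sum_edge_mem_eq_wdeg_add S,
          sum_edge_mem_eq_wdeg_add S, hw]
        simp only [dev, Finset.sum_sub_distrib, hbit]
        ring
      rw [abs_sub_comm, h1]
      have h2 := (hyB v hv).1
      have h3 := hdev v hv
      -- The rounding error 3 takes less than half of the tolerance d^a; the random fluctuation gets
      -- the other half.
      have h4 := hsix v ((hSmem v).1 hv)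
      exact (abs_add_le _ _).trans_lt (by linarith)
  -- The minimizer of −θ d^a / 2 + θ² d, with minimum −d^{2a−1}/16.
  let θ : Fin n → ℝ := fun v => (D v : ℝ) ^ (a - 1) / 4
  let E : Fin n → (Edge n → Bool) → ℝ := fun v ω => Real.exp (-(θ v * ((D v : ℝ) ^ a / 2))) *
    (Real.exp (θ v * dev v ω) + Real.exp (-θ v * dev v ω))
  have hE0 : ∀ v ω, 0 ≤ E v ω := fun v ω => by positivity
  have hθ0 : ∀ v, 0 ≤ θ v := fun v => div_nonneg (Real.rpow_nonneg (hDpos v).le _) (by norm_num)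
  have hθ1 : ∀ v, θ v ≤ 1 := fun v => by
    have : (D v : ℝ) ^ (a - 1) ≤ 1 :=
      Real.rpow_le_one_of_one_le_of_nonpos (by exact_mod_cast hpos v) (by linarith)
    simp only [θ]; linarith
  have hpoint : ∀ ω, cfg ω ≤ (if (graphBits n).symm ω ∈ almostGraphs a D then 1 else 0)
      + ∑ v ∈ Sᶜ, cfg ω * E v ω := by
    intro ω
    by_cases hω : cfg ω = 0
    · rw [hω]
      simp only [zero_mul, Finset.sum_const_zero, add_zero]
      split_ifs <;> simp
    · have h1 := (hcfg_of ω hω).1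
      simp only [h1, one_mul]
      by_cases hall : ∀ v ∉ S, |dev v ω| < (D v : ℝ) ^ a / 2
      · rw [if_pos (hgood ω hω hall)]
        have := Finset.sum_nonneg fun v (_ : v ∈ Sᶜ) => hE0 v ω
        linarith
      · push Not at hall
        obtain ⟨v, hv, hbad⟩ := hall
        have h2 := indicator_le_exp_add_exp (d := dev v ω) (t := (D v : ℝ) ^ a / 2) (hθ0 v)
        rw [if_pos hbad] at h2
        have h3 := Finset.single_le_sum (f := fun v => E v ω) (fun v _ => hE0 v ω)
          (Finset.mem_compl.2 hv)
        have h4 : (0 : ℝ) ≤ if (graphBits n).symm ω ∈ almostGraphs a D then 1 else 0 := by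
          split_ifs <;> simp
        linarith
  have hEsum : ∀ v ∉ S, ∑ ω, bw ω * (cfg ω * E v ω) ≤ Q * (1 / (2 * n)) := by
    intro v hv
    have h1 := hl.sum_agree_mul_exp_le S y v (θ := θ v) (by
      rw [abs_of_nonneg (hθ0 v)]; exact hθ1 v)
    have h2 := hl.sum_agree_mul_exp_le S y v (θ := -θ v) (by
      rw [abs_neg, abs_of_nonneg (hθ0 v)]; exact hθ1 v)
    rw [neg_sq] at h2
    have hQ0 : 0 ≤ Q := (Real.exp_pos _).le.trans hQlow
    calc ∑ ω, bw ω * (cfg ω * E v ω)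
        = Real.exp (-(θ v * ((D v : ℝ) ^ a / 2))) *
          (∑ ω, bw ω * (cfg ω * Real.exp (θ v * dev v ω))
            + ∑ ω, bw ω * (cfg ω * Real.exp (-θ v * dev v ω))) := by
          rw [← Finset.sum_add_distrib, Finset.mul_sum]
          refine Finset.sum_congr rfl fun ω _ => ?_
          simp only [E]
          ring
      _ ≤ Real.exp (-(θ v * ((D v : ℝ) ^ a / 2))) *
          (Q * Real.exp (θ v ^ 2 * D v) + Q * Real.exp (θ v ^ 2 * D v)) := by
          gcongr
      _ = Q * (2 * Real.exp (-((D v : ℝ) ^ (2 * a - 1) / 16))) := by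
          have e1 : (D v : ℝ) ^ (a - 1) * (D v : ℝ) ^ a = (D v : ℝ) ^ (2 * a - 1) := by
            rw [← Real.rpow_add (hDpos v)]; congr 1; ring
          have e2 : ((D v : ℝ) ^ (a - 1)) ^ 2 * D v = (D v : ℝ) ^ (2 * a - 1) := by
            rw [← e1, show a = (a - 1) + 1 by ring, Real.rpow_add (hDpos v), Real.rpow_one]
            ring_nf
          have e3 : -((D v : ℝ) ^ (2 * a - 1) / 16)
              = -(θ v * ((D v : ℝ) ^ a / 2)) + θ v ^ 2 * D v := by
            simp only [θ]
            linear_combination (1 / 8 : ℝ) * e1 - (1 / 16 : ℝ) * e2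
          rw [e3, Real.exp_add]
          ring
      _ ≤ _ := mul_le_mul_of_nonneg_left (hexp v ((hSmem v).1 hv)) hQ0
  have hfinal : Q ≤ (∑ G ∈ Finset.univ.filter
      (fun G : SimpleGraph (Fin n) => G ∈ almostGraphs a D), bernoulliProb (maxEntropy D) G)
        + Q * (1 / 2) := by
    have hP : (∑ G ∈ Finset.univ.filter
      (fun G : SimpleGraph (Fin n) => G ∈ almostGraphs a D), bernoulliProb (maxEntropy D) G)
        = ∑ ω, bw ω * (if (graphBits n).symm ω ∈ almostGraphs a D then 1 else 0) := by
      rw [Finset.sum_filter, ← hl.sum_bernoulliProb_mul fun G => if G ∈ almostGraphs a D then 1 else 0]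
      refine Finset.sum_congr rfl fun G _ => ?_
      split_ifs <;> simp
    have hQ0 : 0 ≤ Q := (Real.exp_pos _).le.trans hQlow
    calc Q = ∑ ω, bw ω * cfg ω := rfl
      _ ≤ ∑ ω, (bw ω * (if (graphBits n).symm ω ∈ almostGraphs a D then 1 else 0)
            + ∑ v ∈ Sᶜ, bw ω * (cfg ω * E v ω)) := by
          refine Finset.sum_le_sum fun ω _ => ?_
          rw [← Finset.mul_sum, ← mul_add]
          exact mul_le_mul_of_nonneg_left (hpoint ω) (hbw0 ω)
      _ = _ + ∑ v ∈ Sᶜ, ∑ ω, bw ω * (cfg ω * E v ω) := by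
          rw [Finset.sum_add_distrib, ← hP]
          congr 1
          rw [Finset.sum_comm]
      _ ≤ _ := by
          gcongr
          calc ∑ v ∈ Sᶜ, ∑ ω, bw ω * (cfg ω * E v ω) ≤ ∑ v ∈ Sᶜ, Q * (1 / (2 * n)) :=
                Finset.sum_le_sum fun v hv => hEsum v (Finset.mem_compl.1 hv)
            _ = Sᶜ.card * (Q * (1 / (2 * n))) := by rw [Finset.sum_const, nsmul_eq_mul]
            _ ≤ n * (Q * (1 / (2 * n))) := by
                gcongr
                exact_mod_cast (Finset.card_le_univ _).trans (by simp)
            _ = Q * (1 / 2) := by field_simp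
  linarith

end LowerBound

/-! ### Comparison of the two distributions -/

section Comparison

variable {n k : ℕ} {D : Fin n → ℕ} {l : Fin n → ℝ}

/-- Two graphs in `almostGraphs a D` differ in degree at i by at most 2 d_i^a, and each unit is
weighted by |l_i| ≤ Λ. -/
theorem IsDual.bernoulliProb_le_mul (hl : IsDual D l) {Λ : ℝ} (hΛ : ∀ i, |l i| ≤ Λ) {a : ℝ}
    {G G' : SimpleGraph (Fin n)} (hG : G ∈ almostGraphs a D) (hG' : G' ∈ almostGraphs a D) :
    bernoulliProb (maxEntropy D) G' ≤
      Real.exp (2 * Λ * ∑ i, (D i : ℝ) ^ a) * bernoulliProb (maxEntropy D) G := by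
  rw [mem_almostGraphs] at hG hG'
  rw [hl.bernoulliProb_eq_exp, hl.bernoulliProb_eq_exp, ← Real.exp_add, Real.exp_le_exp]
  have h : ∑ i, ((G'.degree i : ℝ) - G.degree i) * l i ≤ ∑ i, 2 * Λ * (D i : ℝ) ^ a := by
    refine Finset.sum_le_sum fun i _ => ?_
    have h1 : |(G'.degree i : ℝ) - G.degree i| ≤ 2 * (D i : ℝ) ^ a := by
      have h1 := _root_.abs_lt.1 (hG i)
      have h2 := _root_.abs_lt.1 (hG' i)
      exact _root_.abs_le.2 ⟨by linarith, by linarith⟩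
    calc ((G'.degree i : ℝ) - G.degree i) * l i
        ≤ |(G'.degree i : ℝ) - G.degree i| * |l i| := by
          rw [← abs_mul]; exact le_abs_self _
      _ ≤ 2 * (D i : ℝ) ^ a * Λ :=
          mul_le_mul h1 (hΛ i) (abs_nonneg _) ((abs_nonneg _).trans h1)
      _ = _ := by ring
  simp only [sub_mul, Finset.sum_sub_distrib] at h
  rw [← Finset.mul_sum] at h
  linarith

theorem IsDual.inv_card_le (hl : IsDual D l) {Λ : ℝ} (hΛ : ∀ i, |l i| ≤ Λ) {a X : ℝ}
    (hX : 1 / 2 * Real.exp (-X) ≤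
      ∑ G ∈ Finset.univ.filter (fun G : SimpleGraph (Fin n) => G ∈ almostGraphs a D),
        bernoulliProb (maxEntropy D) G)
    {G : SimpleGraph (Fin n)} (hG : G ∈ almostGraphs a D) :
    1 / ((Finset.univ.filter fun G : SimpleGraph (Fin n) => G ∈ almostGraphs a D).card : ℝ) ≤
      Real.exp (2 * Λ * ∑ i, (D i : ℝ) ^ a + (1 + X)) * bernoulliProb (maxEntropy D) G := by
  set A := Finset.univ.filter fun G : SimpleGraph (Fin n) => G ∈ almostGraphs a D with hA
  have hcard : 0 < (A.card : ℝ) := by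
    exact_mod_cast Finset.card_pos.2 ⟨G, Finset.mem_filter.2 ⟨Finset.mem_univ _, hG⟩⟩
  have h1 : ∑ G ∈ A, bernoulliProb (maxEntropy D) G ≤
      A.card * (Real.exp (2 * Λ * ∑ i, (D i : ℝ) ^ a) * bernoulliProb (maxEntropy D) G) := by
    rw [← nsmul_eq_mul]
    exact Finset.sum_le_card_nsmul _ _ _ fun G' hG' =>
      hl.bernoulliProb_le_mul hΛ hG (Finset.mem_filter.1 hG').2
  -- The added 1 absorbs the factor 1/2, since e ≥ 2.
  have h2 : (1 : ℝ) ≤ Real.exp (1 + X) * (1 / 2 * Real.exp (-X)) := by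
    rw [mul_left_comm, ← Real.exp_add, add_neg_cancel_right]
    linarith [Real.add_one_le_exp (1 : ℝ)]
  rw [div_le_iff₀ hcard, Real.exp_add]
  calc (1 : ℝ) ≤ Real.exp (1 + X) * (1 / 2 * Real.exp (-X)) := h2
    _ ≤ Real.exp (1 + X) * (A.card * (Real.exp (2 * Λ * ∑ i, (D i : ℝ) ^ a)
          * bernoulliProb (maxEntropy D) G)) :=
        mul_le_mul_of_nonneg_left (hX.trans h1) (Real.exp_pos _).le
    _ = _ := by ring

/-- The coefficient of `x_e - p_e` in the expansion of a signed sum over ordered trees of the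
differences between products of the bits `x` and products of the edge probabilities `p`. -/
def edgeCoeff {N : ℕ} (o : Edge n ≃ Fin N) (D : Fin n → ℕ) (l : Fin n → ℝ)
    (σ : (Fin k ↪ Fin n) → SimpleGraph (Fin k) → ℝ) (e : Edge n) (ω : Edge n → Bool) : ℝ :=
  ∑ s : Fin k ↪ Fin n, ∑ T : SimpleGraph (Fin k) with T.IsTree,
    if e ∈ treeEdges s T then 1 / bFunction s T D * (σ s T *
      ((∏ f ∈ treeEdges s T with o f < o e, bit (ω f)) *
        ∏ f ∈ treeEdges s T with o e < o f, edgeProb l f.1)) else 0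

theorem edgeCoeff_congr {N : ℕ} {o : Edge n ≃ Fin N}
    {σ : (Fin k ↪ Fin n) → SimpleGraph (Fin k) → ℝ} {e : Edge n} {ω ω' : Edge n → Bool}
    (h : ∀ f, o f < o e → ω f = ω' f) : edgeCoeff o D l σ e ω = edgeCoeff o D l σ e ω' := by
  refine Finset.sum_congr rfl fun s _ => Finset.sum_congr rfl fun T _ => ?_
  rw [Finset.prod_congr rfl fun f hf => by rw [h f (Finset.mem_filter.1 hf).2]]

theorem sum_edgeCoeff_mul {N : ℕ} (o : Edge n ≃ Fin N)
    (σ : (Fin k ↪ Fin n) → SimpleGraph (Fin k) → ℝ) (ω : Edge n → Bool) :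
    ∑ e, edgeCoeff o D l σ e ω * (bit (ω e) - edgeProb l e.1)
      = ∑ s : Fin k ↪ Fin n, ∑ T : SimpleGraph (Fin k) with T.IsTree,
        1 / bFunction s T D * (σ s T *
          (∏ e ∈ treeEdges s T, bit (ω e) - ∏ e ∈ treeEdges s T, edgeProb l e.1)) := by
  simp only [edgeCoeff, Finset.sum_mul]
  rw [Finset.sum_comm]
  refine Finset.sum_congr rfl fun s _ => ?_
  rw [Finset.sum_comm]
  refine Finset.sum_congr rfl fun T _ => ?_
  rw [prod_sub_prod_ordered o (treeEdges s T) (fun e => bit (ω e)) fun e => edgeProb l e.1,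
    Finset.mul_sum, Finset.mul_sum]
  simp only [ite_mul, zero_mul, Finset.sum_ite_mem, Finset.univ_inter]
  refine Finset.sum_congr rfl fun e _ => ?_
  ring

theorem bFunction_nonneg (s : Fin k ↪ Fin n) (T : SimpleGraph (Fin k)) : 0 ≤ bFunction s T D :=
  Finset.prod_nonneg fun _ _ => zpow_nonneg (Nat.cast_nonneg _) _

theorem exists_adj_of_mem_treeEdges {s : Fin k ↪ Fin n} {T : SimpleGraph (Fin k)} {e : Edge n}
    {i j : Fin n} (he : e.1 = s(i, j)) (h : e ∈ treeEdges s T) :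
    ∃ u v, T.Adj u v ∧ s u = i ∧ s v = j := by
  obtain ⟨f, hf, hfe⟩ := Finset.mem_image.1 (Finset.mem_filter.1 h).2
  rw [he] at hfe
  induction f using Sym2.ind with
  | _ u v =>
    have hadj : T.Adj u v := by simpa using hf
    rw [Sym2.map_mk, Sym2.eq_iff] at hfe
    rcases hfe with ⟨h1, h2⟩ | ⟨h1, h2⟩
    · exact ⟨u, v, hadj, h1, h2⟩
    · exact ⟨v, u, hadj.symm, h2, h1⟩

theorem prod_erase_treeEdges {s : Fin k ↪ Fin n} {T : SimpleGraph (Fin k)} {e : Edge n}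
    {u v : Fin k} (he : e.1 = s(s u, s v)) (W : Sym2 (Fin n) → ℝ) :
    ∏ f ∈ (treeEdges s T).erase e, W f.1 = ∏ f ∈ T.edgeFinset.erase s(u, v), W (f.map s) := by
  have h := prod_treeEdges s T fun x => if x = e.1 then 1 else W x
  rw [← Finset.prod_erase (a := e) _ (by simp),
    ← Finset.prod_erase (s := T.edgeFinset) (a := s(u, v)) (by simp [he])] at h
  calc _ = _ := Finset.prod_congr rfl fun f hf => by
        rw [if_neg fun h => (Finset.mem_erase.1 hf).1 (Subtype.ext h)]
    _ = _ := h
    _ = _ := Finset.prod_congr rfl fun f hf => by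
        rw [if_neg fun h => (Finset.mem_erase.1 hf).1 ?_]
        exact Sym2.map.injective s.injective (by rw [h, he, Sym2.map_mk])

/-- A bound for the coefficients `edgeCoeff`. -/
def coeffBound (k : ℕ) : ℝ := (Fintype.card (SimpleGraph (Fin k)) : ℝ) * (k * (k * 3 ^ k)) + 1

theorem one_le_coeffBound (k : ℕ) : 1 ≤ coeffBound k := by
  have : (0 : ℝ) ≤ (Fintype.card (SimpleGraph (Fin k)) : ℝ) * (k * (k * 3 ^ k)) := by positivity
  unfold coeffBound
  linarith

/-- Sum over the tree T and the ordered pair (u, v) that s sends onto the endpoints of e, then apply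
`sum_embedding_le`. -/
theorem sum_treeEdges_le (hD : ∀ i, 1 ≤ D i) (W : Sym2 (Fin n) → ℝ) (hW : ∀ e, 0 ≤ W e)
    (hrow : ∀ i, ∑ j, W s(i, j) ≤ 3 * D i) (e : Edge n) :
    ∑ s : Fin k ↪ Fin n, ∑ T : SimpleGraph (Fin k) with T.IsTree,
      (if e ∈ treeEdges s T then 1 / bFunction s T D * ∏ f ∈ (treeEdges s T).erase e, W f.1 else 0)
      ≤ coeffBound k := by
  obtain ⟨i, j, he⟩ : ∃ i j, e.1 = s(i, j) := by
    obtain ⟨e, -⟩ := e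
    induction e using Sym2.ind with
    | _ i j => exact ⟨i, j, rfl⟩
  have hterm : ∀ (s : Fin k ↪ Fin n) (T : SimpleGraph (Fin k)),
      (if e ∈ treeEdges s T then 1 / bFunction s T D * ∏ f ∈ (treeEdges s T).erase e, W f.1 else 0)
      ≤ ∑ u, ∑ v, if T.Adj u v then (if s u = i ∧ s v = j then
          1 / bFunction s T D * ∏ f ∈ T.edgeFinset.erase s(u, v), W (f.map s) else 0) else 0 := by
    intro s T
    have h0 : ∀ u v, (0 : ℝ) ≤ if T.Adj u v then (if s u = i ∧ s v = j then
          1 / bFunction s T D * ∏ f ∈ T.edgeFinset.erase s(u, v), W (f.map s) else 0) else 0 := by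
      intro u v
      have := bFunction_nonneg (D := D) s T
      have := Finset.prod_nonneg fun f (_ : f ∈ T.edgeFinset.erase s(u, v)) => hW (f.map s)
      split_ifs <;> positivity
    split_ifs with hmem
    · obtain ⟨u, v, huv, hu, hv⟩ := exists_adj_of_mem_treeEdges he hmem
      rw [prod_erase_treeEdges (u := u) (v := v) (by rw [he, hu, hv]) W]
      refine le_trans ?_ (Finset.single_le_sum (f := fun u => ∑ v, if T.Adj u v then
        (if s u = i ∧ s v = j then 1 / bFunction s T D *
          ∏ f ∈ T.edgeFinset.erase s(u, v), W (f.map s) else 0) else 0)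
        (fun u _ => Finset.sum_nonneg fun v _ => h0 u v) (Finset.mem_univ u))
      refine le_trans ?_ (Finset.single_le_sum (f := fun v => if T.Adj u v then
        (if s u = i ∧ s v = j then 1 / bFunction s T D *
          ∏ f ∈ T.edgeFinset.erase s(u, v), W (f.map s) else 0) else 0)
        (fun v _ => h0 u v) (Finset.mem_univ v))
      rw [if_pos huv, if_pos ⟨hu, hv⟩]
    · exact Finset.sum_nonneg fun u _ => Finset.sum_nonneg fun v _ => h0 u v
  calc _ ≤ ∑ s : Fin k ↪ Fin n, ∑ T : SimpleGraph (Fin k) with T.IsTree,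
        ∑ u, ∑ v, if T.Adj u v then (if s u = i ∧ s v = j then
          1 / bFunction s T D * ∏ f ∈ T.edgeFinset.erase s(u, v), W (f.map s) else 0) else 0 :=
        Finset.sum_le_sum fun s _ => Finset.sum_le_sum fun T _ => hterm s T
    _ = ∑ T : SimpleGraph (Fin k) with T.IsTree, ∑ u, ∑ v, ∑ s : Fin k ↪ Fin n,
        if T.Adj u v then (if s u = i ∧ s v = j then
          1 / bFunction s T D * ∏ f ∈ T.edgeFinset.erase s(u, v), W (f.map s) else 0) else 0 := by
        rw [Finset.sum_comm]
        refine Finset.sum_congr rfl fun T _ => ?_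
        rw [Finset.sum_comm]
        refine Finset.sum_congr rfl fun u _ => ?_
        rw [Finset.sum_comm]
    _ ≤ ∑ T : SimpleGraph (Fin k) with T.IsTree, ∑ _u : Fin k, ∑ _v : Fin k, (3 : ℝ) ^ k := by
        refine Finset.sum_le_sum fun T hT => Finset.sum_le_sum fun u _ =>
          Finset.sum_le_sum fun v _ => ?_
        by_cases huv : T.Adj u v
        · simp only [if_pos huv]
          rw [← Finset.sum_filter]
          exact sum_embedding_le (Finset.mem_filter.1 hT).2 hD W hW hrow huv i j
        · simp only [if_neg huv, Finset.sum_const_zero]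
          positivity
    _ ≤ coeffBound k := by
        simp only [Finset.sum_const, Finset.card_univ, Fintype.card_fin, nsmul_eq_mul, coeffBound]
        refine le_add_of_le_of_nonneg ?_ zero_le_one
        gcongr
        exact Finset.card_le_univ _

/-- Each remaining factor is either a bit of G or an edge probability, so both are dominated by the
single weight W = indicator + probability, regardless of the enumeration. -/
theorem IsDual.abs_edgeCoeff_le (hl : IsDual D l) (hD : ∀ i, 1 ≤ D i) {a : ℝ} (ha : a ≤ 1)
    {G : SimpleGraph (Fin n)} (hG : G ∈ almostGraphs a D) {N : ℕ} (o : Edge n ≃ Fin N)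
    {σ : (Fin k ↪ Fin n) → SimpleGraph (Fin k) → ℝ} (hσ : ∀ s T, |σ s T| ≤ 1) (e : Edge n) :
    |edgeCoeff o D l σ e (graphBits n G)| ≤ coeffBound k := by
  let W : Sym2 (Fin n) → ℝ := fun e => if e.IsDiag then 0 else edgeInd G e + edgeProb l e
  have hW : ∀ e, 0 ≤ W e := fun e => by
    have h1 := edgeInd_nonneg G e
    have h2 := (edgeProb_pos l e).le
    simp only [W]
    split_ifs <;> positivity
  -- Membership of G gives degree at most d_i + d_i^a ≤ 2 d_i, and the expected degree adds d_i.
  have hrow : ∀ i, ∑ j, W s(i, j) ≤ 3 * D i := by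
    intro i
    have h1 : ∑ j, W s(i, j) = G.degree i + D i := by
      rw [← hl i, ← sum_edgeInd, Finset.sum_filter, ← Finset.sum_add_distrib]
      refine Finset.sum_congr rfl fun j _ => ?_
      by_cases h : j = i
      · subst h
        simp [W, edgeInd_of_isDiag]
      · have h' : ¬ i = j := fun h2 => h h2.symm
        simp [W, h, h', edgeProb_mk]
    have h2 := (_root_.abs_lt.1 (mem_almostGraphs.1 hG i)).1
    have h3 : (D i : ℝ) ^ a ≤ D i := by
      calc (D i : ℝ) ^ a ≤ (D i : ℝ) ^ (1 : ℝ) :=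
            Real.rpow_le_rpow_of_exponent_le (by exact_mod_cast hD i) ha
        _ = _ := Real.rpow_one _
    rw [h1]
    linarith
  refine le_trans ?_ (sum_treeEdges_le hD W hW hrow e)
  refine (Finset.abs_sum_le_sum_abs _ _).trans (Finset.sum_le_sum fun s _ => ?_)
  refine (Finset.abs_sum_le_sum_abs _ _).trans (Finset.sum_le_sum fun T _ => ?_)
  split_ifs with he
  · have hb := bFunction_nonneg (D := D) s T
    rw [abs_mul, abs_of_nonneg (by positivity)]
    refine mul_le_mul_of_nonneg_left ?_ (by positivity)
    have hx : ∀ f : Edge n, 0 ≤ bit (graphBits n G f) ∧ bit (graphBits n G f) ≤ W f.1 := fun f => by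
      refine ⟨bit_nonneg _, ?_⟩
      simp only [W, if_neg f.2, bit_graphBits]
      linarith [edgeProb_pos l f.1]
    have hp : ∀ f : Edge n, 0 ≤ edgeProb l f.1 ∧ edgeProb l f.1 ≤ W f.1 := fun f => by
      refine ⟨(edgeProb_pos l _).le, ?_⟩
      simp only [W, if_neg f.2]
      linarith [edgeInd_nonneg G f.1]
    have hA : 0 ≤ ∏ f ∈ treeEdges s T with o f < o e, bit (graphBits n G f) :=
      Finset.prod_nonneg fun f _ => (hx f).1
    have hB : 0 ≤ ∏ f ∈ treeEdges s T with o e < o f, edgeProb l f.1 :=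
      Finset.prod_nonneg fun f _ => (hp f).1
    rw [abs_mul, abs_of_nonneg (mul_nonneg hA hB)]
    refine (mul_le_of_le_one_left (mul_nonneg hA hB) (hσ s T)).trans ?_
    have hsplit : (treeEdges s T).erase e = ((treeEdges s T).filter fun f => o f < o e) ∪
        (treeEdges s T).filter fun f => o e < o f := by
      ext f
      simp only [Finset.mem_erase, Finset.mem_union, Finset.mem_filter, ← and_or_left,
        ← ne_iff_lt_or_gt, ne_eq, EmbeddingLike.apply_eq_iff_eq]
      tauto
    have hdisj : Disjoint ((treeEdges s T).filter fun f => o f < o e)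
        ((treeEdges s T).filter fun f => o e < o f) :=
      Finset.disjoint_filter.2 fun f _ h1 h2 => lt_asymm h1 h2
    rw [hsplit, Finset.prod_union hdisj]
    exact mul_le_mul (Finset.prod_le_prod (fun f _ => (hx f).1) fun f _ => (hx f).2)
      (Finset.prod_le_prod (fun f _ => (hp f).1) fun f _ => (hp f).2) hB
      (Finset.prod_nonneg fun f _ => hW _)
  · simp

theorem IsDual.sum_edgeProb_le (hl : IsDual D l) :
    ∑ e : Edge n, edgeProb l e.1 ≤ total D := by
  have h : ((total D : ℕ) : ℝ) = ∑ v, ∑ e : Edge n, if v ∈ e.1 then edgeProb l e.1 else 0 := by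
    rw [total, Nat.cast_sum]
    refine Finset.sum_congr rfl fun v _ => ?_
    rw [← hl.sum_edgeProb v, Finset.sum_filter]
  rw [h, Finset.sum_comm]
  refine Finset.sum_le_sum fun e _ => ?_
  obtain ⟨i, hi⟩ : ∃ i, i ∈ e.1 := ⟨_, Sym2.out_fst_mem e.1⟩
  calc edgeProb l e.1 = if i ∈ e.1 then edgeProb l e.1 else 0 := by rw [if_pos hi]
    _ ≤ _ := Finset.single_le_sum (f := fun i => if i ∈ e.1 then edgeProb l e.1 else 0)
      (fun j _ => by split_ifs; exacts [(edgeProb_pos l _).le, le_rfl]) (Finset.mem_univ i)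

/-- The supermartingale with step r/C is fed into the change of measure. Averaged over A, its linear
part is (r/C) · M · `treeError`, and its compensator is at most M r². -/
theorem IsDual.treeError_le (hl : IsDual D l) (hD : ∀ i, 1 ≤ D i) {a K r : ℝ} (ha : a ≤ 1)
    (hM : 0 < total D) (hr : 0 < r) (hr1 : r ≤ 1) (hne : (almostGraphs a D).Nonempty)
    (hK : ∀ G ∈ almostGraphs a D,
      1 / ((Finset.univ.filter fun G : SimpleGraph (Fin n) => G ∈ almostGraphs a D).card : ℝ) ≤
        Real.exp K * bernoulliProb (maxEntropy D) G)
    (hKr : K ≤ total D * r ^ 2) :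
    treeError a k D ≤ 2 * coeffBound k * r := by
  set A := Finset.univ.filter fun G : SimpleGraph (Fin n) => G ∈ almostGraphs a D with hA
  have hAmem : ∀ G, G ∈ A ↔ G ∈ almostGraphs a D := fun G => by simp [hA]
  have hAne : A.Nonempty := by
    obtain ⟨G, hG⟩ := hne
    exact ⟨G, (hAmem G).2 hG⟩
  have hcard : 0 < (A.card : ℝ) := by exact_mod_cast hAne.card_pos
  set C := coeffBound k with hC
  have hC1 : 1 ≤ C := one_le_coeffBound k
  have hC0 : 0 < C := by linarith
  let o := Fintype.equivFin (Edge n)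
  let σ : (Fin k ↪ Fin n) → SimpleGraph (Fin k) → ℝ := fun s T =>
    if 0 ≤ probAlmost a D s T - probIndep D s T then 1 else -1
  have hσ : ∀ s T, |σ s T| ≤ 1 := fun s T => by
    simp only [σ]
    split_ifs <;> simp
  have hσabs : ∀ s T, σ s T * (probAlmost a D s T - probIndep D s T)
      = |probAlmost a D s T - probIndep D s T| := fun s T => by
    simp only [σ]
    split_ifs with h
    · rw [one_mul, abs_of_nonneg h]
    · rw [neg_one_mul, abs_of_neg (not_le.1 h)]
  -- The coefficients are bounded by C only on A, whereas the exponential bound needs all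
  -- configurations. Truncation preserves predictability and changes nothing on A.
  let b : Edge n → (Edge n → Bool) → ℝ := fun e ω =>
    r / C * max (-C) (min C (edgeCoeff o D l σ e ω))
  have hb : ∀ e ω, |b e ω| ≤ r := fun e ω => by
    have h1 : |max (-C) (min C (edgeCoeff o D l σ e ω))| ≤ C :=
      _root_.abs_le.2 ⟨le_max_left _ _, max_le (by linarith) (min_le_left _ _)⟩
    calc |b e ω| = r / C * |max (-C) (min C (edgeCoeff o D l σ e ω))| := by
          rw [abs_mul, abs_of_pos (div_pos hr hC0)]
      _ ≤ r / C * C := mul_le_mul_of_nonneg_left h1 (div_pos hr hC0).le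
      _ = r := div_mul_cancel₀ _ hC0.ne'
  have hpre : ∀ e ω ω', (∀ f, o f < o e → ω f = ω' f) → b e ω = b e ω' := fun e ω ω' h => by
    simp only [b, edgeCoeff_congr h]
  let f : SimpleGraph (Fin n) → ℝ := fun G => ∑ e,
    (b e (graphBits n G) * (bit (graphBits n G e) - edgeProb l e.1) - r ^ 2 * edgeProb l e.1)
  have hf : ∑ G, bernoulliProb (maxEntropy D) G * Real.exp (f G) ≤ 1 := by
    rw [hl.sum_bernoulliProb_mul fun G => Real.exp (f G)]
    simp only [f, Equiv.apply_symm_apply]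
    exact sum_exp_predictable o (fun e : Edge n => edgeProb l e.1) (edgeProb_mem l) r hr1 b hb hpre
  have havg := average_le_of_sum_exp_le A hAne (bernoulliProb (maxEntropy D)) f
    (fun G => by rw [hl.bernoulliProb_eq]; exact bitWeight_nonneg (edgeProb_mem l) _) K
    (fun G hG => hK G ((hAmem G).1 hG)) hf
  have hfeq : ∀ G ∈ A, f G = r / C * (∑ s : Fin k ↪ Fin n, ∑ T : SimpleGraph (Fin k) with T.IsTree,
        1 / bFunction s T D * (σ s T * (treeIndicator s T G - probIndep D s T)))
      - r ^ 2 * ∑ e : Edge n, edgeProb l e.1 := by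
    intro G hG
    simp only [f, Finset.sum_sub_distrib, ← Finset.mul_sum]
    congr 1
    simp only [treeIndicator_eq, hl.probIndep_eq]
    rw [← sum_edgeCoeff_mul o σ (graphBits n G), Finset.mul_sum]
    refine Finset.sum_congr rfl fun e _ => ?_
    have h := _root_.abs_le.1 (hl.abs_edgeCoeff_le hD ha ((hAmem G).1 hG) o hσ e)
    simp only [b]
    rw [min_eq_right h.2, max_eq_right h.1]
    ring
  have hsum : (∑ G ∈ A, ∑ s : Fin k ↪ Fin n, ∑ T : SimpleGraph (Fin k) with T.IsTree,
        1 / bFunction s T D * (σ s T * (treeIndicator s T G - probIndep D s T))) / A.card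
      = total D * treeError a k D := by
    rw [treeError, ← mul_assoc, mul_one_div_cancel (by exact_mod_cast hM.ne'), one_mul,
      Finset.sum_comm, Finset.sum_div]
    refine Finset.sum_congr rfl fun s _ => ?_
    rw [Finset.sum_comm, Finset.sum_div]
    refine Finset.sum_congr rfl fun T _ => ?_
    rw [← hσabs, ← Finset.mul_sum, ← Finset.mul_sum, Finset.sum_sub_distrib, Finset.sum_const,
      nsmul_eq_mul, mul_div_assoc, mul_div_assoc, sub_div, mul_div_cancel_left₀ _ hcard.ne']
    rfl
  rw [Finset.sum_congr rfl hfeq, Finset.sum_sub_distrib, ← Finset.mul_sum, Finset.sum_const,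
    nsmul_eq_mul, sub_div, mul_div_assoc, hsum, mul_div_cancel_left₀ _ hcard.ne'] at havg
  have hM' : (0 : ℝ) < total D := by exact_mod_cast hM
  have h1 : r / C * (total D * treeError a k D) ≤ r / C * (total D * (2 * C * r)) := by
    have h2 := mul_le_mul_of_nonneg_left hl.sum_edgeProb_le (sq_nonneg r)
    have h3 : r / C * (total D * (2 * C * r)) = 2 * (total D * r ^ 2) := by
      field_simp
    rw [h3]
    linarith
  exact le_of_mul_le_mul_left (le_of_mul_le_mul_left h1 (div_pos hr hC0)) hM'

end Comparison

/-! ### Asymptotics -/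

section Asymptotics

variable {n k : ℕ} {D : Fin n → ℕ} {l : Fin n → ℝ}

/-- Split d^a = d^{a−1/2} √d and apply Cauchy–Schwarz to Σ √d. -/
theorem sum_rpow_le (hD : ∀ i, 1 ≤ D i) (hDn : ∀ i, D i ≤ n) {a : ℝ} (ha : 1 / 2 ≤ a) :
    ∑ i, (D i : ℝ) ^ a ≤ (n : ℝ) ^ (a - 1 / 2) * Real.sqrt (n * total D) := by
  have h1 : ∀ i, (D i : ℝ) ^ a ≤ (n : ℝ) ^ (a - 1 / 2) * Real.sqrt (D i) := by
    intro i
    have hpos : (0 : ℝ) < D i := by exact_mod_cast hD i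
    calc (D i : ℝ) ^ a = (D i : ℝ) ^ (a - 1 / 2) * Real.sqrt (D i) := by
          rw [Real.sqrt_eq_rpow, ← Real.rpow_add hpos]; congr 1; ring
      _ ≤ _ := by
          refine mul_le_mul_of_nonneg_right ?_ (Real.sqrt_nonneg _)
          exact Real.rpow_le_rpow hpos.le (by exact_mod_cast hDn i) (by linarith)
  calc ∑ i, (D i : ℝ) ^ a ≤ ∑ i, (n : ℝ) ^ (a - 1 / 2) * Real.sqrt (D i) :=
        Finset.sum_le_sum fun i _ => h1 i
    _ = (n : ℝ) ^ (a - 1 / 2) * ∑ i, Real.sqrt (D i) := by rw [Finset.mul_sum]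
    _ ≤ _ := by
        refine mul_le_mul_of_nonneg_left ?_ (by positivity)
        apply Real.le_sqrt_of_sq_le
        have h2 := sq_sum_le_card_mul_sum_sq (s := Finset.univ) (f := fun i => Real.sqrt (D i))
        simpa [total] using h2

theorem rpow_two_mul_lt_total {γ x M ν : ℝ} (hx : 0 < x) (hM : 0 < M) (hγ : 1 ≤ γ)
    (h : Real.sqrt (x / M) * γ < x ^ (-ν)) : x ^ (1 + 2 * ν) < M := by
  have h1 : Real.sqrt (x / M) < x ^ (-ν) :=
    (le_mul_of_one_le_right (Real.sqrt_nonneg _) hγ).trans_lt h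
  have h2 : x / M < (x ^ (-ν)) ^ 2 := by
    rwa [Real.sqrt_lt' (by positivity)] at h1
  rw [← Real.rpow_mul_natCast hx.le, div_lt_iff₀ hM] at h2
  have h3 : x ^ (1 + 2 * ν) = x * x ^ (2 * ν) := by rw [Real.rpow_add hx, Real.rpow_one]
  rw [h3]
  calc x * x ^ (2 * ν) < x ^ (-ν * ((2 : ℕ) : ℝ)) * M * x ^ (2 * ν) := by gcongr
    _ = M := by
        rw [mul_right_comm, ← Real.rpow_add hx,
          show -ν * ((2 : ℕ) : ℝ) + 2 * ν = 0 by push_cast; ring, Real.rpow_zero, one_mul]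

/-- Let g = log x, y = x^{−ν}, z = x^{a−1/2}. The three contributions are at most 1, 76 and 231 = 3
· 77 times g·M·y·z, and the target is M·y·z². The spare factor z absorbs 308 g. -/
theorem relative_entropy_le {γ x M ν a Λ w : ℝ} (hx : 1 ≤ x) (hlog : 1 ≤ Real.log x) (hM : 0 < M)
    (hγ : 1 ≤ γ) (hν : 0 ≤ ν) (ha : 1 / 2 ≤ a) (h : Real.sqrt (x / M) * γ < x ^ (-ν))
    (hΛ : Λ = 38 * γ * Real.log x) (hw : w ≤ x ^ (a - 1 / 2) * Real.sqrt (x * M))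
    (hbig : 308 * Real.log x ≤ x ^ (a - 1 / 2)) :
    2 * Λ * w + (1 + (2 * Λ + 1) * (3 * (x * x ^ ν))) ≤ M * (x ^ (a - (ν + 1) / 2)) ^ 2 := by
  have hx0 : 0 < x := by linarith
  set q := Real.sqrt (x / M) with hq
  set y := x ^ (-ν) with hy
  set z := x ^ (a - 1 / 2) with hz
  set g := Real.log x with hg
  have hq0 : 0 ≤ q := Real.sqrt_nonneg _
  have hy0 : 0 < y := by positivity
  have hz1 : 1 ≤ z := Real.one_le_rpow hx (by linarith)
  have hqsq : M * q ^ 2 = x := by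
    rw [hq, Real.sq_sqrt (by positivity)]; field_simp
  have hsqrt : Real.sqrt (x * M) = M * q := by
    rw [show x * M = (M * q) ^ 2 by rw [← hqsq]; ring, Real.sqrt_sq (by positivity)]
  have hyν : y * x ^ ν = 1 := by
    rw [hy, ← Real.rpow_add hx0]; simp
  have hxν : 1 ≤ x ^ ν := Real.one_le_rpow hx hν
  have hr : (x ^ (a - (ν + 1) / 2)) ^ 2 = z * z * y := by
    rw [hz, hy, ← Real.rpow_mul_natCast hx0.le, ← Real.rpow_add hx0, ← Real.rpow_add hx0]
    congr 1; push_cast; ring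
  -- The gap condition is used twice, as q ≤ y and as qγ ≤ y.
  have hxγ : x * γ * x ^ ν ≤ M * y := by
    have h1 : q * (q * γ) ≤ y * y := by
      have h2 : q ≤ y := (le_mul_of_one_le_right hq0 hγ).trans h.le
      exact mul_le_mul h2 h.le (by positivity) hy0.le
    calc x * γ * x ^ ν = M * (q * (q * γ)) * x ^ ν := by rw [← hqsq]; ring
      _ ≤ M * (y * y) * x ^ ν := by gcongr
      _ = M * y * (y * x ^ ν) := by ring
      _ = M * y := by rw [hyν, mul_one]
  have hone : 1 ≤ M * y := by
    refine le_trans ?_ hxγ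
    exact one_le_mul_of_one_le_of_one_le (one_le_mul_of_one_le_of_one_le hx hγ) hxν
  have hMy : M * y ≤ g * (M * y) * z := by
    have : 1 ≤ g * z := one_le_mul_of_one_le_of_one_le hlog hz1
    nlinarith
  have hgMy : g * (M * y) ≤ g * (M * y) * z := le_mul_of_one_le_right (by positivity) hz1
  have t1 : 2 * Λ * w ≤ 76 * (g * (M * y) * z) := by
    have hΛ0 : 0 ≤ Λ := by rw [hΛ]; positivity
    calc 2 * Λ * w ≤ 2 * Λ * (z * (M * q)) := by rw [← hsqrt]; gcongr
      _ = 76 * g * M * z * (q * γ) := by rw [hΛ]; ring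
      _ ≤ 76 * g * M * z * y := by gcongr
      _ = _ := by ring
  have t2 : (2 * Λ + 1) * (3 * (x * x ^ ν)) ≤ 231 * (g * (M * y) * z) := by
    have h1 : 2 * Λ + 1 ≤ 77 * (g * γ) := by
      have := one_le_mul_of_one_le_of_one_le hlog hγ
      rw [hΛ]; nlinarith
    calc (2 * Λ + 1) * (3 * (x * x ^ ν)) ≤ 77 * (g * γ) * (3 * (x * x ^ ν)) := by gcongr
      _ = 231 * (g * (x * γ * x ^ ν)) := by ring
      _ ≤ 231 * (g * (M * y)) := by gcongr
      _ ≤ _ := by linarith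
  calc _ ≤ 308 * (g * (M * y) * z) := by linarith
    _ = 308 * g * (M * y * z) := by ring
    _ ≤ z * (M * y * z) := by gcongr
    _ = _ := by rw [hr]; ring

theorem IsStrictGraphicOfType.treeError_le {ε ν a : ℝ} (hD : IsStrictGraphicOfType ε ν D)
    (hν : 0 < ν) (ha : 1 / 2 < a) (haν : a < ν / 4 + 1 / 2) (hn : 4 ≤ n)
    (hsix : 6 < (n : ℝ) ^ (ν * a)) (hlog : 32 * Real.log n ≤ (n : ℝ) ^ (ν * (2 * a - 1)))
    (hbig : 308 * Real.log n ≤ (n : ℝ) ^ (a - 1 / 2)) :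
    treeError a k D ≤ 2 * coeffBound k * (n : ℝ) ^ (a - (ν + 1) / 2) := by
  obtain ⟨ℓ, last, hlast, hℓ, hgap⟩ := hD.gap
  obtain ⟨l, hl⟩ := hD.strictErdosGallai.exists_isDual hD.mono hD.pos
  set x : ℝ := (n : ℝ) with hx
  have hx4 : (4 : ℝ) ≤ x := by rw [hx]; exact_mod_cast hn
  have hx0 : 0 < x := by linarith
  have hM : 0 < total D :=
    lt_of_lt_of_le (hD.pos last) (Finset.single_le_sum (f := D) (fun _ _ => Nat.zero_le _)
      (Finset.mem_univ last))
  have hM' : (0 : ℝ) < total D := by exact_mod_cast hM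
  have hγ : (1 : ℝ) ≤ (D last : ℝ) - D ℓ + 1 := by
    have h1 : D ℓ ≤ D last := hD.mono (Fin.le_def.2 (by omega))
    have h2 : (D ℓ : ℝ) ≤ D last := by exact_mod_cast h1
    linarith
  have hDn : ∀ i, D i ≤ n := fun i => by
    have := hl.add_one_le i
    omega
  have hMlow := rpow_two_mul_lt_total hx0 hM' hγ hgap
  have hMup : (total D : ℝ) ≤ x ^ (2 : ℝ) := by
    have h1 : total D ≤ n * n := by
      simpa [total] using Finset.sum_le_card_nsmul Finset.univ D n fun i _ => hDn i
    have h2 : x ^ (2 : ℝ) = x * x := by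
      rw [Real.rpow_two, sq]
    rw [h2, hx]
    exact_mod_cast h1
  -- M ≤ n² forces ν < 1/2, hence a < 5/8; this supplies a ≤ 1 below.
  have hν2 : 1 + 2 * ν < 2 :=
    (Real.rpow_lt_rpow_left_iff (by linarith)).1 (hMlow.trans_le hMup)
  have hlog1 : 1 ≤ Real.log x := by
    rw [Real.le_log_iff_exp_le hx0]
    exact Real.exp_one_lt_three.le.trans (by linarith)
  have hΛ := fun i => hl.abs_le hD.strictErdosGallai hD.mono hD.pos hn hlast hℓ.1 i
  set γ : ℝ := (D last : ℝ) - D ℓ + 1 with hγdef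
  -- If all degrees were below n^ν, then M ≤ n^{1+ν}, against M > n^{1+2ν}. Such a vertex serves as
  -- `star` in the rounding.
  have hexists : ∃ v, x ^ ν ≤ D v := by
    by_contra! hcon
    have h1 : (total D : ℝ) ≤ x * x ^ ν := by
      have h2 : ∑ i, (D i : ℝ) ≤ Fintype.card (Fin n) • (x ^ ν) :=
        Finset.sum_le_card_nsmul Finset.univ _ _ fun i _ => (hcon i).le
      rw [Fintype.card_fin, nsmul_eq_mul] at h2
      simpa [total] using h2
    have h2 : x * x ^ ν ≤ x ^ (1 + 2 * ν) := by
      rw [← Real.rpow_one_add' hx0.le (by linarith)]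
      exact Real.rpow_le_rpow_of_exponent_le (by linarith) (by linarith)
    linarith
  have hprob := hl.prob_almostGraphs_ge hD.pos hΛ (L := x ^ ν) (a := a) (by positivity) hexists
    (by linarith)
    (fun v hv => hsix.trans_le (by
      rw [Real.rpow_mul hx0.le]
      exact Real.rpow_le_rpow (by positivity) hv (by linarith)))
    (fun v hv => by
      have h1 : x ^ (ν * (2 * a - 1)) ≤ (D v : ℝ) ^ (2 * a - 1) := by
        rw [Real.rpow_mul hx0.le]
        exact Real.rpow_le_rpow (by positivity) hv (by linarith)
      have h2 : Real.exp (-((D v : ℝ) ^ (2 * a - 1) / 16)) ≤ Real.exp (-(2 * Real.log x)) :=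
        Real.exp_le_exp.2 (by linarith)
      have h3 : Real.exp (-(2 * Real.log x)) = 1 / (x * x) := by
        rw [Real.exp_neg, two_mul, Real.exp_add, Real.exp_log hx0, one_div]
      rw [h3] at h2
      calc 2 * Real.exp (-((D v : ℝ) ^ (2 * a - 1) / 16)) ≤ 2 * (1 / (x * x)) := by linarith
        _ ≤ 1 / (2 * x) := by
          rw [mul_one_div, div_le_div_iff₀ (by positivity) (by positivity)]
          nlinarith)
  have hne : (almostGraphs a D).Nonempty := by
    by_contra hempty
    rw [Set.not_nonempty_iff_eq_empty] at hempty
    rw [hempty] at hprob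
    simp only [Set.mem_empty_iff_false, Finset.filter_false, Finset.sum_empty] at hprob
    linarith [Real.exp_pos (-((2 * (38 * γ * Real.log x) + 1) * (3 * (x * x ^ ν))))]
  refine hl.treeError_le hD.pos (by linarith) hM (Real.rpow_pos_of_pos hx0 _)
    (Real.rpow_le_one_of_one_le_of_nonpos (by linarith) (by linarith)) hne
    (fun G hG => hl.inv_card_le hΛ hprob hG) ?_
  exact relative_entropy_le (by linarith) hlog1 hM' hγ hν.le ha.le hgap rfl
    (sum_rpow_le hD.pos hDn ha.le) hbig

theorem eventually_mul_log_le {c δ : ℝ} (hc : 0 < c) (hδ : 0 < δ) :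
    ∀ᶠ n : ℕ in Filter.atTop, c * Real.log n ≤ (n : ℝ) ^ δ := by
  have h := (isLittleO_log_rpow_atTop hδ).bound (inv_pos.2 hc)
  have h2 := (h.and (Filter.eventually_ge_atTop 1)).natCast_atTop
  filter_upwards [h2] with n hn
  obtain ⟨h3, h4⟩ := hn
  rw [Real.norm_of_nonneg (Real.log_nonneg h4), Real.norm_of_nonneg (by positivity),
    inv_mul_eq_div, le_div_iff₀ hc] at h3
  linarith

end Asymptotics

end

end AlmostDegree

theorem mainTheorem1 (k : ℕ) :
    ∃ c : ℝ, 0 < c ∧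
      ∀ ε ν a : ℝ, 0 < ε → 0 < ν → 1 / 2 < a → a < ν / 4 + 1 / 2 →
        (∃ N : ℕ, ∀ n : ℕ, N ≤ n → ∀ D : Fin n → ℕ,
          AlmostDegree.IsStrictGraphicOfType ε ν D →
            AlmostDegree.treeError a k D ≤ c * (n : ℝ) ^ (a - (ν + 1) / 2)) ∧
        Filter.Tendsto (fun n : ℕ => c * (n : ℝ) ^ (a - (ν + 1) / 2))
          Filter.atTop (nhds 0) := by
  have hC := AlmostDegree.one_le_coeffBound k
  refine ⟨2 * AlmostDegree.coeffBound k, by linarith, fun ε ν a _ hν ha haν => ⟨?_, ?_⟩⟩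
  · have hsix : ∀ᶠ n : ℕ in Filter.atTop, 6 < (n : ℝ) ^ (ν * a) :=
      ((tendsto_rpow_atTop (by positivity : 0 < ν * a)).comp
        tendsto_natCast_atTop_atTop).eventually_gt_atTop 6
    obtain ⟨N, hN⟩ := Filter.eventually_atTop.1 (((hsix.and
      (AlmostDegree.eventually_mul_log_le (by norm_num : (0 : ℝ) < 32)
        (mul_pos hν (by linarith : 0 < 2 * a - 1)))).and
      (AlmostDegree.eventually_mul_log_le (by norm_num : (0 : ℝ) < 308)
        (by linarith : 0 < a - 1 / 2))).and (Filter.eventually_ge_atTop 4))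
    refine ⟨N, fun n hn D hD => ?_⟩
    obtain ⟨⟨⟨h1, h2⟩, h3⟩, h4⟩ := hN n hn
    exact hD.treeError_le hν ha haν h4 h1 h2 h3
  -- The exponent is negative because a < ν/4 + 1/2 < (ν + 1)/2.
  · have h := (tendsto_rpow_neg_atTop (by linarith : 0 < (ν + 1) / 2 - a)).comp
      (tendsto_natCast_atTop_atTop (R := ℝ))
    have h2 := h.const_mul (2 * AlmostDegree.coeffBound k)
    rw [mul_zero] at h2
    refine h2.congr fun n => ?_
    simp only [Function.comp_apply, neg_sub]
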